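/- **Setting.** Let $a,b,c\in C^\infty(\mathbb R^n)$ satisfy, with positive constants $a_i,b_i,c_i$, $$a_0(1+|x|)^{-\alpha}\le a(x)\le a_1(1+|x|)^{-\alpha},\quad b_0(1+|x|)^{\beta}\le b(x)\le b_1(1+|x|)^{\beta},\quad c_0(1+|x|)^{-\gamma}\le c(x)\le c_1(1+|x|)^{-\gamma},$$ where $\beta+\gamma<2$ and $2\alpha+\beta-\gamma<2$. Let $R>0$ and let $q\in C^1([0,\infty))$ satisfy $0<q'(|x|)\le\sqrt{c(x)/b(x)}$ for all $x\in\mathbb R^n$ and $q(r)\ge q_0r^{1-(\beta+\gamma)/2}$ for all $r\ge 0$, with some $q_0>0$. Write $Mw=a^{-1}\operatorname{div}(b\nabla w)$ (in the sense of distributions). For $m\ge 1$, a *solution of order $m$* is a function $u\in C^m([0,\infty);H^1(\mathbb R^n))\cap C^{m+1}([0,\infty);L^2(\mathbb R^n))$ that satisfies $$c\,u_{tt}-\operatorname{div}(b\nabla u)+a\,u_t=h$$ weakly in $x$ for every $t\ge 0$, where $u(\cdot,0)$ and $u_t(\cdot,0)$ vanish for $|x|>R$, and $h\in C^m([0,\infty)\times\mathbb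 R^n)$ vanishes for $q(|x|)>t+q(R)$. Put $$E(t;\partial_t^iu)=\tfrac12\int\big(c\,(\partial_t^{i+1}u)^2+b\,|\nabla\partial_t^iu|^2\big)\,dx .$$ Let $\lambda_1,\lambda_2\in[0,1]$ and let $K_1,K_2$ be constants. Consider the conditions, for all $t\ge 0$, $$\text{(CC1)}\quad \sup_{x\in\operatorname{supp}u(\cdot,t)}\Big[\frac{c}{a}+\frac ba\Big|\nabla\frac ca\Big|^2\Big]\le K_1(1+t)^{\lambda_1},\qquad \text{(CC2)}\quad \sup_{x\in\operatorname{supp}u(\cdot,t)}\Big[\frac1a\operatorname{div}\Big(b\nabla\frac ca\Big)\Big]^2\le K_2(1+t)^{\lambda_2}.$$ **Proposition 4.2.** Let $\theta>0$ and $T_0\ge 0$. There is a constant $C$, depending on $n,a,b,c,q,R,\theta,\lambda_1,\lambda_2,K_1,K_2,T_0$ but not on $u$, $h$ and $T$, such that the following holds. (i) If $u$ is a solution of order $1$ with source $h$ and (CC1) holds, then $Mu(\cdot,t)$ is a (locally integrable) function for every $t\ge 0$, and for all $T\ge T_0$ $$\int_{T_0}^T\!\!\int(1+t)^{\theta+1}a(Mu)^2\,dx\,dt\le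 C\Big[(1+T_0)^{\theta+1}\sum_{i=0}^1E(T_0;\partial_t^iu)+\int_{T_0}^T(1+t)^\theta E(t;u)\,dt+\int_{T_0}^T\!\!\int(1+t)^{\theta+1}\sum_{i=0}^1\frac{(1+t)^{2i}(\partial_t^ih)^2}{a}\,dx\,dt\Big].$$ (ii) If $u$ is a solution of order $3$ with source $h$ and (CC1), (CC2) hold, then $Mu(\cdot,t)$ and $M^2u(\cdot,t)$ are (locally integrable) functions for every $t\ge 0$, and for all $T\ge T_0$ $$\int_{T_0}^T\!\!\int(1+t)^{\theta+3-\lambda_2}a(M^2u)^2\,dx\,dt\le C\Big[(1+T_0)^{\theta+3}\sum_{i=0}^3E(T_0;\partial_t^iu)+\int_{T_0}^T(1+t)^\theta E(t;u)\,dt+\int_{T_0}^T\!\!\int(1+t)^{\theta+1}\sum_{i=0}^3\frac{(1+t)^{2i}(\partial_t^ih)^2}{a}\,dx\,dt$$ $$\qquad\qquad+\int_{T_0}^T\!\!\int(1+t)^{\theta+3-\lambda_2}\Big[\frac{h_t^2}{a}+(1+t)^{2\lambda_1}\frac{h_{tt}^2}{a}+a\Big(M\frac ha\Big)^2\Big]dx\,dt\Big].$$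 -/

import Mathlib

open MeasureTheory Set Topology
open scoped ENNReal NNReal ContDiff Gradient

noncomputable section

namespace DampedWave

/-- The space `ℝⁿ` with its Euclidean norm. -/
abbrev Sp (n : ℕ) : Type := EuclideanSpace ℝ (Fin n)

/-- The space `L²(ℝⁿ)` of real functions. -/
abbrev L2 (n : ℕ) : Type := Lp ℝ 2 (volume : Measure (Sp n))

/-- The space `L²(ℝⁿ; ℝⁿ)` of vector fields. -/
abbrev L2Vec (n : ℕ) : Type := Lp (Sp n) 2 (volume : Measure (Sp n))

variable {n : ℕ}

/-- Two-sided power bound `f₀ (1+|x|)^e ≤ f(x) ≤ f₁ (1+|x|)^e`. -/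
def PowerGrowth (f : Sp n → ℝ) (f₀ f₁ e : ℝ) : Prop :=
  ∀ x, f₀ * (1 + ‖x‖) ^ e ≤ f x ∧ f x ≤ f₁ * (1 + ‖x‖) ^ e

/-- The classical divergence of a vector field on `ℝⁿ`. -/
def divergence (F : Sp n → Sp n) (x : Sp n) : ℝ :=
  ∑ i : Fin n, fderiv ℝ (fun y => F y i) x (EuclideanSpace.single i 1)

/-- `div (b ∇ φ)`, for a `C²` function `φ`. -/
def divGrad (b φ : Sp n → ℝ) : Sp n → ℝ :=
  divergence (fun y => b y • ∇ φ y)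

/-- `M φ = a⁻¹ div (b ∇ φ)`, for a `C²` function `φ`. -/
def opM (a b φ : Sp n → ℝ) (x : Sp n) : ℝ := (a x)⁻¹ * divGrad b φ x

/-- Test functions: `C_c^∞(ℝⁿ)`. -/
def IsTest (φ : Sp n → ℝ) : Prop := ContDiff ℝ ∞ φ ∧ HasCompactSupport φ

/-- `g` is the weak gradient of `f` (both are locally integrable in all uses). -/
def IsWeakGradient (f : Sp n → ℝ) (g : Sp n → Sp n) : Prop :=
  ∀ φ : Sp n → ℝ, IsTest φ → ∫ x, f x • ∇ φ x = - ∫ x, φ x • g x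

/-- `M f = w` in the weak sense: `w` is locally integrable and `div (b ∇ f) = a w` in the sense
of distributions.  Such a `w` is unique up to null sets. -/
def IsWeakM (a b f w : Sp n → ℝ) : Prop :=
  LocallyIntegrable f ∧ LocallyIntegrable w ∧
    ∀ φ : Sp n → ℝ, IsTest φ → ∫ x, f x * divGrad b φ x = ∫ x, a x * w x * φ x

/-- The support of a measurable function: the complement of the largest open set on which
the function vanishes almost everywhere. -/
def essSupport (f : Sp n → ℝ) : Set (Sp n) :=
  {x | ¬ ∃ U ∈ 𝓝 x, ∀ᵐ y, y ∈ U → f y = 0}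

/-- The `j`-th time derivative at time `t` of a curve defined on `[0, ∞)`. -/
def dt {F : Type*} [NormedAddCommGroup F] [NormedSpace ℝ F] (j : ℕ) (f : ℝ → F) (t : ℝ) : F :=
  iteratedDerivWithin j f (Ici 0) t

/-- The `k`-th order energy
`E(t; ∂_t^k u) = (1/2) ∫ (c (∂_t^{k+1} u)² + b |∇ ∂_t^k u|²) dx`, where `g = ∇u`. -/
def energy (b c : Sp n → ℝ) (u : ℝ → L2 n) (g : ℝ → L2Vec n) (k : ℕ) (t : ℝ) : ℝ≥0∞ :=
  ∫⁻ x, ENNReal.ofReal ((c x * (dt (k + 1) u t x) ^ 2 + b x * ‖dt k g t x‖ ^ 2) / 2)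

/-- `q` measures the propagation of the support: `q ∈ C¹([0, ∞))`,
`0 < q'(|x|) ≤ √(c(x)/b(x))` and `q(r) ≥ q₀ r^p`. -/
structure IsSpeedBound (b c : Sp n → ℝ) (q : ℝ → ℝ) (q₀ p : ℝ) : Prop where
  contDiffOn : ContDiffOn ℝ 1 q (Ici 0)
  deriv_pos : ∀ r : ℝ, 0 ≤ r → 0 < derivWithin q (Ici 0) r
  deriv_le : ∀ x : Sp n, derivWithin q (Ici 0) ‖x‖ ≤ √(c x / b x)
  lower : ∀ r : ℝ, 0 ≤ r → q₀ * r ^ p ≤ q r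

/-- `u` (with spatial gradient `g`) is a solution on `[0, ∞) × ℝⁿ` of
`c u_tt - div (b ∇ u) + a u_t = h` for which `u, ∂_t u, …, ∂_t^m u` (`m ≥ 1`) are all of finite
energy, i.e. `u ∈ C^m([0, ∞); H¹) ∩ C^{m+1}([0, ∞); L²)`.  The source `h` is of class `C^m`, the
initial data vanish for `|x| > R`, and `h(x, t)` vanishes for `q(|x|) > t + q(R)`. -/
structure IsSolution (m : ℕ) (a b c : Sp n → ℝ) (q : ℝ → ℝ) (R : ℝ)
    (h : ℝ → Sp n → ℝ) (u : ℝ → L2 n) (g : ℝ → L2Vec n) : Prop where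
  contDiffOn_source : ContDiffOn ℝ m (fun p : ℝ × Sp n => h p.1 p.2) (Ici 0 ×ˢ univ)
  source_support : ∀ t : ℝ, 0 ≤ t → ∀ x : Sp n, t + q R < q ‖x‖ → h t x = 0
  contDiffOn_u : ContDiffOn ℝ (m + 1) u (Ici 0)
  contDiffOn_grad : ContDiffOn ℝ m g (Ici 0)
  weak_gradient : ∀ t : ℝ, 0 ≤ t → IsWeakGradient (u t) (g t)
  data_support : ∀ᵐ x : Sp n, R < ‖x‖ → u 0 x = 0 ∧ dt 1 u 0 x = 0
  equation : ∀ t : ℝ, 0 ≤ t → ∀ φ : Sp n → ℝ, IsTest φ →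
    ∫ x, (c x * dt 2 u t x * φ x + b x * inner ℝ (g t x) (∇ φ x) + a x * dt 1 u t x * φ x)
      = ∫ x, h t x * φ x

/-- `sup_{x ∈ supp u(·,t)} [c/a + (b/a) |∇(c/a)|²] ≤ K (1+t)^lam` for all `t ≥ 0`. -/
def CoeffCond1 (a b c : Sp n → ℝ) (lam K : ℝ) (u : ℝ → L2 n) : Prop :=
  ∀ t : ℝ, 0 ≤ t → ∀ x ∈ essSupport (u t),
    c x / a x + b x / a x * ‖∇ (fun y => c y / a y) x‖ ^ 2 ≤ K * (1 + t) ^ lam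

/-- `sup_{x ∈ supp u(·,t)} [a⁻¹ div (b ∇(c/a))]² ≤ K (1+t)^lam` for all `t ≥ 0`. -/
def CoeffCond2 (a b c : Sp n → ℝ) (lam K : ℝ) (u : ℝ → L2 n) : Prop :=
  ∀ t : ℝ, 0 ≤ t → ∀ x ∈ essSupport (u t),
    (opM a b (fun y => c y / a y) x) ^ 2 ≤ K * (1 + t) ^ lam

/-- The weighted source term
`∫_{T₀}^T ∫ (1+t)^{θ+1} ∑_{i=0}^k (1+t)^{2i} (∂_t^i h)² / a dx dt`. -/
def sourceTerm (a : Sp n → ℝ) (θ : ℝ) (h : ℝ → Sp n → ℝ) (k : ℕ) (T₀ T : ℝ) : ℝ≥0∞ :=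
  ∫⁻ t in Icc T₀ T, ∫⁻ x, ENNReal.ofReal ((1 + t) ^ (θ + 1) *
    ∑ i ∈ Finset.range (k + 1), (1 + t) ^ (2 * i) * (dt i (fun s => h s x) t) ^ 2 / a x)

end DampedWave

end

open DampedWave

/-!
The estimates come from the weighted energy method, applied to all the time derivatives of `u` at
once, and from trading each application of `M` for time derivatives by means of the equation.

*The equation as a formula for `M`.*  The equation says that
`M u = (c / a) u_tt + u_t - h / a`.  Applying `M` once more, by the product rule with the smooth
factor `c / a` and by the same formula for `M u_t` and `M u_tt`,
`M² u = (c / a) M u_tt + 2 (b / a) ⟨∇ (c / a), ∇ u_tt⟩ + u_tt M (c / a) + M u_t - M (h / a)`.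
So `M u` and `M² u` are functions (`IsSolution.isWeakM_zero`, `IsSolution.isWeakM_spatialM`), and
their weighted norms are controlled by those of at most four time derivatives of `u`, of `∇ u_tt`
and of the source.  The conditions on `∇ (c / a)` and `M (c / a)` hold on the support of `u`, which
suffices because `M² u` vanishes outside of it (`IsWeakM.eq_zero_of_notMem_essSupport`).

*The light cone.*  An energy identity with a weight localized in `q |x| > t + q R`, together with
`|∇ q| ≤ √(c / b)`, shows that `u_t` and `∇ u` vanish there (`finite_speed`), hence so do their time
derivatives.  The cone is bounded at each time, and in it `c / a = O((1 + |x|)^(α - γ))` while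
`(1 + |x|)^(1 - (β + γ) / 2) = O(1 + t)`; thus `2 α + β - γ < 2` makes `c / a = o(t)`
(`effectiveDamping_of_growth`).

*Weighted energies.*  Let `K`, `P`, `D` be the kinetic energy `∫ c (∂_t^{j+1} u)²`, the potential
energy `∫ b |∇ ∂_t^j u|²` and the dissipation `∫ a (∂_t^{j+1} u)²` of order `j`, and let `K'`, `D'`
be those of order `j - 1`.  Then `(K + P)' = -2 D + source`, and testing with `∂_t^j u` gives the
virial identity `(∫ c ∂_t^{j+1} u ∂_t^j u + D' / 2)' = K - P + source`.  For `w = A + t` and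
`s = θ + 2 j + 1` the derivative of
`w^s (K + P) / 2 + s w^(s-1) (∫ c ∂_t^{j+1} u ∂_t^j u + D' / 2)`
contains `-w^s D - (s / 2) w^(s-1) P`.  All the terms with `K` are absorbed by the dissipation since
`K ≤ ε w D`, and the remaining ones are `w^(s-2) D'`, `w^(s-3) K'` and the source: these are
controlled by the estimate of order `j - 1`, whose exponent is `s - 2` (`level_step`).  Induction on
`j`, starting from the given `∫ (1 + t)^θ E(t; u)`, yields `level_estimate`.

*Regularity.*  A solution of order `m` has `m + 1` time derivatives in `L²`, while the identities of
order `j = m` formally involve `∂_t^{m+2} u`.  The energy identity of order `m` is therefore obtained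
as a limit of the identities for difference quotients of `∂_t^{m-1} u`
(`AbstractWave.energy_deriv_sub`), and the virial identity by differentiating the tested equation of
order `m - 1` (`AbstractWave.hasDerivWithinAt_virial`).  Testing the equation, given for smooth
functions, with functions of `H¹` rests on the duality between the weak gradient and the weak
divergence, `inner_add_inner_eq_zero_of_weak`.
-/

noncomputable section

namespace DampedWave

open Filter BoundedContinuousFunction

/-! ### Multiplication by bounded continuous functions on `L²` -/

section

variable {n : ℕ}

section Mul

variable {E : Type*} [NormedAddCommGroup E] [InnerProductSpace ℝ E]

lemma memLp_bcf_smul (P : Sp n →ᵇ ℝ) (f : Lp E 2 (volume : Measure (Sp n))) :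
    MemLp (fun x => P x • f x) 2 volume :=
  (Lp.memLp f).of_le_mul (c := ‖P‖)
    ((P.continuous.aestronglyMeasurable).smul (Lp.aestronglyMeasurable f))
    (Eventually.of_forall fun x => by
      rw [norm_smul]; gcongr; exact P.norm_coe_le_norm x)

/-- Multiplication of square integrable functions by bounded continuous functions, as a
continuous bilinear map. -/
def mulL (E : Type*) [NormedAddCommGroup E] [InnerProductSpace ℝ E] :
    (Sp n →ᵇ ℝ) →L[ℝ] Lp E 2 (volume : Measure (Sp n)) →L[ℝ] Lp E 2 (volume : Measure (Sp n)) :=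
  LinearMap.mkContinuous₂
    (LinearMap.mk₂ ℝ (fun P f => (memLp_bcf_smul P f).toLp _)
      (fun P Q f => by
        ext1
        filter_upwards [(memLp_bcf_smul (P + Q) f).coeFn_toLp, (memLp_bcf_smul P f).coeFn_toLp,
          (memLp_bcf_smul Q f).coeFn_toLp, Lp.coeFn_add ((memLp_bcf_smul P f).toLp _)
          ((memLp_bcf_smul Q f).toLp _)] with x h1 h2 h3 h4
        rw [h1, h4, Pi.add_apply, h2, h3, BoundedContinuousFunction.add_apply, add_smul])
      (fun r P f => by
        ext1
        filter_upwards [(memLp_bcf_smul (r • P) f).coeFn_toLp, (memLp_bcf_smul P f).coeFn_toLp,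
          Lp.coeFn_smul r ((memLp_bcf_smul P f).toLp _)] with x h1 h2 h4
        rw [h1, h4, Pi.smul_apply, h2, BoundedContinuousFunction.smul_apply, smul_assoc])
      (fun P f g => by
        ext1
        filter_upwards [(memLp_bcf_smul P (f + g)).coeFn_toLp, (memLp_bcf_smul P f).coeFn_toLp,
          (memLp_bcf_smul P g).coeFn_toLp, Lp.coeFn_add ((memLp_bcf_smul P f).toLp _)
          ((memLp_bcf_smul P g).toLp _), Lp.coeFn_add f g] with x h1 h2 h3 h4 h5
        simp only [h1, h4, Pi.add_apply, h2, h3, h5, smul_add])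
      (fun r P f => by
        ext1
        filter_upwards [(memLp_bcf_smul P (r • f)).coeFn_toLp, (memLp_bcf_smul P f).coeFn_toLp,
          Lp.coeFn_smul r ((memLp_bcf_smul P f).toLp _), Lp.coeFn_smul r f] with x h1 h2 h4 h5
        simp only [h1, h4, Pi.smul_apply, h2, h5, smul_comm r]))
    1 (fun P f => by
      simp only [LinearMap.mk₂_apply, one_mul]
      refine Lp.norm_le_mul_norm_of_ae_le_mul ?_
      filter_upwards [(memLp_bcf_smul P f).coeFn_toLp] with x hx
      rw [hx, norm_smul]
      gcongr
      exact P.norm_coe_le_norm x)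

lemma coeFn_mulL (P : Sp n →ᵇ ℝ) (f : Lp E 2 (volume : Measure (Sp n))) :
    mulL E P f =ᵐ[volume] fun x => P x • f x :=
  (memLp_bcf_smul P f).coeFn_toLp

lemma inner_mulL (P : Sp n →ᵇ ℝ) (f g : Lp E 2 (volume : Measure (Sp n))) :
    inner ℝ (mulL E P f) g = ∫ x, P x * inner ℝ (f x) (g x) := by
  rw [L2.inner_def]
  refine integral_congr_ae ?_
  filter_upwards [coeFn_mulL P f] with x hx
  rw [hx, real_inner_smul_left]

lemma inner_mulL_right (P : Sp n →ᵇ ℝ) (f g : Lp E 2 (volume : Measure (Sp n))) :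
    inner ℝ f (mulL E P g) = inner ℝ (mulL E P f) g := by
  rw [real_inner_comm, inner_mulL, inner_mulL]
  simp only [real_inner_comm]

lemma integrable_bcf_mul_inner (P : Sp n →ᵇ ℝ) (f g : Lp E 2 (volume : Measure (Sp n))) :
    Integrable (fun x => P x * inner ℝ (f x) (g x)) := by
  refine (L2.integrable_inner (𝕜 := ℝ) (mulL E P f) g).congr ?_
  filter_upwards [coeFn_mulL P f] with x hx
  rw [hx, real_inner_smul_left]

end Mul

/-- A continuous function with compact support, as a bounded continuous function. -/
def bcfOfCompact (f : Sp n → ℝ) (hf : Continuous f) (hs : HasCompactSupport f) : Sp n →ᵇ ℝ :=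
  BoundedContinuousFunction.ofNormedAddCommGroup f hf
    (hs.exists_bound_of_continuous hf).choose
    (hs.exists_bound_of_continuous hf).choose_spec

@[simp] lemma bcfOfCompact_apply (f : Sp n → ℝ) (hf : Continuous f) (hs : HasCompactSupport f)
    (x : Sp n) : bcfOfCompact f hf hs x = f x := rfl

/-! ### Translations in `L²` and the duality between weak gradient and weak divergence -/

/-- The translate `x ↦ f (z + x)` of `f ∈ L²`. -/
def translate (f : L2 n) (z : Sp n) : L2 n := DomAddAct.mk z +ᵥ f

lemma continuous_translate (f : L2 n) : Continuous (translate f) := by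
  unfold translate
  have : Fact ((2 : ℝ≥0∞) ≠ ⊤) := ⟨by norm_num⟩
  have h2 : Continuous fun z : Sp n => DomAddAct.mk z := continuous_induced_rng.2 continuous_id
  exact h2.vadd continuous_const

lemma translate_zero (f : L2 n) : translate f 0 = f := by
  ext1
  exact (DomAddAct.vadd_Lp_ae_eq (DomAddAct.mk (0 : Sp n)) f).trans (by simp)

lemma coeFn_translate (f : L2 n) (z : Sp n) : translate f z =ᵐ[volume] fun x => f (z + x) :=
  DomAddAct.vadd_Lp_ae_eq (DomAddAct.mk z) f

/-- The integrand of the correlations of two functions in `L²` against a test function, for Fubini's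
theorem. -/
lemma integrable_kernel {η : Sp n → ℝ} (hη : Continuous η) (hs : HasCompactSupport η)
    (f g : L2 n) :
    Integrable (fun p : Sp n × Sp n => η p.1 * (f (p.1 + p.2) * g p.2))
      ((volume : Measure (Sp n)).prod volume) := by
  have hi : Integrable (fun x => |η x|) := (hη.integrable_of_hasCompactSupport hs).abs
  have hg : Integrable (fun p : Sp n × Sp n => |η p.1| * (g p.2) ^ 2)
      ((volume : Measure (Sp n)).prod volume) := hi.mul_prod (Lp.memLp g).integrable_sq
  have hf : Integrable (fun p : Sp n × Sp n => |η p.1| * (f (p.1 + p.2)) ^ 2)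
      ((volume : Measure (Sp n)).prod volume) :=
    (measurePreserving_prod_add (volume : Measure (Sp n)) volume).integrable_comp_of_integrable
      (hi.mul_prod (Lp.memLp f).integrable_sq)
  have hfm : AEStronglyMeasurable (fun p : Sp n × Sp n => f (p.1 + p.2))
      ((volume : Measure (Sp n)).prod volume) :=
    ((Lp.aestronglyMeasurable f).comp_snd (μ := (volume : Measure (Sp n)))).comp_measurePreserving
      (measurePreserving_prod_add (volume : Measure (Sp n)) volume)
  refine (hg.add hf).mono' ?_ ?_
  · exact (hη.comp continuous_fst).aestronglyMeasurable.mul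
      (hfm.mul (Lp.aestronglyMeasurable g).comp_snd)
  · refine Eventually.of_forall fun p => ?_
    simp only [Pi.add_apply, Real.norm_eq_abs, abs_mul]
    have : |f (p.1 + p.2)| * |g p.2| ≤ g p.2 ^ 2 + f (p.1 + p.2) ^ 2 := by
      nlinarith [sq_nonneg (|f (p.1 + p.2)| - |g p.2|), sq_abs (f (p.1 + p.2)), sq_abs (g p.2)]
    nlinarith [abs_nonneg (η p.1)]

lemma integral_translate_eq_left {η : Sp n → ℝ} (hη : Continuous η) (hs : HasCompactSupport η)
    (f g : L2 n) :
    ∫ z, η z * inner ℝ (translate f z) g = ∫ y, g y * ∫ x, η (x - y) * f x := by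
  have h1 : ∀ z, η z * inner ℝ (translate f z) g = ∫ y, η z * (f (z + y) * g y) := by
    intro z
    rw [L2.inner_def, ← integral_const_mul]
    refine integral_congr_ae ?_
    filter_upwards [coeFn_translate f z] with y hy
    rw [hy]; simp [mul_comm]
  simp_rw [h1]
  rw [integral_integral_swap (integrable_kernel hη hs f g)]
  refine integral_congr_ae (Eventually.of_forall fun y => ?_)
  simp only
  rw [← integral_add_right_eq_self (fun x => η (x - y) * f x) y, ← integral_const_mul]
  refine integral_congr_ae (Eventually.of_forall fun x => ?_)
  simp only [add_sub_cancel_right]; ring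

lemma integral_translate_eq_right {η : Sp n → ℝ} (hη : Continuous η) (hs : HasCompactSupport η)
    (f g : L2 n) :
    ∫ z, η z * inner ℝ (translate f z) g = ∫ x, f x * ∫ y, η (x - y) * g y := by
  have hmp : MeasurePreserving (fun p : Sp n × Sp n => (p.1 - p.2, p.2))
      ((volume : Measure (Sp n)).prod volume) (volume.prod volume) :=
    measurePreserving_sub_prod volume volume
  have hint := hmp.integrable_comp_of_integrable (integrable_kernel hη hs f g)
  have hint' : Integrable (fun p : Sp n × Sp n => η (p.1 - p.2) * (f p.1 * g p.2))
      ((volume : Measure (Sp n)).prod volume) := by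
    simpa [Function.comp_def] using hint
  rw [integral_translate_eq_left hη hs]
  simp_rw [← integral_const_mul]
  have := integral_integral_swap (f := fun x y => η (x - y) * (f x * g y)) hint'
  calc _ = ∫ y, ∫ x, η (x - y) * (f x * g y) := by
        refine integral_congr_ae (Eventually.of_forall fun y => integral_congr_ae
          (Eventually.of_forall fun x => ?_))
        simp only; ring
    _ = _ := by
        rw [← this]
        refine integral_congr_ae (Eventually.of_forall fun y => integral_congr_ae
          (Eventually.of_forall fun x => ?_))
        simp only; ring

end

/-! ### Partial derivatives and weak gradients -/

section

variable {n : ℕ}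

/-- The partial derivative in the `i`-th coordinate direction. -/
def pd (i : Fin n) (φ : Sp n → ℝ) (x : Sp n) : ℝ := fderiv ℝ φ x (EuclideanSpace.single i 1)

lemma inner_gradient (φ : Sp n → ℝ) (x v : Sp n) : inner ℝ (∇ φ x) v = fderiv ℝ φ x v := by
  simp [gradient]

lemma gradient_apply (φ : Sp n → ℝ) (x : Sp n) (i : Fin n) : (∇ φ x) i = pd i φ x := by
  rw [pd, ← inner_gradient, EuclideanSpace.inner_single_right]
  simp

lemma norm_gradient (φ : Sp n → ℝ) (x : Sp n) : ‖∇ φ x‖ = ‖fderiv ℝ φ x‖ := by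
  simp [gradient]

lemma inner_eq_sum (v w : Sp n) : inner ℝ v w = ∑ i, v i * w i := by
  simp [PiLp.inner_apply, mul_comm]

lemma inner_gradient_eq_sum (φ : Sp n → ℝ) (x v : Sp n) :
    inner ℝ v (∇ φ x) = ∑ i, v i * pd i φ x := by
  simp only [inner_eq_sum, gradient_apply]

lemma continuous_gradient {φ : Sp n → ℝ} (hφ : ContDiff ℝ 1 φ) : Continuous (∇ φ) :=
  (InnerProductSpace.toDual ℝ (Sp n)).symm.continuous.comp
    (hφ.continuous_fderiv (by norm_num))

lemma support_gradient {φ : Sp n → ℝ} : tsupport (∇ φ) ⊆ tsupport φ := by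
  refine closure_minimal (fun x hx => ?_) (isClosed_tsupport _)
  refine support_fderiv_subset ℝ (f := φ) ?_
  intro h
  exact hx (by simp [gradient, h])

lemma continuous_pd {φ : Sp n → ℝ} (hφ : ContDiff ℝ 1 φ) (i : Fin n) : Continuous (pd i φ) :=
  (hφ.continuous_fderiv (by norm_num)).clm_apply continuous_const

lemma contDiff_pd {φ : Sp n → ℝ} {k m : ℕ∞ω} (hφ : ContDiff ℝ m φ) (hk : k + 1 ≤ m) (i : Fin n) :
    ContDiff ℝ k (pd i φ) :=
  (hφ.fderiv_right hk).clm_apply contDiff_const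

lemma hasCompactSupport_pd {φ : Sp n → ℝ} (hs : HasCompactSupport φ) (i : Fin n) :
    HasCompactSupport (pd i φ) :=
  hs.fderiv_apply ℝ _

lemma IsTest.continuous {φ : Sp n → ℝ} (h : IsTest φ) : Continuous φ := h.1.continuous

lemma IsTest.one {φ : Sp n → ℝ} (h : IsTest φ) : ContDiff ℝ 1 φ := h.1.of_le (by simp)

lemma IsTest.pd {φ : Sp n → ℝ} (h : IsTest φ) (i : Fin n) : IsTest (pd i φ) :=
  ⟨contDiff_pd h.1 (by simp) i, hasCompactSupport_pd h.2 i⟩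

lemma IsTest.mul_left {φ ψ : Sp n → ℝ} (h : IsTest φ) (hψ : ContDiff ℝ ∞ ψ) :
    IsTest (fun x => ψ x * φ x) :=
  ⟨hψ.mul h.1, h.2.mul_left⟩

lemma pd_mul {φ ψ : Sp n → ℝ} {x : Sp n} (hφ : DifferentiableAt ℝ φ x)
    (hψ : DifferentiableAt ℝ ψ x) (i : Fin n) :
    pd i (fun y => φ y * ψ y) x = φ x * pd i ψ x + ψ x * pd i φ x := by
  simp [pd, fderiv_fun_mul hφ hψ]

lemma gradient_mul {φ ψ : Sp n → ℝ} {x : Sp n} (hφ : DifferentiableAt ℝ φ x)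
    (hψ : DifferentiableAt ℝ ψ x) :
    ∇ (fun y => φ y * ψ y) x = φ x • ∇ ψ x + ψ x • ∇ φ x := by
  ext i
  simp [gradient_apply, pd_mul hφ hψ]

lemma IsTest.comp_sub_const {η : Sp n → ℝ} (h : IsTest η) (y : Sp n) :
    IsTest (fun x => η (x - y)) :=
  ⟨h.1.comp (contDiff_id.sub contDiff_const),
    h.2.comp_homeomorph (Homeomorph.subRight y)⟩

lemma IsTest.comp_const_sub {η : Sp n → ℝ} (h : IsTest η) (y : Sp n) :
    IsTest (fun x => η (y - x)) :=
  ⟨h.1.comp (contDiff_const.sub contDiff_id),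
    h.2.comp_homeomorph (Homeomorph.subLeft y)⟩

lemma pd_comp_sub_const (η : Sp n → ℝ) (y x : Sp n) (i : Fin n) :
    pd i (fun x => η (x - y)) x = pd i η (x - y) := by
  simp [pd, fderiv_comp_sub]

lemma pd_comp_const_sub {η : Sp n → ℝ} (h : IsTest η) (y x : Sp n) (i : Fin n) :
    pd i (fun x => η (y - x)) x = - pd i η (y - x) := by
  have h1 : HasFDerivAt (fun x => y - x) (-ContinuousLinearMap.id ℝ (Sp n)) x :=
    (hasFDerivAt_id x).const_sub y
  have h2 := ((h.one.differentiable (by norm_num) (y - x)).hasFDerivAt.comp x h1).fderiv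
  simp only [Function.comp_def] at h2
  simp [pd, h2]

/-- A continuous function with compact support, as an element of `L²`. -/
def ccL2 (φ : Sp n → ℝ) (hφ : Continuous φ) (hs : HasCompactSupport φ) : L2 n :=
  (hφ.memLp_of_hasCompactSupport hs).toLp φ

lemma coeFn_ccL2 (φ : Sp n → ℝ) (hφ : Continuous φ) (hs : HasCompactSupport φ) :
    ccL2 φ hφ hs =ᵐ[volume] φ :=
  (hφ.memLp_of_hasCompactSupport hs).coeFn_toLp

lemma inner_ccL2 (φ : Sp n → ℝ) (hφ : Continuous φ) (hs : HasCompactSupport φ) (f : L2 n) :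
    inner ℝ (ccL2 φ hφ hs) f = ∫ x, φ x * f x := by
  rw [L2.inner_def]
  refine integral_congr_ae ?_
  filter_upwards [coeFn_ccL2 φ hφ hs] with x hx
  rw [hx]; simp [mul_comm]

/-- The `i`-th component of a square integrable vector field. -/
def compL (i : Fin n) : L2Vec n →L[ℝ] L2 n :=
  (EuclideanSpace.proj i : Sp n →L[ℝ] ℝ).compLpL 2 volume

lemma coeFn_compL (i : Fin n) (G : L2Vec n) : compL i G =ᵐ[volume] fun x => G x i :=
  ContinuousLinearMap.coeFn_compLpL _ _

lemma inner_eq_sum_compL (G H : L2Vec n) :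
    inner ℝ G H = ∑ i, inner ℝ (compL i G) (compL i H) := by
  simp_rw [L2.inner_def]
  rw [← integral_finsetSum _ (fun i _ => L2.integrable_inner _ _)]
  refine integral_congr_ae ?_
  filter_upwards [eventually_all.2 fun i => coeFn_compL i G,
    eventually_all.2 fun i => coeFn_compL i H] with x h1 h2
  simp only [inner_eq_sum, h1, h2]
  simp [mul_comm]

lemma integrable_cc_mul {φ : Sp n → ℝ} (hφ : Continuous φ) (hs : HasCompactSupport φ) (f : L2 n) :
    Integrable (fun x => φ x * f x) :=
  MemLp.integrable_mul (p := 2) (q := 2) (hφ.memLp_of_hasCompactSupport hs) (Lp.memLp f)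

lemma integrable_cc_smul {φ : Sp n → ℝ} (hφ : Continuous φ) (hs : HasCompactSupport φ)
    (G : L2Vec n) : Integrable (fun x => φ x • G x) := by
  have : Integrable ((φ : Sp n → ℝ) • (G : Sp n → Sp n)) :=
    memLp_one_iff_integrable.1 ((Lp.memLp G).smul
      (hφ.memLp_of_hasCompactSupport (p := 2) hs))
  exact this

lemma integrable_smul_gradient {φ : Sp n → ℝ} (hφ : ContDiff ℝ 1 φ) (hs : HasCompactSupport φ)
    (f : L2 n) : Integrable (fun x => f x • ∇ φ x) := by
  have h1 : HasCompactSupport (∇ φ) := hs.mono' (subset_closure.trans support_gradient)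
  have : Integrable ((f : Sp n → ℝ) • (∇ φ)) :=
    memLp_one_iff_integrable.1 (((continuous_gradient hφ).memLp_of_hasCompactSupport
      (p := 2) h1).smul (Lp.memLp f))
  exact this

/-- The weak gradient, component by component. -/
lemma isWeakGradient_iff {v : L2 n} {w : L2Vec n} :
    IsWeakGradient v w ↔ ∀ φ, IsTest φ → ∀ i,
      ∫ x, pd i φ x * v x = - ∫ x, φ x * compL i w x := by
  refine forall₂_congr fun φ hφ => ?_
  have hpr : ∀ i, ∫ x, pd i φ x * v x = (∫ x, v x • ∇ φ x) i := by
    intro i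
    have := (EuclideanSpace.proj i : Sp n →L[ℝ] ℝ).integral_comp_comm
      (integrable_smul_gradient hφ.one hφ.2 v)
    simp only [PiLp.proj_apply] at this
    rw [← this]
    refine integral_congr_ae (Eventually.of_forall fun x => ?_)
    simp [gradient_apply, mul_comm]
  have hpl : ∀ i, ∫ x, φ x * compL i w x = (∫ x, φ x • w x) i := by
    intro i
    have := (EuclideanSpace.proj i : Sp n →L[ℝ] ℝ).integral_comp_comm
      (integrable_cc_smul hφ.continuous hφ.2 w)
    simp only [PiLp.proj_apply] at this
    rw [← this]
    refine integral_congr_ae ?_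
    filter_upwards [coeFn_compL i w] with x hx
    simp [hx]
  simp_rw [hpr, hpl]
  constructor
  · intro h i; rw [h]; simp
  · intro h; ext i; rw [h]; simp

/-- Duality between the weak divergence and the weak gradient: a distributional identity
`F = div G` in `L²` may be tested with any `L²` function that has a weak gradient in `L²`.  The
correlation function `J z = ⟪F (z + ·), v⟫ + ⟪G (z + ·), w⟫` is continuous, and it is orthogonal to
all test functions by Fubini's theorem. -/
theorem inner_add_inner_eq_zero_of_weak {F v : L2 n} {G w : L2Vec n}
    (hF : ∀ φ, IsTest φ → ∫ x, (F x * φ x + inner ℝ (G x) (∇ φ x)) = 0)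
    (hv : IsWeakGradient v w) : inner ℝ F v + inner ℝ G w = 0 := by
  set J : Sp n → ℝ := fun z => inner ℝ (translate F z) v +
    ∑ i, inner ℝ (translate (compL i G) z) (compL i w) with hJ
  have hJc : Continuous J :=
    ((continuous_translate F).inner continuous_const).add
      (continuous_finsetSum _ fun i _ => (continuous_translate _).inner continuous_const)
  have hF' : ∀ φ, IsTest φ → ∫ x, φ x * F x = - ∑ i, ∫ x, pd i φ x * compL i G x := by
    intro φ hφ
    have h1 : ∀ i, Integrable (fun x => pd i φ x * compL i G x) := fun i =>
      integrable_cc_mul (hφ.pd i).continuous (hφ.pd i).2 _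
    rw [← integral_finsetSum _ fun i _ => h1 i, eq_neg_iff_add_eq_zero, ← integral_add
      (integrable_cc_mul hφ.continuous hφ.2 F) (integrable_finsetSum _ fun i _ => h1 i), ← hF φ hφ]
    refine integral_congr_ae ?_
    filter_upwards [eventually_all.2 fun i => coeFn_compL i G] with x hx
    simp only [hx, inner_gradient_eq_sum, mul_comm]
  rw [isWeakGradient_iff] at hv
  -- Integrated against `η`, the first term of `J` is `-∑ i, ∫ ∂ᵢη ⟪G_i (z + ·), v⟫` by the identity
  -- for `F`, and the second one is its opposite because `w` is the weak gradient of `v`.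
  have hJ0 : J =ᵐ[volume] 0 := by
    refine ae_eq_zero_of_integral_contDiff_smul_eq_zero hJc.locallyIntegrable fun η hη hs => ?_
    have ht : IsTest η := ⟨hη, hs⟩
    have hi1 : ∀ f g : L2 n, Integrable (fun z => η z * inner ℝ (translate f z) g) := fun f g =>
      (ht.continuous.mul ((continuous_translate f).inner continuous_const)).integrable_of_hasCompactSupport
        hs.mul_right
    simp only [hJ, smul_eq_mul, mul_add, Finset.mul_sum]
    rw [integral_add (hi1 _ _) (integrable_finsetSum _ fun i _ => hi1 _ _),
      integral_finsetSum _ fun i _ => hi1 _ _]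
    have e1 : ∫ z, η z * inner ℝ (translate F z) v =
        - ∑ i, ∫ z, pd i η z * inner ℝ (translate (compL i G) z) v := by
      simp_rw [fun i => integral_translate_eq_left (ht.pd i).continuous (ht.pd i).2 (compL i G) v]
      rw [integral_translate_eq_left ht.continuous ht.2]
      have h2 : ∀ i, Integrable (fun y => v y * ∫ x, pd i η (x - y) * compL i G x) := by
        intro i
        have := (integrable_kernel (ht.pd i).continuous (ht.pd i).2 (compL i G) v).integral_prod_right
        refine this.congr (Eventually.of_forall fun y => ?_)
        simp only
        rw [← integral_add_right_eq_self (fun x => pd i η (x - y) * compL i G x) y,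
          ← integral_const_mul]
        refine integral_congr_ae (Eventually.of_forall fun x => ?_)
        simp only [add_sub_cancel_right]; ring
      rw [← integral_finsetSum _ fun i _ => h2 i, ← integral_neg]
      refine integral_congr_ae (Eventually.of_forall fun y => ?_)
      simp only
      rw [hF' _ (ht.comp_sub_const y)]
      simp only [pd_comp_sub_const, Finset.mul_sum, mul_neg]
    have e2 : ∀ i, ∫ z, η z * inner ℝ (translate (compL i G) z) (compL i w) =
        ∫ z, pd i η z * inner ℝ (translate (compL i G) z) v := by
      intro i
      rw [integral_translate_eq_right ht.continuous ht.2,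
        integral_translate_eq_right (ht.pd i).continuous (ht.pd i).2]
      refine integral_congr_ae (Eventually.of_forall fun x => ?_)
      simp only
      have := hv _ (ht.comp_const_sub x) i
      simp only [pd_comp_const_sub ht, neg_mul, integral_neg, neg_inj] at this
      rw [this]
    rw [e1]
    simp_rw [e2]
    simp
  have hJz : J = 0 := (hJc.ae_eq_iff_eq volume continuous_const).1 hJ0
  have := congrFun hJz 0
  simpa [hJ, translate_zero, inner_eq_sum_compL G w] using this

/-- The closed space of pairs `(v, ∇v)` with `v ∈ H¹`.  The defining relations are written as inner
products with fixed elements of `L²`, which makes closedness immediate. -/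
def weakPairs (n : ℕ) : Submodule ℝ (L2 n × L2Vec n) where
  carrier := {p | ∀ (φ : Sp n → ℝ) (hφ : IsTest φ) (i : Fin n),
    inner ℝ (ccL2 (pd i φ) (hφ.pd i).continuous (hφ.pd i).2) p.1 =
      - inner ℝ (ccL2 φ hφ.continuous hφ.2) (compL i p.2)}
  add_mem' := by
    intro p q hp hq φ hφ i
    simp only [Prod.fst_add, Prod.snd_add, inner_add_right, map_add, hp φ hφ i, hq φ hφ i]
    ring
  zero_mem' := by intro φ hφ i; simp
  smul_mem' := by
    intro r p hp φ hφ i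
    simp only [Prod.smul_fst, Prod.smul_snd, inner_smul_right, map_smul, hp φ hφ i]
    ring

lemma mem_weakPairs {p : L2 n × L2Vec n} : p ∈ weakPairs n ↔ IsWeakGradient p.1 p.2 := by
  rw [isWeakGradient_iff]
  simp only [weakPairs, inner_ccL2]
  rfl

lemma isClosed_weakPairs : IsClosed (weakPairs n : Set (L2 n × L2Vec n)) := by
  have : (weakPairs n : Set (L2 n × L2Vec n)) = ⋂ (φ : Sp n → ℝ) (hφ : IsTest φ) (i : Fin n),
    {p | inner ℝ (ccL2 (pd i φ) (hφ.pd i).continuous (hφ.pd i).2) p.1 =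
      - inner ℝ (ccL2 φ hφ.continuous hφ.2) (compL i p.2)} := by
    ext p; simp [weakPairs]
  rw [this]
  refine isClosed_iInter fun φ => isClosed_iInter fun hφ => isClosed_iInter fun i =>
    isClosed_eq (by fun_prop) (by fun_prop)

end

/-! ### Testing with functions of class `C¹` -/

section

variable {n : ℕ}

lemma hasCompactSupport_gradient {φ : Sp n → ℝ} (hs : HasCompactSupport φ) :
    HasCompactSupport (∇ φ) :=
  hs.mono' (subset_closure.trans support_gradient)

/-- Integration by parts for `C¹` functions, one of which has compact support. -/
lemma integral_pd_mul {φ ψ : Sp n → ℝ} (hφ : ContDiff ℝ 1 φ) (hs : HasCompactSupport φ)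
    (hψ : ContDiff ℝ 1 ψ) (i : Fin n) :
    ∫ x, pd i φ x * ψ x = - ∫ x, φ x * pd i ψ x := by
  rw [eq_comm, neg_eq_iff_eq_neg]
  refine integral_mul_fderiv_eq_neg_fderiv_mul_of_integrable (𝕜 := ℝ) ?_ ?_ ?_ ?_ ?_
  · exact ((continuous_pd hφ i).mul hψ.continuous).integrable_of_hasCompactSupport
      (hasCompactSupport_pd hs i).mul_right
  · exact (hφ.continuous.mul (continuous_pd hψ i)).integrable_of_hasCompactSupport hs.mul_right
  · exact (hφ.continuous.mul hψ.continuous).integrable_of_hasCompactSupport hs.mul_right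
  · exact fun x _ => hφ.differentiable (by norm_num) x
  · exact fun x _ => hψ.differentiable (by norm_num) x

/-- The gradient of a `C¹` function with compact support, as an element of `L²`. -/
def ccGrad (φ : Sp n → ℝ) (hφ : ContDiff ℝ 1 φ) (hs : HasCompactSupport φ) : L2Vec n :=
  ((continuous_gradient hφ).memLp_of_hasCompactSupport (hasCompactSupport_gradient hs)).toLp _

lemma coeFn_ccGrad (φ : Sp n → ℝ) (hφ : ContDiff ℝ 1 φ) (hs : HasCompactSupport φ) :
    ccGrad φ hφ hs =ᵐ[volume] ∇ φ :=
  MemLp.coeFn_toLp _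

lemma isWeakGradient_ccGrad (ψ : Sp n → ℝ) (hψ : ContDiff ℝ 1 ψ) (hs : HasCompactSupport ψ) :
    IsWeakGradient (ccL2 ψ hψ.continuous hs) (ccGrad ψ hψ hs) := by
  rw [isWeakGradient_iff]
  intro φ hφ i
  have h1 : ∫ x, pd i φ x * ccL2 ψ hψ.continuous hs x = ∫ x, pd i φ x * ψ x := by
    refine integral_congr_ae ?_
    filter_upwards [coeFn_ccL2 ψ hψ.continuous hs] with x hx
    rw [hx]
  have h2 : ∫ x, φ x * compL i (ccGrad ψ hψ hs) x = ∫ x, φ x * pd i ψ x := by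
    refine integral_congr_ae ?_
    filter_upwards [coeFn_compL i (ccGrad ψ hψ hs), coeFn_ccGrad ψ hψ hs] with x hx hx'
    rw [hx, hx', gradient_apply]
  rw [h1, h2, integral_pd_mul hφ.one hφ.2 hψ]

/-- The vector field `x ↦ v x • eᵢ`. -/
def embL (i : Fin n) : L2 n →L[ℝ] L2Vec n :=
  (ContinuousLinearMap.toSpanSingleton ℝ (EuclideanSpace.single i 1 : Sp n)).compLpL 2 volume

lemma coeFn_embL (i : Fin n) (v : L2 n) :
    embL i v =ᵐ[volume] fun x => v x • (EuclideanSpace.single i 1 : Sp n) :=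
  ContinuousLinearMap.coeFn_compLpL _ _

/-- A weak gradient may be tested with `C¹` functions of compact support. -/
lemma IsWeakGradient.integral_pd_mul {v : L2 n} {w : L2Vec n} (hv : IsWeakGradient v w)
    {ψ : Sp n → ℝ} (hψ : ContDiff ℝ 1 ψ) (hs : HasCompactSupport ψ) (i : Fin n) :
    ∫ x, pd i ψ x * v x = - ∫ x, ψ x * compL i w x := by
  have key := inner_add_inner_eq_zero_of_weak (F := compL i w) (G := embL i v)
    (v := ccL2 ψ hψ.continuous hs) (w := ccGrad ψ hψ hs) ?_ (isWeakGradient_ccGrad ψ hψ hs)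
  · rw [real_inner_comm, inner_ccL2, L2.inner_def] at key
    rw [eq_neg_iff_add_eq_zero, add_comm, ← key]
    congr 1
    refine integral_congr_ae ?_
    filter_upwards [coeFn_embL i v, coeFn_ccGrad ψ hψ hs] with x h1 h2
    rw [h1, h2, real_inner_smul_left, real_inner_comm, inner_gradient, mul_comm]; rfl
  · intro φ hφ
    have h1 := isWeakGradient_iff.1 hv φ hφ i
    rw [eq_neg_iff_add_eq_zero, add_comm, ← integral_add
      (integrable_cc_mul hφ.continuous hφ.2 _)
      (integrable_cc_mul (hφ.pd i).continuous (hφ.pd i).2 _)] at h1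
    rw [← h1]
    refine integral_congr_ae ?_
    filter_upwards [coeFn_embL i v] with x h1
    rw [h1, real_inner_smul_left, real_inner_comm, inner_gradient, pd]; ring

/-- The product rule for weak gradients. -/
lemma isWeakGradient_mul {v : L2 n} {w : L2Vec n} (hv : IsWeakGradient v w)
    {ψ : Sp n → ℝ} (hψ : ContDiff ℝ 1 ψ) {v' : L2 n} {w' : L2Vec n}
    (hv' : v' =ᵐ[volume] fun x => ψ x * v x)
    (hw' : w' =ᵐ[volume] fun x => ψ x • w x + v x • ∇ ψ x) :
    IsWeakGradient v' w' := by
  rw [isWeakGradient_iff]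
  intro φ hφ i
  have h1 := hv.integral_pd_mul (hψ.mul hφ.one) (hφ.2.mul_left (f := ψ)) i
  have hi1 : Integrable (fun x => pd i (fun y => ψ y * φ y) x * v x) :=
    integrable_cc_mul (continuous_pd (hψ.mul hφ.one) i)
      (hasCompactSupport_pd (hφ.2.mul_left (f := ψ)) i) v
  have hi2 : Integrable (fun x => (φ x * pd i ψ x) * v x) :=
    integrable_cc_mul (hφ.continuous.mul (continuous_pd hψ i)) hφ.2.mul_right v
  have hi3 : Integrable (fun x => (ψ x * φ x) * compL i w x) :=
    integrable_cc_mul (hψ.continuous.mul hφ.continuous) hφ.2.mul_left (compL i w)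
  have e1 : ∫ x, pd i φ x * v' x = ∫ x, (pd i (fun y => ψ y * φ y) x * v x
      - (φ x * pd i ψ x) * v x) := by
    refine integral_congr_ae ?_
    filter_upwards [hv'] with x hx
    rw [hx, pd_mul (hψ.differentiable (by norm_num) x) (hφ.one.differentiable (by norm_num) x)]
    ring
  have e2 : ∫ x, φ x * compL i w' x = ∫ x, ((ψ x * φ x) * compL i w x
      + (φ x * pd i ψ x) * v x) := by
    refine integral_congr_ae ?_
    filter_upwards [hw', coeFn_compL i w', coeFn_compL i w] with x hx h2 h3
    rw [h2, hx, h3]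
    simp only [PiLp.add_apply, PiLp.smul_apply, smul_eq_mul, gradient_apply]
    ring
  rw [e1, e2, integral_sub hi1 hi2, integral_add hi3 hi2, h1]
  ring

/-- `f` is locally square integrable: it is measurable, and its products with continuous functions of
compact support are in `L²`. -/
structure LocL2 {E : Type*} [NormedAddCommGroup E] [NormedSpace ℝ E] (f : Sp n → E) : Prop where
  meas : AEStronglyMeasurable f volume
  memLp : ∀ κ : Sp n → ℝ, Continuous κ → HasCompactSupport κ → MemLp (fun x => κ x • f x) 2 volume

section LocL2

variable {E : Type*} [NormedAddCommGroup E] [NormedSpace ℝ E]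

lemma locL2_of_memLp {f : Sp n → E} (hf : MemLp f 2 volume) : LocL2 f := by
  refine ⟨hf.1, fun κ hκ hs => ?_⟩
  obtain ⟨C, hC⟩ := hs.exists_bound_of_continuous hκ
  refine hf.of_le_mul (c := C) (hκ.aestronglyMeasurable.smul hf.1) (Eventually.of_forall fun x => ?_)
  rw [norm_smul]; gcongr; exact hC x

lemma locL2_of_continuous {f : Sp n → E} (hf : Continuous f) : LocL2 f :=
  ⟨hf.aestronglyMeasurable, fun _ hκ hs =>
    (hκ.smul hf).memLp_of_hasCompactSupport hs.smul_right⟩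

lemma LocL2.add {f g : Sp n → E} (hf : LocL2 f) (hg : LocL2 g) : LocL2 (fun x => f x + g x) :=
  ⟨hf.1.add hg.1, fun κ hκ hs => by
    simp only [smul_add]; exact (hf.2 κ hκ hs).add (hg.2 κ hκ hs)⟩

lemma LocL2.sub {f g : Sp n → E} (hf : LocL2 f) (hg : LocL2 g) : LocL2 (fun x => f x - g x) :=
  ⟨hf.1.sub hg.1, fun κ hκ hs => by
    simp only [smul_sub]; exact (hf.2 κ hκ hs).sub (hg.2 κ hκ hs)⟩

lemma LocL2.continuous_smul {f : Sp n → E} (hf : LocL2 f) {m : Sp n → ℝ} (hm : Continuous m) :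
    LocL2 (fun x => m x • f x) :=
  ⟨hm.aestronglyMeasurable.smul hf.1, fun κ hκ hs => by
    simpa only [smul_smul] using hf.2 (fun x => κ x * m x) (hκ.mul hm) hs.mul_right⟩

lemma LocL2.continuous_mul {f : Sp n → ℝ} (hf : LocL2 f) {m : Sp n → ℝ} (hm : Continuous m) :
    LocL2 (fun x => m x * f x) := hf.continuous_smul hm

lemma LocL2.inner_continuous {f : Sp n → Sp n} (hf : LocL2 f) {m : Sp n → Sp n}
    (hm : Continuous m) : LocL2 (fun x => inner ℝ (f x) (m x)) :=
  ⟨hf.1.inner hm.aestronglyMeasurable, fun κ hκ hs =>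
    (hf.2 (fun x => κ x * ‖m x‖) (hκ.mul hm.norm) hs.mul_right).of_le
      (hκ.aestronglyMeasurable.smul (hf.1.inner hm.aestronglyMeasurable))
      (Eventually.of_forall fun x => by
        simp only [norm_smul, norm_mul, norm_norm, mul_assoc]
        gcongr
        rw [mul_comm]
        exact norm_inner_le_norm _ _)⟩

lemma LocL2.integrable_mul {f : Sp n → ℝ} (hf : LocL2 f) {φ : Sp n → ℝ} (hφ : Continuous φ)
    (hs : HasCompactSupport φ) : Integrable (fun x => f x * φ x) := by
  obtain ⟨C, hC⟩ := hs.isCompact.isBounded.subset_closedBall (0 : Sp n)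
  set χ : ContDiffBump (0 : Sp n) := ⟨max C 0 + 1, max C 0 + 2, by positivity, by linarith⟩
  have h1 : Integrable (fun x => (φ x • f x) * χ x) :=
    MemLp.integrable_mul (p := 2) (q := 2) (hf.2 φ hφ hs)
      (χ.continuous.memLp_of_hasCompactSupport χ.hasCompactSupport)
  refine h1.congr (Eventually.of_forall fun x => ?_)
  by_cases hx : φ x = 0
  · simp [hx]
  · have : x ∈ Metric.closedBall (0 : Sp n) (max C 0 + 1) :=
      Metric.closedBall_subset_closedBall (by linarith [le_max_left C 0])
        (hC (subset_tsupport φ (Function.mem_support.2 hx)))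
    simp only [smul_eq_mul]
    rw [χ.one_of_mem_closedBall this]; ring

lemma LocL2.locallyIntegrable {f : Sp n → ℝ} (hf : LocL2 f) : LocallyIntegrable f := by
  rw [locallyIntegrable_iff]
  intro k hk
  obtain ⟨C, hC⟩ := hk.isBounded.subset_closedBall (0 : Sp n)
  set χ : ContDiffBump (0 : Sp n) := ⟨max C 0 + 1, max C 0 + 2, by positivity, by linarith⟩
  have h1 : Integrable (fun x => f x * χ x) :=
    hf.integrable_mul χ.continuous χ.hasCompactSupport
  refine h1.integrableOn.congr_fun (fun x hx => ?_) hk.measurableSet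
  have : x ∈ Metric.closedBall (0 : Sp n) (max C 0 + 1) :=
      Metric.closedBall_subset_closedBall (by linarith [le_max_left C 0]) (hC hx)
  simp only
  rw [χ.one_of_mem_closedBall this, mul_one]

end LocL2

lemma LocL2.integrable_inner {f : Sp n → Sp n} (hf : LocL2 f) {m : Sp n → Sp n}
    (hm : Continuous m) (hs : HasCompactSupport m) : Integrable (fun x => inner ℝ (f x) (m x)) := by
  obtain ⟨C, hC⟩ := hs.isCompact.isBounded.subset_closedBall (0 : Sp n)
  set χ : ContDiffBump (0 : Sp n) := ⟨max C 0 + 1, max C 0 + 2, by positivity, by linarith⟩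
  refine ((hf.inner_continuous hm).integrable_mul χ.continuous χ.hasCompactSupport).congr
    (Eventually.of_forall fun x => ?_)
  by_cases hx : m x = 0
  · simp [hx]
  · have : x ∈ Metric.closedBall (0 : Sp n) (max C 0 + 1) :=
      Metric.closedBall_subset_closedBall (by linarith [le_max_left C 0])
        (hC (subset_tsupport m (Function.mem_support.2 hx)))
    simp only
    rw [χ.one_of_mem_closedBall this]; ring

/-- A distributional identity `f = div G` with locally square integrable `f` and `G` may be tested
with `ψ v` for `ψ` of class `C¹` with compact support and `v ∈ H¹`. -/
theorem integral_eq_zero_of_weak_local {f : Sp n → ℝ} {G : Sp n → Sp n} (hf : LocL2 f)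
    (hG : LocL2 G) (heq : ∀ φ, IsTest φ → ∫ x, (f x * φ x + inner ℝ (G x) (∇ φ x)) = 0)
    {v : L2 n} {w : L2Vec n} (hv : IsWeakGradient v w) {ψ : Sp n → ℝ} (hψ : ContDiff ℝ 1 ψ)
    (hs : HasCompactSupport ψ) :
    Integrable (fun x => f x * (ψ x * v x) + inner ℝ (G x) (ψ x • w x + v x • ∇ ψ x)) ∧
    ∫ x, (f x * (ψ x * v x) + inner ℝ (G x) (ψ x • w x + v x • ∇ ψ x)) = 0 := by
  obtain ⟨C, hC⟩ := hs.isCompact.isBounded.subset_closedBall (0 : Sp n)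
  set κ : ContDiffBump (0 : Sp n) := ⟨max C 0 + 1, max C 0 + 2, by positivity, by linarith⟩ with hκ
  have hκt : IsTest κ := ⟨κ.contDiff, κ.hasCompactSupport⟩
  have hκ1 : ∀ x ∈ tsupport ψ, κ x = 1 ∧ ∇ κ x = 0 := by
    intro x hx
    have hx' : x ∈ Metric.ball (0 : Sp n) (max C 0 + 1) :=
      Metric.closedBall_subset_ball (by linarith [le_max_left C 0]) (hC hx)
    refine ⟨κ.one_of_mem_closedBall (Metric.ball_subset_closedBall hx'), ?_⟩
    have : (κ : Sp n → ℝ) =ᶠ[𝓝 x] fun _ => 1 := by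
      filter_upwards [Metric.isOpen_ball.mem_nhds hx'] with y hy
      exact κ.one_of_mem_closedBall (Metric.ball_subset_closedBall hy)
    simp [gradient, this.fderiv_eq]
  have hF : MemLp (fun x => κ x * f x + inner ℝ (G x) (∇ κ x)) 2 volume := by
    refine (hf.2 κ κ.continuous κ.hasCompactSupport).add ?_
    refine (hG.2 (fun x => ‖∇ κ x‖) (continuous_gradient hκt.one).norm
      (hasCompactSupport_gradient hκt.2).norm).of_le
      (hG.1.inner (continuous_gradient hκt.one).aestronglyMeasurable)
      (Eventually.of_forall fun x => ?_)
    rw [norm_smul, norm_norm, mul_comm]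
    exact norm_inner_le_norm _ _
  have hG' := hG.2 κ κ.continuous κ.hasCompactSupport
  have hψc := hψ.continuous
  have hv' : MemLp (fun x => ψ x * v x) 2 volume :=
    (locL2_of_memLp (Lp.memLp v)).2 ψ hψ.continuous hs
  have hw' : MemLp (fun x => ψ x • w x + v x • ∇ ψ x) 2 volume := by
    refine ((locL2_of_memLp (Lp.memLp w)).2 ψ hψ.continuous hs).add ?_
    refine ((locL2_of_memLp (Lp.memLp v)).2 (fun x => ‖∇ ψ x‖) (continuous_gradient hψ).norm
      (hasCompactSupport_gradient hs).norm).of_le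
      ((Lp.aestronglyMeasurable v).smul (continuous_gradient hψ).aestronglyMeasurable)
      (Eventually.of_forall fun x => ?_)
    rw [norm_smul, norm_smul, norm_norm, mul_comm]
  -- For a cutoff `κ` which is `1` near the support of `ψ`, the fields `κ f + ⟨G, ∇ κ⟩` and `κ G` are
  -- in `L²` and satisfy the same identity.
  have key := inner_add_inner_eq_zero_of_weak (F := hF.toLp _) (G := hG'.toLp _)
    (v := hv'.toLp _) (w := hw'.toLp _) ?_
    (isWeakGradient_mul hv hψ hv'.coeFn_toLp hw'.coeFn_toLp)
  · have hint := (L2.integrable_inner (𝕜 := ℝ) (hF.toLp _) (hv'.toLp _)).add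
      (L2.integrable_inner (𝕜 := ℝ) (hG'.toLp _) (hw'.toLp _))
    rw [L2.inner_def, L2.inner_def, ← integral_add (L2.integrable_inner _ _)
      (L2.integrable_inner _ _)] at key
    rw [← key]
    suffices h : (fun x => inner ℝ (hF.toLp _ x) (hv'.toLp _ x) +
        inner ℝ (hG'.toLp _ x) (hw'.toLp _ x)) =ᵐ[volume] fun x =>
        f x * (ψ x * v x) + inner ℝ (G x) (ψ x • w x + v x • ∇ ψ x) from
      ⟨hint.congr h, (integral_congr_ae h).symm⟩
    filter_upwards [hF.coeFn_toLp, hG'.coeFn_toLp, hv'.coeFn_toLp, hw'.coeFn_toLp]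
      with x h1 h2 h3 h4
    rw [h1, h2, h3, h4]
    by_cases hx : x ∈ tsupport ψ
    · rw [(hκ1 x hx).1, (hκ1 x hx).2]
      simp [mul_comm]
    · have h5 : ψ x = 0 := image_eq_zero_of_notMem_tsupport hx
      have h6 : ∇ ψ x = 0 :=
        image_eq_zero_of_notMem_tsupport fun h => hx (support_gradient h)
      simp [h5, h6]
  · intro φ hφ
    have := heq _ (hφ.mul_left κ.contDiff)
    rw [← this]
    refine integral_congr_ae ?_
    filter_upwards [hF.coeFn_toLp, hG'.coeFn_toLp] with x h1 h2
    rw [h1, h2, gradient_mul (hκt.one.differentiable (by norm_num) x)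
      (hφ.one.differentiable (by norm_num) x)]
    simp only [real_inner_smul_left, inner_add_right, real_inner_smul_right]
    ring

end

/-! ### Time derivatives -/

section

variable {n : ℕ}

section TimeDerivative

variable {F : Type*} [NormedAddCommGroup F] [NormedSpace ℝ F]

lemma dt_zero (f : ℝ → F) (t : ℝ) : dt 0 f t = f t := by simp [dt]

lemma dt_succ (j : ℕ) (f : ℝ → F) (t : ℝ) : dt (j + 1) f t = derivWithin (dt j f) (Ici 0) t := by
  unfold dt; rw [iteratedDerivWithin_succ]

lemma hasDerivWithinAt_dt {f : ℝ → F} {m : ℕ} (hf : ContDiffOn ℝ m f (Ici 0)) {j : ℕ} (hj : j < m)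
    {t : ℝ} (ht : 0 ≤ t) : HasDerivWithinAt (dt j f) (dt (j + 1) f t) (Ici 0) t := by
  rw [dt_succ]
  exact (hf.differentiableOn_iteratedDerivWithin (by exact_mod_cast hj) (uniqueDiffOn_Ici 0) t
    ht).hasDerivWithinAt

lemma continuousOn_dt {f : ℝ → F} {m : ℕ} (hf : ContDiffOn ℝ m f (Ici 0)) {j : ℕ} (hj : j ≤ m) :
    ContinuousOn (dt j f) (Ici 0) :=
  hf.continuousOn_iteratedDerivWithin (by exact_mod_cast hj) (uniqueDiffOn_Ici 0)

/-- The derivative of a curve in a closed subspace lies in that subspace. -/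
lemma mem_of_hasDerivWithinAt {K : Submodule ℝ F} (hK : IsClosed (K : Set F)) {f : ℝ → F} {f' : F}
    {t : ℝ} (ht : 0 ≤ t) (hf : HasDerivWithinAt f f' (Ici 0) t) (hft : f t ∈ K)
    (hmem : ∀ᶠ s in 𝓝[Ici 0] t, f s ∈ K) : f' ∈ K := by
  have h1 := hasDerivWithinAt_iff_tendsto_slope.1 hf
  have : (𝓝[Ici 0 \ {t}] t).NeBot := by
    have h2 : (𝓝[Ioi t] t).NeBot := inferInstance
    exact h2.mono (nhdsWithin_mono t fun s hs => ⟨ht.trans (le_of_lt hs), ne_of_gt hs⟩)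
  refine hK.mem_of_tendsto h1 ?_
  filter_upwards [nhdsWithin_mono t sdiff_subset hmem] with s hs
  exact K.smul_mem _ (K.sub_mem hs hft)

end TimeDerivative

/-- Each time derivative of a function on `[0, ∞) × ℝⁿ` costs one order of joint differentiability. -/
lemma contDiffOn_dt {h : ℝ → Sp n → ℝ} {m : ℕ}
    (hh : ContDiffOn ℝ m (fun p : ℝ × Sp n => h p.1 p.2) (Ici 0 ×ˢ univ)) {j k : ℕ}
    (hjk : k + j = m) :
    ContDiffOn ℝ k (fun p : ℝ × Sp n => dt j (fun s => h s p.2) p.1) (Ici 0 ×ˢ univ) := by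
  have hS : UniqueDiffOn ℝ (Ici (0 : ℝ) ×ˢ (univ : Set (Sp n))) :=
    (uniqueDiffOn_Ici 0).prod uniqueDiffOn_univ
  induction j generalizing k with
  | zero => simpa [dt_zero, ← hjk] using hh
  | succ j ih =>
    have h1 := ih (k := k + 1) (by omega)
    have h2 : ContDiffOn ℝ k (fun p : ℝ × Sp n => fderivWithin ℝ
        (fun p : ℝ × Sp n => dt j (fun s => h s p.2) p.1) (Ici 0 ×ˢ univ) p (1, 0))
        (Ici 0 ×ˢ univ) :=
      (h1.fderivWithin hS (by push_cast; exact le_rfl)).clm_apply contDiffOn_const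
    refine h2.congr fun p hp => ?_
    obtain ⟨t, x⟩ := p
    have h3 : HasFDerivWithinAt (fun p : ℝ × Sp n => dt j (fun s => h s p.2) p.1) _
        (Ici 0 ×ˢ univ) (t, x) := (h1.differentiableOn (by simp) _ hp).hasFDerivWithinAt
    have h4 : HasDerivWithinAt (fun s : ℝ => ((s, x) : ℝ × Sp n)) (1, 0) (Ici 0) t :=
      (hasDerivWithinAt_id t _).prodMk (hasDerivWithinAt_const t _ x)
    have h6 : MapsTo (fun s : ℝ => ((s, x) : ℝ × Sp n)) (Ici 0) (Ici 0 ×ˢ univ) :=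
      fun s hs => ⟨hs, mem_univ _⟩
    have h5 := h3.comp_hasDerivWithinAt t h4 h6
    simp only [dt_succ]
    exact h5.derivWithin (uniqueDiffOn_Ici 0 t hp.1)

/-- For fixed `x`, the time derivatives of a function of class `C^m`. -/
lemma contDiffOn_time {h : ℝ → Sp n → ℝ} {m : ℕ}
    (hh : ContDiffOn ℝ m (fun p : ℝ × Sp n => h p.1 p.2) (Ici 0 ×ˢ univ)) (x : Sp n) :
    ContDiffOn ℝ m (fun s => h s x) (Ici 0) := by
  have h1 : ContDiffOn ℝ m (fun s : ℝ => ((s, x) : ℝ × Sp n)) (Ici 0) :=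
    contDiffOn_id.prodMk contDiffOn_const
  have h2 : MapsTo (fun s : ℝ => ((s, x) : ℝ × Sp n)) (Ici 0) (Ici 0 ×ˢ univ) :=
    fun s hs => ⟨hs, mem_univ _⟩
  exact hh.comp h1 h2

lemma contDiff_space {h : ℝ → Sp n → ℝ} {m : ℕ∞ω}
    (hh : ContDiffOn ℝ m (fun p : ℝ × Sp n => h p.1 p.2) (Ici 0 ×ˢ univ)) {t : ℝ} (ht : 0 ≤ t) :
    ContDiff ℝ m (h t) := by
  rw [← contDiffOn_univ]
  exact hh.comp (f := fun x : Sp n => (t, x)) (contDiffOn_const.prodMk contDiffOn_id)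
    fun _ _ => ⟨ht, mem_univ _⟩

/-! ### Curves in `L²` of continuous functions -/

/-- A function as an element of `L²`, and zero if it is not square integrable. -/
def asL2 (f : Sp n → ℝ) : L2 n :=
  haveI := Classical.propDecidable (MemLp f 2 (volume : Measure (Sp n)))
  if h : MemLp f 2 (volume : Measure (Sp n)) then h.toLp f else 0

/-- The element `κ f` of `L²`, for a continuous function `f` and a continuous cutoff `κ`; it is zero if
`κ f` is not square integrable. -/
def cutL2 (κ f : Sp n → ℝ) : L2 n := asL2 fun x => κ x * f x

lemma coeFn_cutL2 {κ f : Sp n → ℝ} (hκ : Continuous κ) (hs : HasCompactSupport κ)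
    (hf : Continuous f) : cutL2 κ f =ᵐ[volume] fun x => κ x * f x := by
  have h : MemLp (fun x => κ x * f x) 2 (volume : Measure (Sp n)) :=
    (hκ.mul hf).memLp_of_hasCompactSupport hs.mul_right
  rw [cutL2, asL2, dif_pos h]
  exact h.coeFn_toLp

lemma continuous_slice {H : ℝ → Sp n → ℝ}
    (hH : ContinuousOn (fun p : ℝ × Sp n => H p.1 p.2) (Ici 0 ×ˢ univ)) {t : ℝ} (ht : 0 ≤ t) :
    Continuous (H t) := by
  rw [← continuousOn_univ]
  exact hH.comp (f := fun x : Sp n => (t, x)) (by fun_prop) fun _ _ => ⟨ht, mem_univ _⟩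

lemma exists_uniform_slice {H : ℝ → Sp n → ℝ}
    (hH : ContinuousOn (fun p : ℝ × Sp n => H p.1 p.2) (Ici 0 ×ˢ univ)) {k : Set (Sp n)}
    (hk : IsCompact k) {t : ℝ} (ht : 0 ≤ t) {ε : ℝ} (hε : 0 < ε) :
    ∃ δ > 0, ∀ s, 0 ≤ s → |s - t| < δ → ∀ x ∈ k, |H s x - H t x| ≤ ε := by
  have hc : IsCompact (Icc 0 (t + 1) ×ˢ k) := isCompact_Icc.prod hk
  have hu := hc.uniformContinuousOn_of_continuous
    (hH.mono (prod_mono Icc_subset_Ici_self (subset_univ k)))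
  obtain ⟨δ, hδ, hu⟩ := Metric.uniformContinuousOn_iff.1 hu ε hε
  refine ⟨min δ 1, lt_min hδ one_pos, fun s hs hst x hx => ?_⟩
  have h1 : s ≤ t + 1 := by
    have := (abs_lt.1 (hst.trans_le (min_le_right _ _))).2; linarith
  have := hu (s, x) ⟨⟨hs, h1⟩, hx⟩ (t, x) ⟨⟨ht, by linarith⟩, hx⟩
    (by simpa [Prod.dist_eq, Real.dist_eq, hδ] using hst.trans_le (min_le_left _ _))
  exact (le_of_lt (by simpa [Real.dist_eq] using this))

lemma continuousOn_cutL2 {κ : Sp n → ℝ} (hκ : Continuous κ) (hs : HasCompactSupport κ)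
    {H : ℝ → Sp n → ℝ}
    (hH : ContinuousOn (fun p : ℝ × Sp n => H p.1 p.2) (Ici 0 ×ˢ univ)) :
    ContinuousOn (fun t => cutL2 κ (H t)) (Ici 0) := by
  intro t ht
  rw [Metric.continuousWithinAt_iff]
  intro ε hε
  set N := ‖ccL2 κ hκ hs‖ + 1 with hN
  have hN0 : 0 < N := by positivity
  obtain ⟨δ, hδ, hu⟩ := exists_uniform_slice hH hs.isCompact (mem_Ici.1 ht) (ε := ε / (2 * N))
    (by positivity)
  refine ⟨δ, hδ, fun {s} hs' hst => ?_⟩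
  rw [dist_eq_norm]
  have h1 : ‖cutL2 κ (H s) - cutL2 κ (H t)‖ ≤ ε / (2 * N) * ‖ccL2 κ hκ hs‖ := by
    refine Lp.norm_le_mul_norm_of_ae_le_mul ?_
    filter_upwards [coeFn_cutL2 hκ hs (continuous_slice hH hs'), coeFn_ccL2 κ hκ hs,
      coeFn_cutL2 hκ hs (continuous_slice hH ht),
      Lp.coeFn_sub (cutL2 κ (H s)) (cutL2 κ (H t))] with x h1 h2 h3 h4
    rw [h4, Pi.sub_apply, h1, h2, h3, ← mul_sub, norm_mul, mul_comm]
    by_cases hx : x ∈ tsupport κ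
    · gcongr
      exact hu s hs' (by simpa [Real.dist_eq] using hst) x hx
    · simp [image_eq_zero_of_notMem_tsupport hx]
  refine h1.trans_lt ?_
  have h2 : ‖ccL2 κ hκ hs‖ < N := by linarith
  calc ε / (2 * N) * ‖ccL2 κ hκ hs‖ ≤ ε / (2 * N) * N := by gcongr
    _ = ε / 2 := by field_simp
    _ < ε := by linarith

/-- A jointly continuous time derivative is a derivative of the `L²`-valued curve, once the
functions are cut off to a compact set. -/
lemma hasDerivWithinAt_cutL2 {κ : Sp n → ℝ} (hκ : Continuous κ) (hs : HasCompactSupport κ)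
    {H H' : ℝ → Sp n → ℝ} (hH : ∀ t, 0 ≤ t → Continuous (H t))
    (hH' : ContinuousOn (fun p : ℝ × Sp n => H' p.1 p.2) (Ici 0 ×ˢ univ))
    (hd : ∀ t, 0 ≤ t → ∀ x, HasDerivWithinAt (fun s => H s x) (H' t x) (Ici 0) t)
    {t : ℝ} (ht : 0 ≤ t) :
    HasDerivWithinAt (fun t => cutL2 κ (H t)) (cutL2 κ (H' t)) (Ici 0) t := by
  rw [hasDerivWithinAt_iff_isLittleO, Asymptotics.isLittleO_iff]
  intro ε hε
  set N := ‖ccL2 κ hκ hs‖ + 1 with hN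
  have hN0 : 0 < N := by positivity
  obtain ⟨δ, hδ, hu⟩ := exists_uniform_slice hH' hs.isCompact ht (ε := ε / N) (by positivity)
  have hev : ∀ᶠ s in 𝓝[Ici 0] t, s ∈ Ici (0 : ℝ) ∩ Metric.ball t δ :=
    inter_mem self_mem_nhdsWithin (mem_nhdsWithin_of_mem_nhds (Metric.ball_mem_nhds t hδ))
  filter_upwards [hev] with s hst
  have hbd : ∀ x ∈ tsupport κ, |H s x - H t x - (s - t) * H' t x| ≤ ε / N * |s - t| := by
    intro x hx
    have hconv : Convex ℝ (Ici (0 : ℝ) ∩ Metric.ball t δ) := (convex_Ici 0).inter (convex_ball t δ)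
    have := hconv.norm_image_sub_le_of_norm_hasDerivWithin_le
      (f := fun r => H r x - (r - t) * H' t x) (f' := fun r => H' r x - H' t x) (C := ε / N)
      (x := t) (y := s) ?_ ?_ ⟨ht, Metric.mem_ball_self hδ⟩ hst
    · simpa [Real.norm_eq_abs, sub_right_comm] using this
    · intro r hr
      have h1 := ((hd r hr.1 x).mono (inter_subset_left (t := Metric.ball t δ))).sub
        ((((hasDerivWithinAt_id r (Ici (0 : ℝ) ∩ Metric.ball t δ)).sub_const t).mul_const (H' t x)))
      exact h1.congr_deriv (by simp)
    · intro r hr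
      exact hu r hr.1 (by simpa [Real.dist_eq] using hr.2) x hx
  have hHt' := continuous_slice hH' ht
  have h1 : ‖cutL2 κ (H s) - cutL2 κ (H t) - (s - t) • cutL2 κ (H' t)‖
      ≤ ε / N * |s - t| * ‖ccL2 κ hκ hs‖ := by
    refine Lp.norm_le_mul_norm_of_ae_le_mul ?_
    filter_upwards [coeFn_cutL2 hκ hs (hH s hst.1), coeFn_ccL2 κ hκ hs,
      coeFn_cutL2 hκ hs (hH t ht), coeFn_cutL2 hκ hs hHt',
      Lp.coeFn_sub (cutL2 κ (H s)) (cutL2 κ (H t)),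
      Lp.coeFn_sub (cutL2 κ (H s) - cutL2 κ (H t)) ((s - t) • cutL2 κ (H' t)),
      Lp.coeFn_smul (s - t) (cutL2 κ (H' t))] with x h1 h2 h3 h4 h5 h6 h7
    rw [h6, Pi.sub_apply, h5, Pi.sub_apply, h7, Pi.smul_apply, h1, h2, h3, h4, smul_eq_mul]
    have e : κ x * H s x - κ x * H t x - (s - t) * (κ x * H' t x)
      = (H s x - H t x - (s - t) * H' t x) * κ x := by ring
    rw [e, norm_mul]
    by_cases hx : x ∈ tsupport κ
    · gcongr
      exact hbd x hx
    · simp [image_eq_zero_of_notMem_tsupport hx]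
  refine h1.trans ?_
  have h2 : ‖ccL2 κ hκ hs‖ ≤ N := by linarith
  calc ε / N * |s - t| * ‖ccL2 κ hκ hs‖ ≤ ε / N * |s - t| * N := by gcongr
    _ = ε * ‖s - t‖ := by rw [Real.norm_eq_abs]; field_simp

end

/-! ### The coefficients and the speed of propagation -/

section

variable {n : ℕ}

/-- The properties of the coefficients and of the speed bound `q` that the energy method uses:
smooth positive coefficients, and a `C¹` function `q` with `0 < q'(|x|) ≤ √(c/b)` whose sublevel sets
are bounded. -/
structure Setting (a b c : Sp n → ℝ) (q : ℝ → ℝ) : Prop where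
  smooth_a : ContDiff ℝ ∞ a
  smooth_b : ContDiff ℝ ∞ b
  smooth_c : ContDiff ℝ ∞ c
  pos_a : ∀ x, 0 < a x
  pos_b : ∀ x, 0 < b x
  pos_c : ∀ x, 0 < c x
  q_contDiffOn : ContDiffOn ℝ 1 q (Ici 0)
  q_deriv_pos : ∀ r : ℝ, 0 ≤ r → 0 < derivWithin q (Ici 0) r
  q_deriv_le : ∀ x : Sp n, derivWithin q (Ici 0) ‖x‖ ≤ √(c x / b x)
  q_proper : ∀ L, ∃ r₀, ∀ r, 0 ≤ r → q r ≤ L → r ≤ r₀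

variable {a b c : Sp n → ℝ} {q : ℝ → ℝ}

lemma Setting.strictMonoOn (hS : Setting a b c q) : StrictMonoOn q (Ici 0) := by
  refine strictMonoOn_of_deriv_pos (convex_Ici 0) hS.q_contDiffOn.continuousOn fun r hr => ?_
  rw [interior_Ici] at hr
  have := hS.q_deriv_pos r (le_of_lt hr)
  rwa [derivWithin_of_mem_nhds (Ici_mem_nhds hr)] at this

lemma Setting.continuous_q (hS : Setting a b c q) : Continuous (fun x : Sp n => q ‖x‖) :=
  hS.q_contDiffOn.continuousOn.comp_continuous continuous_norm fun x => norm_nonneg x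

lemma Setting.isCompact_cone (hS : Setting a b c q) (L : ℝ) :
    IsCompact {x : Sp n | q ‖x‖ ≤ L} := by
  obtain ⟨r₀, hr⟩ := hS.q_proper L
  refine (isCompact_closedBall (0 : Sp n) r₀).of_isClosed_subset
    (isClosed_le hS.continuous_q continuous_const) fun x hx => ?_
  simpa using hr ‖x‖ (norm_nonneg x) hx

lemma Setting.exists_cutoff (hS : Setting a b c q) (L : ℝ) :
    ∃ κ : Sp n → ℝ, IsTest κ ∧ ∀ x, q ‖x‖ ≤ L → κ x = 1 := by
  obtain ⟨r₀, hr⟩ := hS.q_proper L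
  set κ : ContDiffBump (0 : Sp n) := ⟨max r₀ 0 + 1, max r₀ 0 + 2, by positivity, by linarith⟩
  refine ⟨κ, ⟨κ.contDiff, κ.hasCompactSupport⟩, fun x hx => κ.one_of_mem_closedBall ?_⟩
  have h1 : ‖x‖ ≤ r₀ := hr ‖x‖ (norm_nonneg x) hx
  have h2 : κ.rIn = max r₀ 0 + 1 := rfl
  rw [h2, mem_closedBall_zero_iff]
  linarith [le_max_left r₀ 0]

/-! ### Finite speed of propagation -/

/-- The square of the positive part, the profile of the weights localizing to a light cone.  It is
of class `C¹` but not smooth. -/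
def chi (s : ℝ) : ℝ := (max s 0) ^ 2

lemma chi_nonneg (s : ℝ) : 0 ≤ chi s := sq_nonneg _

lemma chi_taylor (s h : ℝ) : |chi (s + h) - chi s - h * (2 * max s 0)| ≤ h ^ 2 := by
  unfold chi
  rw [abs_le]
  rcases le_total (s + h) 0 with h1 | h1 <;> rcases le_total s 0 with h2 | h2 <;>
    simp only [max_eq_left, max_eq_right, h1, h2] <;> constructor <;> nlinarith

lemma hasDerivAt_chi (s : ℝ) : HasDerivAt chi (2 * max s 0) s := by
  rw [hasDerivAt_iff_isLittleO_nhds_zero]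
  refine Asymptotics.IsBigO.trans_isLittleO (g := fun h : ℝ => h ^ 2) ?_ ?_
  · exact Asymptotics.IsBigO.of_bound 1 (Eventually.of_forall fun h => by
      simpa using chi_taylor s h)
  · exact (Asymptotics.isLittleO_pow_id (n := 2) (by norm_num))

lemma contDiff_chi : ContDiff ℝ 1 chi := by
  rw [contDiff_one_iff_deriv]
  refine ⟨fun s => (hasDerivAt_chi s).differentiableAt, ?_⟩
  have : deriv chi = fun s => 2 * max s 0 := funext fun s => (hasDerivAt_chi s).deriv
  rw [this]
  fun_prop

/-- The positive part of `Q + τ`, as a bounded continuous function. -/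
def posB (Q : Sp n →ᵇ ℝ) (τ : ℝ) : Sp n →ᵇ ℝ := (Q + BoundedContinuousFunction.const _ τ) ⊔ 0

lemma posB_apply (Q : Sp n →ᵇ ℝ) (τ : ℝ) (x : Sp n) : posB Q τ x = max (Q x + τ) 0 := rfl

lemma hasDerivAt_posB_sq (Q : Sp n →ᵇ ℝ) (τ : ℝ) :
    HasDerivAt (fun τ => posB Q τ ^ 2) ((2 : ℝ) • posB Q τ) τ := by
  rw [hasDerivAt_iff_isLittleO_nhds_zero]
  refine Asymptotics.IsBigO.trans_isLittleO (g := fun h : ℝ => h ^ 2) ?_ ?_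
  · refine Asymptotics.IsBigO.of_bound 1 (Eventually.of_forall fun h => ?_)
    rw [one_mul]
    refine (BoundedContinuousFunction.norm_le (by positivity)).2 fun x => ?_
    have e : (posB Q (τ + h) ^ 2 - posB Q τ ^ 2 - h • (2 : ℝ) • posB Q τ) x =
        chi (Q x + τ + h) - chi (Q x + τ) - h * (2 * max (Q x + τ) 0) := by
      rw [BoundedContinuousFunction.sub_apply, BoundedContinuousFunction.sub_apply,
        BoundedContinuousFunction.smul_apply, BoundedContinuousFunction.smul_apply,
        BoundedContinuousFunction.pow_apply, BoundedContinuousFunction.pow_apply,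
        posB_apply, posB_apply, add_assoc]
      rfl
    rw [e, Real.norm_eq_abs, Real.norm_of_nonneg (sq_nonneg h)]
    exact chi_taylor (Q x + τ) h
  · exact (Asymptotics.isLittleO_pow_id (n := 2) (by norm_num))

lemma hasDerivWithinAt_bilin {V W X : Type*} [NormedAddCommGroup V] [NormedSpace ℝ V]
    [NormedAddCommGroup W] [NormedSpace ℝ W] [NormedAddCommGroup X] [NormedSpace ℝ X]
    (B : V →L[ℝ] W →L[ℝ] X) {P : ℝ → V} {P' : V} {f : ℝ → W} {f' : W} {s : Set ℝ} {t : ℝ}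
    (hP : HasDerivWithinAt P P' s t) (hf : HasDerivWithinAt f f' s t) :
    HasDerivWithinAt (fun t => B (P t) (f t)) (B P' (f t) + B (P t) f') s t :=
  HasDerivWithinAt.clm_apply (c := fun t => B (P t)) (B.hasFDerivAt.comp_hasDerivWithinAt t hP) hf

/-- The derivative of a quadratic form with a time dependent weight along a curve in `L²`. -/
lemma hasDerivWithinAt_quadratic {E : Type*} [NormedAddCommGroup E] [InnerProductSpace ℝ E]
    {P : ℝ → Sp n →ᵇ ℝ} {P' : Sp n →ᵇ ℝ} {f : ℝ → Lp E 2 (volume : Measure (Sp n))}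
    {f' : Lp E 2 (volume : Measure (Sp n))} {s : Set ℝ} {t : ℝ} (hP : HasDerivWithinAt P P' s t)
    (hf : HasDerivWithinAt f f' s t) :
    HasDerivWithinAt (fun t => inner ℝ (mulL E (P t) (f t)) (f t))
      (inner ℝ (mulL E P' (f t)) (f t) + 2 * inner ℝ (mulL E (P t) (f t)) f') s t := by
  have h1 := hasDerivWithinAt_bilin (mulL (n := n) E) hP hf
  refine (h1.inner ℝ hf).congr_deriv ?_
  rw [inner_add_left, ← inner_mulL_right (P t) f' (f t), real_inner_comm (mulL E (P t) (f t)) f']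
  ring

lemma Setting.contDiffAt_q (hS : Setting a b c q) {x : Sp n} (hx : x ≠ 0) :
    ContDiffAt ℝ 1 (fun x : Sp n => q ‖x‖) x :=
  (hS.q_contDiffOn.contDiffAt (Ici_mem_nhds (norm_pos_iff.2 hx))).comp x (contDiffAt_norm ℝ hx)

lemma Setting.norm_gradient_q (hS : Setting a b c q) {x : Sp n} (hx : x ≠ 0) :
    ‖∇ (fun x : Sp n => q ‖x‖) x‖ ≤ √(c x / b x) := by
  have h0 : 0 < ‖x‖ := norm_pos_iff.2 hx
  have h1 : HasDerivAt q (derivWithin q (Ici 0) ‖x‖) ‖x‖ :=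
    (hS.q_contDiffOn.differentiableOn (by norm_num) _ h0.le).hasDerivWithinAt.hasDerivAt
      (Ici_mem_nhds h0)
  have h2 : HasFDerivAt (fun x : Sp n => ‖x‖) (fderiv ℝ (fun x : Sp n => ‖x‖) x) x :=
    ((contDiffAt_norm ℝ hx).differentiableAt (n := 1) (by norm_num)).hasFDerivAt
  have h3 := h1.comp_hasFDerivAt x h2
  have h4 : ‖fderiv ℝ (fun x : Sp n => ‖x‖) x‖ ≤ 1 := by
    simpa using norm_fderiv_le_of_lipschitz ℝ (lipschitzWith_one_norm (E := Sp n)) (x₀ := x)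
  rw [norm_gradient]
  have h5 : fderiv ℝ (fun x : Sp n => q ‖x‖) x = _ := h3.fderiv
  rw [h5, norm_smul, Real.norm_of_nonneg (hS.q_deriv_pos _ h0.le).le]
  calc _ ≤ derivWithin q (Ici 0) ‖x‖ * 1 := by
        gcongr; exact (hS.q_deriv_pos _ h0.le).le
    _ ≤ _ := by rw [mul_one]; exact hS.q_deriv_le x

/-- The weight localizing to `t + q R < q |x| < L - t`.  The upper bound gives it compact support, and
it recedes with time so that no energy enters from outside. -/
def coneWeight (q : ℝ → ℝ) (R L t : ℝ) (x : Sp n) : ℝ :=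
  chi (q ‖x‖ - t - q R) * chi (L - t - q ‖x‖)

/-- The coefficient of `∇ (q |x|)` in the gradient of `coneWeight`. -/
def coneSlope (q : ℝ → ℝ) (R L t : ℝ) (x : Sp n) : ℝ :=
  2 * max (q ‖x‖ - t - q R) 0 * chi (L - t - q ‖x‖) -
    chi (q ‖x‖ - t - q R) * (2 * max (L - t - q ‖x‖) 0)

lemma Setting.cone_shift_nonpos (hS : Setting a b c q) {R t : ℝ} (ht : 0 ≤ t) {x : Sp n}
    (hx : ‖x‖ < R) : q ‖x‖ - t - q R ≤ 0 := by
  have := hS.strictMonoOn (norm_nonneg x) ((norm_nonneg x).trans hx.le) hx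
  linarith

/-- Regularity and gradient of `coneWeight`.  Near the origin, where `|x|` is not differentiable, the
weight vanishes. -/
lemma Setting.contDiff_coneWeight (hS : Setting a b c q) {R L t : ℝ} (hR : 0 < R) (ht : 0 ≤ t) :
    ContDiff ℝ 1 (coneWeight q R L t : Sp n → ℝ) ∧
      (∀ x, ∇ (coneWeight q R L t : Sp n → ℝ) x =
        coneSlope q R L t x • ∇ (fun x : Sp n => q ‖x‖) x) ∧
      (∀ x : Sp n, coneSlope q R L t x ≠ 0 → x ≠ 0) := by
  have hz : ∀ x : Sp n, ‖x‖ < R → (coneWeight q R L t : Sp n → ℝ) =ᶠ[𝓝 x] fun _ => 0 := by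
    intro x hx
    filter_upwards [(isOpen_lt continuous_norm continuous_const).mem_nhds hx] with y hy
    simp [coneWeight, chi, max_eq_right (hS.cone_shift_nonpos ht hy)]
  have hz' : ∀ x : Sp n, ‖x‖ < R → coneSlope q R L t x = 0 := by
    intro x hx
    simp [coneSlope, chi, max_eq_right (hS.cone_shift_nonpos ht hx)]
  refine ⟨?_, ?_, ?_⟩
  · rw [contDiff_iff_contDiffAt]
    intro x
    rcases lt_or_ge ‖x‖ R with hx | hx
    · exact contDiffAt_const.congr_of_eventuallyEq (hz x hx)
    · have hx0 : x ≠ 0 := norm_pos_iff.1 (hR.trans_le hx)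
      have hq := hS.contDiffAt_q hx0
      exact (contDiff_chi.contDiffAt.comp x
        ((hq.sub contDiffAt_const).sub contDiffAt_const)).mul
        (contDiff_chi.contDiffAt.comp x (contDiffAt_const.sub hq))
  · intro x
    rcases lt_or_ge ‖x‖ R with hx | hx
    · rw [hz' x hx]
      simp [gradient, (hz x hx).fderiv_eq]
    · have hx0 : x ≠ 0 := norm_pos_iff.1 (hR.trans_le hx)
      have hq := ((hS.contDiffAt_q hx0).differentiableAt (by norm_num)).hasFDerivAt
      have h1 := (hasDerivAt_chi (q ‖x‖ - t - q R)).comp_hasFDerivAt x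
        ((hq.sub_const t).sub_const (q R))
      have h2 := (hasDerivAt_chi (L - t - q ‖x‖)).comp_hasFDerivAt x (hq.const_sub (L - t))
      have h3 : fderiv ℝ (coneWeight q R L t : Sp n → ℝ) x = _ := (h1.mul h2).fderiv
      rw [gradient, h3, gradient, ← map_smul]
      congr 1
      ext v
      simp only [coneSlope, Function.comp_apply, _root_.add_apply,
        _root_.smul_apply, _root_.neg_apply, smul_eq_mul]
      ring
  · intro x hx h0
    exact hx (hz' x (by simpa [h0] using hR))

end

/-! ### Vanishing outside of the light cone -/

section

variable {n : ℕ} {a b c : Sp n → ℝ} {q : ℝ → ℝ} {R : ℝ} {m : ℕ} {h : ℝ → Sp n → ℝ}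
  {u : ℝ → L2 n} {g : ℝ → L2Vec n}

/-- Time derivatives commute with the weak gradient, since `weakPairs` is closed. -/
lemma IsSolution.weakGradient_dt (hu : IsSolution m a b c q R h u g) {j : ℕ}
    (hj : j ≤ m) {t : ℝ} (ht : 0 ≤ t) : IsWeakGradient (dt j u t : L2 n) (dt j g t : L2Vec n) := by
  induction j generalizing t with
  | zero => simpa only [dt_zero] using hu.weak_gradient t ht
  | succ j ih =>
    have h1 : HasDerivWithinAt (fun s => (dt j u s, dt j g s)) (dt (j + 1) u t, dt (j + 1) g t)
        (Ici 0) t :=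
      (hasDerivWithinAt_dt (m := m + 1) (by exact_mod_cast hu.contDiffOn_u) (by omega) ht).prodMk
        (hasDerivWithinAt_dt hu.contDiffOn_grad (by omega) ht)
    exact mem_weakPairs.1 (mem_of_hasDerivWithinAt isClosed_weakPairs ht h1
      (mem_weakPairs.2 (ih (by omega) ht))
      (eventually_mem_nhdsWithin.mono fun s hs => mem_weakPairs.2 (ih (by omega) hs)))

lemma IsSolution.continuous_source (hu : IsSolution m a b c q R h u g) {t : ℝ}
    (ht : 0 ≤ t) : Continuous (h t) :=
  continuous_slice hu.contDiffOn_source.continuousOn ht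

lemma locL2_lp {E : Type*} [NormedAddCommGroup E] [NormedSpace ℝ E]
    (f : Lp E 2 (volume : Measure (Sp n))) : LocL2 f := locL2_of_memLp (Lp.memLp f)

/-- The equation in divergence form. -/
lemma IsSolution.equation_div (hS : Setting a b c q)
    (hu : IsSolution m a b c q R h u g) {t : ℝ} (ht : 0 ≤ t) {φ : Sp n → ℝ} (hφ : IsTest φ) :
    ∫ x, ((c x * dt 2 u t x + a x * dt 1 u t x - h t x) * φ x +
      inner ℝ (b x • g t x) (∇ φ x)) = 0 := by
  have h1 : Integrable (fun x => (c x * dt 2 u t x + a x * dt 1 u t x) * φ x) :=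
    (((locL2_lp _).continuous_mul hS.smooth_c.continuous).add
      ((locL2_lp _).continuous_mul hS.smooth_a.continuous)).integrable_mul hφ.continuous hφ.2
  have h2 : Integrable (fun x => inner ℝ (b x • g t x) (∇ φ x)) :=
    ((locL2_lp (g t)).continuous_smul hS.smooth_b.continuous).integrable_inner
      (continuous_gradient hφ.one) (hasCompactSupport_gradient hφ.2)
  have h3 : Integrable (fun x => h t x * φ x) :=
    ((hu.continuous_source ht).mul hφ.continuous).integrable_of_hasCompactSupport hφ.2.mul_left
  have h4 := hu.equation t ht φ hφ
  rw [← sub_eq_zero, ← integral_sub] at h4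
  · rw [← h4]
    refine integral_congr_ae (Eventually.of_forall fun x => ?_)
    simp only [real_inner_smul_left]
    ring
  · refine (h1.add h2).congr (Eventually.of_forall fun x => ?_)
    simp only [Pi.add_apply, real_inner_smul_left]
    ring
  · exact h3

/-- If `v` vanishes on an open set, so does its weak gradient. -/
lemma IsWeakGradient.eq_zero_of_isOpen {v : L2 n} {w : L2Vec n} (hv : IsWeakGradient v w)
    {U : Set (Sp n)} (hU : IsOpen U) (h0 : ∀ᵐ x, x ∈ U → v x = 0) : ∀ᵐ x, x ∈ U → w x = 0 := by
  refine hU.ae_eq_zero_of_integral_contDiff_smul_eq_zero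
    (((Lp.memLp w).locallyIntegrable (by norm_num)).locallyIntegrableOn U) fun φ hφ hs hsU => ?_
  have h1 := hv φ ⟨hφ, hs⟩
  rw [eq_comm, neg_eq_iff_eq_neg] at h1
  rw [h1, neg_eq_zero]
  rw [integral_eq_zero_of_ae]
  filter_upwards [h0] with x hx
  by_cases hxU : x ∈ tsupport φ
  · simp [hx (hsU hxU)]
  · have : ∇ φ x = 0 := image_eq_zero_of_notMem_tsupport fun h => hxU (support_gradient h)
    simp [this]

/-- The pointwise inequality behind the domain of dependence: the flux through the boundary of a
light cone is controlled by the energy density. -/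
lemma cone_flux_le {A B c b u s a : ℝ} {v e : Sp n} (hb : 0 < b) (hc : 0 < c) (ha : 0 ≤ a)
    (hA : 0 ≤ A) (hB : 0 ≤ B) (hs : 0 ≤ s) (he : A - B ≠ 0 → ‖e‖ ≤ √(c / b)) :
    -(A + B) * (c * u ^ 2 + b * ‖v‖ ^ 2) -
      2 * (s * a * u ^ 2 + u * (b * ((A - B) * inner ℝ v e))) ≤ 0 := by
  have h1 : |u * (b * ((A - B) * inner ℝ v e))| ≤ (A + B) * (|u| * ‖v‖ * (b * √(c / b))) := by
    by_cases hAB : A - B = 0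
    · rw [hAB]; simp; positivity
    · rw [abs_mul, abs_mul, abs_mul, abs_of_pos hb]
      have h2 : |inner ℝ v e| ≤ ‖v‖ * √(c / b) :=
        (abs_real_inner_le_norm v e).trans (by gcongr; exact he hAB)
      have h3 : |A - B| ≤ A + B := abs_le.2 ⟨by linarith, by linarith⟩
      calc |u| * (b * (|A - B| * |inner ℝ v e|))
          ≤ |u| * (b * ((A + B) * (‖v‖ * √(c / b)))) := by gcongr
        _ = _ := by ring
  have h2 : 2 * (|u| * ‖v‖ * (b * √(c / b))) ≤ c * u ^ 2 + b * ‖v‖ ^ 2 := by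
    have h4 : √(c / b) ^ 2 = c / b := Real.sq_sqrt (by positivity)
    have h5 : b * √(c / b) ^ 2 = c := by rw [h4]; field_simp
    have h6 : 0 ≤ b * (√(c / b) * |u| - ‖v‖) ^ 2 := by positivity
    have h7 : b * (√(c / b) * |u| - ‖v‖) ^ 2 = (b * √(c / b) ^ 2) * |u| ^ 2
      - 2 * (|u| * ‖v‖ * (b * √(c / b))) + b * ‖v‖ ^ 2 := by ring
    rw [h5, sq_abs] at h7
    linarith
  have h3 : 0 ≤ s * a * u ^ 2 := by positivity
  have h4 := (abs_le.1 h1).1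
  have h5 : (A + B) * (2 * (|u| * ‖v‖ * (b * √(c / b)))) ≤ (A + B) * (c * u ^ 2 + b * ‖v‖ ^ 2) := by
    gcongr
  nlinarith

lemma real_inner_eq_mul (x y : ℝ) : inner ℝ x y = x * y := by simp [mul_comm]

lemma integral_add_four {f₁ f₂ f₃ f₄ : Sp n → ℝ} (h₁ : Integrable f₁) (h₂ : Integrable f₂)
    (h₃ : Integrable f₃) (h₄ : Integrable f₄) :
    Integrable (fun x => f₁ x + 2 * f₂ x + (f₃ x + 2 * f₄ x)) ∧
    (∫ x, f₁ x) + 2 * (∫ x, f₂ x) + ((∫ x, f₃ x) + 2 * (∫ x, f₄ x)) =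
      ∫ x, (f₁ x + 2 * f₂ x + (f₃ x + 2 * f₄ x)) := by
  refine ⟨(h₁.add (h₂.const_mul 2)).add (h₃.add (h₄.const_mul 2)), ?_⟩
  rw [← integral_const_mul, ← integral_const_mul, ← integral_add h₁ (h₂.const_mul 2),
    ← integral_add h₃ (h₄.const_mul 2)]
  exact (integral_add (h₁.add (h₂.const_mul 2)) (h₃.add (h₄.const_mul 2))).symm

lemma quadratic_integral (P₁ P₂ P₃ P₄ : Sp n →ᵇ ℝ) (f f' : L2 n) (k k' : L2Vec n) :
    Integrable (fun x => P₁ x * f x ^ 2 + 2 * (P₂ x * (f x * f' x)) +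
      (P₃ x * ‖k x‖ ^ 2 + 2 * (P₄ x * inner ℝ (k x) (k' x)))) ∧
    inner ℝ (mulL ℝ P₁ f) f + 2 * inner ℝ (mulL ℝ P₂ f) f' +
      (inner ℝ (mulL (Sp n) P₃ k) k + 2 * inner ℝ (mulL (Sp n) P₄ k) k') =
    ∫ x, (P₁ x * f x ^ 2 + 2 * (P₂ x * (f x * f' x)) +
      (P₃ x * ‖k x‖ ^ 2 + 2 * (P₄ x * inner ℝ (k x) (k' x)))) := by
  have key := integral_add_four (integrable_bcf_mul_inner P₁ f f) (integrable_bcf_mul_inner P₂ f f')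
    (integrable_bcf_mul_inner P₃ k k) (integrable_bcf_mul_inner P₄ k k')
  rw [← inner_mulL, ← inner_mulL, ← inner_mulL, ← inner_mulL] at key
  have e : ∀ x, P₁ x * inner ℝ (f x) (f x) + 2 * (P₂ x * inner ℝ (f x) (f' x)) +
      (P₃ x * inner ℝ (k x) (k x) + 2 * (P₄ x * inner ℝ (k x) (k' x))) =
      P₁ x * f x ^ 2 + 2 * (P₂ x * (f x * f' x)) +
      (P₃ x * ‖k x‖ ^ 2 + 2 * (P₄ x * inner ℝ (k x) (k' x))) := fun x => by
    rw [real_inner_self_eq_norm_sq, real_inner_self_eq_norm_sq, Real.norm_eq_abs, sq_abs,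
      real_inner_eq_mul]
  simp_rw [e] at key
  exact key

set_option maxHeartbeats 1000000 in
/-- The energy in the truncated cone `t + q R < q |x| < L - t` stays zero. -/
lemma finite_speed_aux (hS : Setting a b c q) (hR : 0 < R) (hm : 1 ≤ m)
    (hu : IsSolution m a b c q R h u g) (L : ℝ) {t : ℝ} (ht : 0 ≤ t) :
    ∀ᵐ x, coneWeight q R L t x ≠ 0 → dt 1 u t x = 0 ∧ g t x = 0 := by
  obtain ⟨κ, hκ, hκ1⟩ := hS.exists_cutoff L
  set ρ := q R with hρ
  -- `q |x|` and the coefficients are truncated to be bounded, so that they act on `L²`.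
  set Q : Sp n →ᵇ ℝ := BoundedContinuousFunction.ofNormedAddCommGroup
    (fun x => min (q ‖x‖) (L + 1)) (hS.continuous_q.min continuous_const) (|q 0| + |L + 1|)
    (fun x => by
      have h0 : q 0 ≤ q ‖x‖ := hS.strictMonoOn.monotoneOn (by simp) (by simp) (norm_nonneg x)
      rw [Real.norm_eq_abs, abs_le]
      constructor
      · refine le_min ?_ ?_ <;>
          linarith [neg_abs_le (q 0), abs_nonneg (L + 1), abs_nonneg (q 0), neg_abs_le (L + 1)]
      · refine (min_le_right _ _).trans ?_
        linarith [le_abs_self (L + 1), abs_nonneg (q 0)]) with hQ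
  have hQx : ∀ x, Q x = min (q ‖x‖) (L + 1) := fun x => rfl
  set cB : Sp n →ᵇ ℝ := bcfOfCompact (fun x => κ x * c x)
    (hκ.continuous.mul hS.smooth_c.continuous) hκ.2.mul_right with hcB
  set bB : Sp n →ᵇ ℝ := bcfOfCompact (fun x => κ x * b x)
    (hκ.continuous.mul hS.smooth_b.continuous) hκ.2.mul_right with hbB
  set X : ℝ → Sp n →ᵇ ℝ := fun s => posB Q (-(s + ρ)) ^ 2 with hX
  set Y : ℝ → Sp n →ᵇ ℝ := fun s => posB (-Q) (L - s) ^ 2 with hY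
  set X' : ℝ → Sp n →ᵇ ℝ := fun s => (-1 : ℝ) • (2 : ℝ) • posB Q (-(s + ρ)) with hX'
  set Y' : ℝ → Sp n →ᵇ ℝ := fun s => (-1 : ℝ) • (2 : ℝ) • posB (-Q) (L - s) with hY'
  have hXd : ∀ s, HasDerivAt X (X' s) s := fun s =>
    (hasDerivAt_posB_sq Q (-(s + ρ))).scomp s (((hasDerivAt_id s).add_const ρ).neg)
  have hYd : ∀ s, HasDerivAt Y (Y' s) s := fun s =>
    (hasDerivAt_posB_sq (-Q) (L - s)).scomp s ((hasDerivAt_id s).const_sub L)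
  set e : ℝ → ℝ := fun s => inner ℝ (mulL ℝ (X s * Y s * cB) (dt 1 u s)) (dt 1 u s) +
    inner ℝ (mulL (Sp n) (X s * Y s * bB) (g s)) (g s) with he
  have hX0 : ∀ s x, X s x = (max (Q x - s - ρ) 0) ^ 2 := fun s x => by
    simp only [hX, BoundedContinuousFunction.pow_apply, posB_apply]; ring_nf
  have hY0 : ∀ s x, Y s x = (max (L - s - Q x) 0) ^ 2 := fun s x => by
    simp only [hY, BoundedContinuousFunction.pow_apply, posB_apply,
      BoundedContinuousFunction.neg_apply]; ring_nf
  have hX1 : ∀ s x, X' s x = -(2 * max (Q x - s - ρ) 0) := fun s x => by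
    simp only [hX', BoundedContinuousFunction.smul_apply, posB_apply, smul_eq_mul]; ring_nf
  have hY1 : ∀ s x, Y' s x = -(2 * max (L - s - Q x) 0) := fun s x => by
    simp only [hY', BoundedContinuousFunction.smul_apply, posB_apply, smul_eq_mul,
      BoundedContinuousFunction.neg_apply]; ring_nf
  -- Inside `q |x| ≤ L` the truncations are invisible, outside it the weight vanishes.
  have hW : ∀ s, 0 ≤ s → ∀ x, (X s x * Y s x) = coneWeight q R L s x ∧
      (X s x * Y s x) * κ x = coneWeight q R L s x ∧
      (X' s x * Y s x + X s x * Y' s x) * κ x =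
        -(2 * max (q ‖x‖ - s - q R) 0 * chi (L - s - q ‖x‖) +
          chi (q ‖x‖ - s - q R) * (2 * max (L - s - q ‖x‖) 0)) := by
    intro s hs x
    rw [hX0, hY0, hX1, hY1]
    rcases le_or_gt (q ‖x‖) L with hx | hx
    · have h1 : Q x = q ‖x‖ := by rw [hQx, min_eq_left (by linarith)]
      rw [h1, hκ1 x hx]
      simp only [coneWeight, chi]
      refine ⟨by ring, by ring, by ring⟩
    · have h1 : max (L - s - Q x) 0 = 0 :=
        max_eq_right (by rw [hQx]; linarith [le_min hx.le (by linarith : L ≤ L + 1)])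
      have h2 : max (L - s - q ‖x‖) 0 = 0 := max_eq_right (by linarith)
      simp [coneWeight, chi, h1, h2]
  have he_int : ∀ s, 0 ≤ s → e s = ∫ x, coneWeight q R L s x *
      (c x * (dt 1 u s x) ^ 2 + b x * ‖g s x‖ ^ 2) := by
    intro s hs
    simp only [he, inner_mulL]
    rw [← integral_add (integrable_bcf_mul_inner _ _ _) (integrable_bcf_mul_inner _ _ _)]
    refine integral_congr_ae (Eventually.of_forall fun x => ?_)
    simp only [BoundedContinuousFunction.mul_apply, hcB, hbB, bcfOfCompact_apply,
      real_inner_self_eq_norm_sq, Real.norm_eq_abs, sq_abs]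
    rw [← (hW s hs x).2.1]
    ring
  have hint : ∀ s, 0 ≤ s → Integrable (fun x => coneWeight q R L s x *
      (c x * (dt 1 u s x) ^ 2 + b x * ‖g s x‖ ^ 2)) := by
    intro s hs
    refine ((integrable_bcf_mul_inner (X s * Y s * cB) (dt 1 u s) (dt 1 u s)).add
      (integrable_bcf_mul_inner (X s * Y s * bB) (g s) (g s))).congr
      (Eventually.of_forall fun x => ?_)
    simp only [Pi.add_apply, BoundedContinuousFunction.mul_apply, hcB, hbB, bcfOfCompact_apply,
      real_inner_self_eq_norm_sq, Real.norm_eq_abs, sq_abs]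
    rw [← (hW s hs x).2.1]
    ring
  have hderiv : ∀ s, 0 ≤ s → ∃ e', HasDerivWithinAt e e' (Ici 0) s ∧ e' ≤ 0 := by
    intro s hs
    have hu1 : HasDerivWithinAt (dt 1 u) (dt 2 u s) (Ici 0) s :=
      hasDerivWithinAt_dt (m := m + 1) (by exact_mod_cast hu.contDiffOn_u) (by omega) hs
    have hg1 : HasDerivWithinAt g (dt 1 g s) (Ici 0) s := by
      have := hasDerivWithinAt_dt (j := 0) hu.contDiffOn_grad (by omega) hs
      exact this.congr (fun r _ => (dt_zero g r).symm) (dt_zero g s).symm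
    have hPc := ((hXd s).mul (hYd s)).mul_const cB
    have hPb := ((hXd s).mul (hYd s)).mul_const bB
    have hd := (hasDerivWithinAt_quadratic hPc.hasDerivWithinAt hu1).add
      (hasDerivWithinAt_quadratic hPb.hasDerivWithinAt hg1)
    refine ⟨_, hd, ?_⟩
    obtain ⟨hΨ1, hΨ2, hΨ3⟩ := hS.contDiff_coneWeight (L := L) hR hs
    have hΨs : HasCompactSupport (coneWeight q R L s : Sp n → ℝ) := by
      refine HasCompactSupport.intro (hS.isCompact_cone L) fun x hx => ?_
      have : max (L - s - q ‖x‖) 0 = 0 := max_eq_right (by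
        have : L < q ‖x‖ := not_le.1 hx
        linarith)
      simp [coneWeight, chi, this]
    have hloc_f : LocL2 (fun x => c x * dt 2 u s x + a x * dt 1 u s x - h s x) :=
      (((locL2_lp _).continuous_mul hS.smooth_c.continuous).add
        ((locL2_lp _).continuous_mul hS.smooth_a.continuous)).sub
        (locL2_of_continuous (hu.continuous_source hs))
    have hloc_G : LocL2 (fun x => b x • g s x) :=
      (locL2_lp (g s)).continuous_smul hS.smooth_b.continuous
    -- The equation tested with `coneWeight * u_t`.
    obtain ⟨hi, hz⟩ := integral_eq_zero_of_weak_local hloc_f hloc_G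
      (fun φ hφ => hu.equation_div hS hs hφ) (hu.weakGradient_dt hm hs) hΨ1 hΨs
    obtain ⟨hi', hz'⟩ := quadratic_integral ((X' s * Y s + X s * Y' s) * cB) (X s * Y s * cB)
      ((X' s * Y s + X s * Y' s) * bB) (X s * Y s * bB) (dt 1 u s) (dt 2 u s) (g s) (dt 1 g s)
    have hz2 := (integral_sub hi' (hi.const_mul 2)).symm
    rw [integral_const_mul, hz, mul_zero, sub_zero, ← hz'] at hz2
    refine le_of_eq_of_le hz2 ?_
    · refine integral_nonpos fun x => ?_
      simp only [Pi.zero_apply, BoundedContinuousFunction.mul_apply,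
        BoundedContinuousFunction.add_apply, hcB, hbB, bcfOfCompact_apply, hΨ2]
      have hh : h s x * coneWeight q R L s x = 0 := by
        by_cases hx : s + q R < q ‖x‖
        · rw [hu.source_support s hs x hx, zero_mul]
        · have : max (q ‖x‖ - s - q R) 0 = 0 := max_eq_right (by linarith)
          simp [coneWeight, chi, this]
      have hfl := cone_flux_le (n := n) (A := 2 * max (q ‖x‖ - s - q R) 0 * chi (L - s - q ‖x‖))
        (B := chi (q ‖x‖ - s - q R) * (2 * max (L - s - q ‖x‖) 0)) (u := dt 1 u s x)
        (s := coneWeight q R L s x) (v := g s x) (e := ∇ (fun x : Sp n => q ‖x‖) x)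
        (hS.pos_b x) (hS.pos_c x) (hS.pos_a x).le
        (mul_nonneg (by positivity) (chi_nonneg _)) (mul_nonneg (chi_nonneg _) (by positivity))
        (mul_nonneg (chi_nonneg _) (chi_nonneg _))
        (fun hne => hS.norm_gradient_q (hΨ3 x hne))
      refine le_trans (le_of_eq ?_) hfl
      obtain ⟨hw1, hw2, hw3⟩ := hW s hs x
      simp only [inner_add_right, real_inner_smul_right, real_inner_smul_left, coneSlope]
      have r1 : (X' s x * Y s x + X s x * Y' s x) * (κ x * c x) =
          ((X' s x * Y s x + X s x * Y' s x) * κ x) * c x := by ring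
      have r2 : (X' s x * Y s x + X s x * Y' s x) * (κ x * b x) =
          ((X' s x * Y s x + X s x * Y' s x) * κ x) * b x := by ring
      have r3 : X s x * Y s x * (κ x * c x) = X s x * Y s x * κ x * c x := by ring
      have r4 : X s x * Y s x * (κ x * b x) = X s x * Y s x * κ x * b x := by ring
      rw [r1, r2, r3, r4, hw2, hw3]
      linear_combination (2 * dt 1 u s x) * hh
  have hanti : AntitoneOn e (Ici 0) := by
    refine antitoneOn_of_deriv_nonpos (convex_Ici 0) ?_ ?_ ?_
    · intro s hs
      obtain ⟨e', h1, -⟩ := hderiv s hs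
      exact h1.continuousWithinAt
    · intro s hs
      rw [interior_Ici] at hs
      obtain ⟨e', h1, -⟩ := hderiv s (le_of_lt hs)
      exact (h1.hasDerivAt (Ici_mem_nhds hs)).differentiableAt.differentiableWithinAt
    · intro s hs
      rw [interior_Ici] at hs
      obtain ⟨e', h1, h2⟩ := hderiv s (le_of_lt hs)
      rw [(h1.hasDerivAt (Ici_mem_nhds hs)).deriv]
      exact h2
  have he0 : e 0 = 0 := by
    rw [he_int 0 le_rfl]
    have hUo : IsOpen {x : Sp n | R < ‖x‖} := isOpen_lt continuous_const continuous_norm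
    have hg0 := (hu.weak_gradient 0 le_rfl).eq_zero_of_isOpen hUo
      (hu.data_support.mono fun x hx hxR => (hx hxR).1)
    refine integral_eq_zero_of_ae ?_
    filter_upwards [hu.data_support, hg0] with x h1 h2
    by_cases hx : R < ‖x‖
    · simp [(h1 hx).2, h2 hx]
    · have : q ‖x‖ ≤ q R :=
        hS.strictMonoOn.monotoneOn (norm_nonneg x) hR.le (not_lt.1 hx)
      have h3 : max (q ‖x‖ - 0 - q R) 0 = 0 := max_eq_right (by linarith)
      simp only [coneWeight, chi, h3]
      simp
  have hnn : ∀ x : Sp n, 0 ≤ coneWeight q R L t x *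
      (c x * (dt 1 u t x) ^ 2 + b x * ‖g t x‖ ^ 2) := fun x =>
    mul_nonneg (mul_nonneg (chi_nonneg _) (chi_nonneg _))
      (by have := hS.pos_c x; have := hS.pos_b x; positivity)
  have het : e t = 0 := by
    refine le_antisymm (he0 ▸ hanti self_mem_Ici ht ht) ?_
    rw [he_int t ht]
    exact integral_nonneg hnn
  rw [he_int t ht, integral_eq_zero_iff_of_nonneg hnn (hint t ht)] at het
  filter_upwards [het] with x hx hx0
  have h1 : c x * (dt 1 u t x) ^ 2 + b x * ‖g t x‖ ^ 2 = 0 := by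
    simpa [hx0] using hx
  have hcx := hS.pos_c x
  have hbx := hS.pos_b x
  obtain ⟨h2, h3⟩ := (add_eq_zero_iff_of_nonneg (mul_nonneg hcx.le (sq_nonneg _))
    (mul_nonneg hbx.le (sq_nonneg _))).1 h1
  exact ⟨by simpa [hcx.ne'] using h2, by simpa [hbx.ne'] using h3⟩

/-- Finite speed of propagation: `∂_t u` and `∇ u` vanish where `q |x| > t + q R`. -/
theorem finite_speed (hS : Setting a b c q) (hR : 0 < R) (hm : 1 ≤ m)
    (hu : IsSolution m a b c q R h u g) {t : ℝ} (ht : 0 ≤ t) :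
    ∀ᵐ x : Sp n, t + q R < q ‖x‖ → dt 1 u t x = 0 ∧ g t x = 0 := by
  -- The truncation at `q |x| = L - t` is removed by letting `L` run through the naturals.
  have := ae_all_iff.2 fun k : ℕ => finite_speed_aux hS hR hm hu k ht
  filter_upwards [this] with x hx hxt
  obtain ⟨k, hk⟩ := exists_nat_gt (q ‖x‖ + t)
  refine hx k ?_
  unfold coneWeight chi
  rw [max_eq_left (by linarith), max_eq_left (by linarith)]
  have h1 : q ‖x‖ - t - q R ≠ 0 := by linarith
  have h2 : (k : ℝ) - t - q ‖x‖ ≠ 0 := by linarith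
  positivity

end

/-! ### Energy identities for abstract damped wave equations -/

section Abstract

variable {X Y : Type*} [NormedAddCommGroup X] [InnerProductSpace ℝ X]
  [NormedAddCommGroup Y] [InnerProductSpace ℝ Y]

/-- A solution `z` on `[0, τ)` of `C z'' + B k + A z' = F`, tested with the pairs in `G`, where
`k` is the gradient of `z` (so that the pairs `(z', k')` lie in `G`).  Only `p = z'` enters.  The
functions `p'`, `k'` are derivatives of `p`, `k`; `F'` is meant to be the derivative of `F`, which is
assumed only where it is needed. -/
structure AbstractWave (G : Submodule ℝ (X × Y)) (C A : X →L[ℝ] X) (B : Y →L[ℝ] Y) (τ : ℝ)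
    (p p' : ℝ → X) (k k' : ℝ → Y) (F F' : ℝ → X) : Prop where
  symm_C : ∀ x y, inner ℝ (C x) y = inner ℝ x (C y)
  symm_A : ∀ x y, inner ℝ (A x) y = inner ℝ x (A y)
  symm_B : ∀ x y, inner ℝ (B x) y = inner ℝ x (B y)
  deriv_p : ∀ t ∈ Ico 0 τ, HasDerivWithinAt p (p' t) (Ici 0) t
  deriv_k : ∀ t ∈ Ico 0 τ, HasDerivWithinAt k (k' t) (Ici 0) t
  mem : ∀ t ∈ Ico 0 τ, (p t, k' t) ∈ G
  eq : ∀ t ∈ Ico 0 τ, ∀ w ∈ G,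
    inner ℝ (C (p' t)) w.1 + inner ℝ (B (k t)) w.2 + inner ℝ (A (p t)) w.1 = inner ℝ (F t) w.1

variable {G : Submodule ℝ (X × Y)} {C A : X →L[ℝ] X} {B : Y →L[ℝ] Y} {τ : ℝ}
  {p p' : ℝ → X} {k k' : ℝ → Y} {F F' : ℝ → X}

lemma hasDerivWithinAt_quad {V : Type*} [NormedAddCommGroup V] [InnerProductSpace ℝ V]
    {C : V →L[ℝ] V} (hC : ∀ x y, inner ℝ (C x) y = inner ℝ x (C y)) {f : ℝ → V} {f' : V}
    {s : Set ℝ} {t : ℝ} (hf : HasDerivWithinAt f f' s t) :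
    HasDerivWithinAt (fun t => inner ℝ (C (f t)) (f t)) (2 * inner ℝ (C f') (f t)) s t := by
  have h1 := (C.hasFDerivAt.comp_hasDerivWithinAt t hf).inner ℝ hf
  refine h1.congr_deriv ?_
  simp only [Function.comp_apply]
  rw [hC (f t) f', real_inner_comm]
  ring

/-- The energy identity, without loss of regularity. -/
lemma AbstractWave.hasDerivWithinAt_energy (h : AbstractWave G C A B τ p p' k k' F F') {t : ℝ}
    (ht : t ∈ Ico 0 τ) :
    HasDerivWithinAt (fun t => inner ℝ (C (p t)) (p t) + inner ℝ (B (k t)) (k t))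
      (2 * (inner ℝ (F t) (p t) - inner ℝ (A (p t)) (p t))) (Ici 0) t := by
  refine ((hasDerivWithinAt_quad h.symm_C (h.deriv_p t ht)).add
    (hasDerivWithinAt_quad h.symm_B (h.deriv_k t ht))).congr_deriv ?_
  have := h.eq t ht _ (h.mem t ht)
  simp only at this
  rw [← this, h.symm_B (k' t), real_inner_comm (B (k t)) (k' t)]
  ring

/-- At a zero of the first factor, continuity of the second one suffices in the product rule. -/
lemma hasDerivWithinAt_inner_of_eq_zero {V : Type*} [NormedAddCommGroup V] [InnerProductSpace ℝ V]
    {f g : ℝ → V} {f' : V} {s : Set ℝ} {t : ℝ} (hf : HasDerivWithinAt f f' s t) (h0 : f t = 0)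
    (hg : ContinuousWithinAt g s t) :
    HasDerivWithinAt (fun r => inner ℝ (f r) (g r)) (inner ℝ f' (g t)) s t := by
  rw [hasDerivWithinAt_iff_tendsto_slope] at hf ⊢
  have h1 := hf.inner (𝕜 := ℝ) (hg.mono_left (nhdsWithin_mono t sdiff_subset))
  refine h1.congr fun r => ?_
  simp [slope, h0, real_inner_smul_left]

/-- The virial identity, which is formally the differentiated equation tested with `z'`.  As `C p'`
need not be differentiable, `⟨C p', p⟩` is differentiated by means of the equation at time `s`, tested
with the pair at time `s` itself: it is
`⟨C p'(t), p(s)⟩ + ⟨F(s) - F(t), p(s)⟩ - ⟨B (k(s) - k(t)), k'(s)⟩ - ⟨A (p(s) - p(t)), p(s)⟩`. -/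
lemma AbstractWave.hasDerivWithinAt_virial (h : AbstractWave G C A B τ p p' k k' F F')
    (hkc : ContinuousOn k' (Ico 0 τ)) {t : ℝ} (ht : t ∈ Ico 0 τ)
    (hF : HasDerivWithinAt F (F' t) (Ici 0) t) :
    HasDerivWithinAt (fun t => inner ℝ (C (p' t)) (p t) + inner ℝ (A (p t)) (p t) / 2)
      (inner ℝ (F' t) (p t) + inner ℝ (C (p' t)) (p' t) - inner ℝ (B (k' t)) (k' t)) (Ici 0) t := by
  have hp := h.deriv_p t ht
  have hk := h.deriv_k t ht
  have hI : ∀ᶠ s in 𝓝[Ici 0] t, s ∈ Ico 0 τ := by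
    filter_upwards [self_mem_nhdsWithin, mem_nhdsWithin_of_mem_nhds (Iio_mem_nhds ht.2)]
      with s h1 h2 using ⟨h1, h2⟩
  have hkc' : ContinuousWithinAt k' (Ici 0) t :=
    (hkc t ht).mono_of_mem_nhdsWithin hI
  have d1 := hasDerivWithinAt_inner_of_eq_zero (hF.sub_const (F t)) (sub_self _)
    hp.continuousWithinAt
  have d2 := hasDerivWithinAt_inner_of_eq_zero
    (B.hasFDerivAt.comp_hasDerivWithinAt t (hk.sub_const (k t))) (by simp) hkc'
  have d3 := hasDerivWithinAt_inner_of_eq_zero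
    (A.hasFDerivAt.comp_hasDerivWithinAt t (hp.sub_const (p t))) (by simp) hp.continuousWithinAt
  have d4 := (hasDerivWithinAt_const t (Ici 0) (C (p' t))).inner ℝ (hp.sub_const (p t))
  have d5 := (hasDerivWithinAt_quad h.symm_A hp).div_const 2
  have d := ((((d1.sub d2).sub d3).add d4).add d5).add_const (inner ℝ (C (p' t)) (p t))
  refine (d.congr_deriv ?_).congr_of_eventuallyEq_of_mem ?_ ht.1
  · simp only [inner_zero_left, add_zero]
    ring
  · filter_upwards [hI] with s hs
    have e1 := h.eq s hs _ (h.mem s hs)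
    have e2 := h.eq t ht _ (h.mem s hs)
    simp only [Function.comp_apply, map_sub, inner_sub_left, inner_sub_right, Pi.add_apply,
      Pi.sub_apply] at e1 e2 ⊢
    linarith

/-- Difference quotients of solutions are solutions. -/
lemma AbstractWave.quotient (h : AbstractWave G C A B τ p p' k k' F F') {δ : ℝ} (hδ : 0 < δ) :
    AbstractWave G C A B (τ - δ) (fun t => δ⁻¹ • (p (t + δ) - p t))
      (fun t => δ⁻¹ • (p' (t + δ) - p' t)) (fun t => δ⁻¹ • (k (t + δ) - k t))
      (fun t => δ⁻¹ • (k' (t + δ) - k' t)) (fun t => δ⁻¹ • (F (t + δ) - F t))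
      (fun t => δ⁻¹ • (F' (t + δ) - F' t)) where
  symm_C := h.symm_C
  symm_A := h.symm_A
  symm_B := h.symm_B
  deriv_p t ht := by
    have h1 := (h.deriv_p (t + δ) ⟨by linarith [ht.1], by linarith [ht.2]⟩).hasDerivAt
      (Ici_mem_nhds (by linarith [ht.1]))
    exact ((h1.comp_add_const t δ).hasDerivWithinAt.sub
      (h.deriv_p t ⟨ht.1, by linarith [ht.2]⟩)).const_smul δ⁻¹
  deriv_k t ht := by
    have h1 := (h.deriv_k (t + δ) ⟨by linarith [ht.1], by linarith [ht.2]⟩).hasDerivAt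
      (Ici_mem_nhds (by linarith [ht.1]))
    exact ((h1.comp_add_const t δ).hasDerivWithinAt.sub
      (h.deriv_k t ⟨ht.1, by linarith [ht.2]⟩)).const_smul δ⁻¹
  mem t ht := G.smul_mem δ⁻¹ (G.sub_mem (h.mem (t + δ) ⟨by linarith [ht.1], by linarith [ht.2]⟩)
    (h.mem t ⟨ht.1, by linarith [ht.2]⟩))
  eq t ht w hw := by
    have e1 := h.eq (t + δ) ⟨by linarith [ht.1], by linarith [ht.2]⟩ w hw
    have e2 := h.eq t ⟨ht.1, by linarith [ht.2]⟩ w hw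
    simp only [map_smul, map_sub, real_inner_smul_left, inner_sub_left]
    linear_combination δ⁻¹ * (e1 - e2)

/-- Difference quotients converge to the derivative, and are bounded on compact intervals. -/
lemma quotient_tendsto {V : Type*} [NormedAddCommGroup V] [NormedSpace ℝ V] {f f' : ℝ → V}
    {T δ₀ : ℝ} (hδ₀ : 0 < δ₀) (hd : ∀ r ∈ Icc 0 (T + δ₀), HasDerivWithinAt f (f' r) (Ici 0) r)
    (hc : ContinuousOn f' (Icc 0 (T + δ₀))) :
    (∀ r ∈ Icc 0 T, Tendsto (fun j : ℕ => (δ₀ / (j + 1))⁻¹ • (f (r + δ₀ / (j + 1)) - f r)) atTop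
      (𝓝 (f' r))) ∧
    ∃ M, 0 ≤ M ∧ ∀ (j : ℕ), ∀ r ∈ Icc 0 T, ‖(δ₀ / (j + 1))⁻¹ • (f (r + δ₀ / (j + 1)) - f r)‖ ≤ M := by
  have hpos : ∀ j : ℕ, 0 < δ₀ / ((j : ℝ) + 1) := fun j => by positivity
  have hle : ∀ j : ℕ, δ₀ / ((j : ℝ) + 1) ≤ δ₀ := fun j =>
    div_le_self hδ₀.le (by linarith [(Nat.cast_nonneg j : (0 : ℝ) ≤ j)])
  constructor
  · intro r hr
    have h1 := hasDerivWithinAt_iff_tendsto_slope.1 (hd r ⟨hr.1, by linarith [hr.2]⟩)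
    have h0 : Tendsto (fun j : ℕ => δ₀ / ((j : ℝ) + 1)) atTop (𝓝 0) :=
      by simpa [div_eq_mul_inv] using
        (tendsto_one_div_add_atTop_nhds_zero_nat (𝕜 := ℝ)).const_mul δ₀
    have h2 : Tendsto (fun j : ℕ => r + δ₀ / ((j : ℝ) + 1)) atTop (𝓝[Ici 0 \ {r}] r) := by
      refine tendsto_nhdsWithin_iff.2 ⟨?_, Eventually.of_forall fun j => ?_⟩
      · simpa using h0.const_add r
      · exact ⟨mem_Ici.2 (by linarith [hr.1, hpos j]), by simpa using (hpos j).ne'⟩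
    refine (h1.comp h2).congr fun j => ?_
    simp [slope]
  · obtain ⟨M, hM⟩ := isCompact_Icc.exists_bound_of_continuousOn hc
    refine ⟨max M 0, le_max_right _ _, fun j r hr => ?_⟩
    have h1 := (convex_Icc (0 : ℝ) (T + δ₀)).norm_image_sub_le_of_norm_hasDerivWithin_le
      (f := f) (f' := f') (C := max M 0) (x := r) (y := r + δ₀ / (j + 1))
      (fun s hs => (hd s hs).mono Icc_subset_Ici_self) (fun s hs => (hM s hs).trans (le_max_left _ _))
      ⟨hr.1, by linarith [hr.2]⟩ ⟨by linarith [hr.1, hpos j], by linarith [hr.2, hle j]⟩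
    rw [add_sub_cancel_left, Real.norm_of_nonneg (hpos j).le] at h1
    rw [norm_smul, norm_inv, Real.norm_of_nonneg (hpos j).le, inv_mul_le_iff₀ (hpos j)]
    linarith

lemma continuousOn_quotient {V : Type*} [NormedAddCommGroup V] [NormedSpace ℝ V] {f f' : ℝ → V}
    {s t δ : ℝ} (hs : 0 ≤ s) (hδ : 0 < δ) (ht : t + δ < τ)
    (hf : ∀ r ∈ Ico 0 τ, HasDerivWithinAt f (f' r) (Ici 0) r) :
    ContinuousOn (fun r => δ⁻¹ • (f (r + δ) - f r)) (Icc s t) := by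
  have hfc : ContinuousOn f (Ico 0 τ) := fun r hr =>
    (hf r hr).continuousWithinAt.mono Ico_subset_Ici_self
  refine ContinuousOn.const_smul (ContinuousOn.sub ?_ (hfc.mono fun r hr =>
    ⟨hs.trans hr.1, by linarith [hr.2]⟩)) _
  exact hfc.comp (by fun_prop) fun r hr => ⟨by linarith [hr.1], by linarith [hr.2]⟩

lemma tendsto_quad {V : Type*} [NormedAddCommGroup V] [InnerProductSpace ℝ V] (D : V →L[ℝ] V)
    {f : ℕ → V} {v : V} (hf : Tendsto f atTop (𝓝 v)) :
    Tendsto (fun j => inner ℝ (D (f j)) (f j)) atTop (𝓝 (inner ℝ (D v) v)) :=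
  ((D.continuous.tendsto v).comp hf).inner hf

/-- The energy identity for the time derivative of a solution.  Since the second time derivative
of `z'` need not exist, it is obtained as a limit of the identities for difference quotients. -/
lemma AbstractWave.energy_deriv_sub (h : AbstractWave G C A B τ p p' k k' F F')
    (hpc : ContinuousOn p' (Ico 0 τ)) (hkc : ContinuousOn k' (Ico 0 τ))
    (hFc : ContinuousOn F' (Ico 0 τ)) (hF : ∀ t ∈ Ico 0 τ, HasDerivWithinAt F (F' t) (Ici 0) t)
    {s t : ℝ} (hs : 0 ≤ s) (hst : s ≤ t) (ht : t < τ) :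
    (inner ℝ (C (p' t)) (p' t) + inner ℝ (B (k' t)) (k' t)) -
      (inner ℝ (C (p' s)) (p' s) + inner ℝ (B (k' s)) (k' s)) =
      ∫ r in s..t, 2 * (inner ℝ (F' r) (p' r) - inner ℝ (A (p' r)) (p' r)) := by
  set δ₀ := (τ - t) / 2 with hδ₀
  have hδ0 : 0 < δ₀ := by rw [hδ₀]; linarith
  have hsub : Icc 0 (t + δ₀) ⊆ Ico 0 τ := fun r hr => ⟨hr.1, by rw [hδ₀] at hr; linarith [hr.2]⟩
  have hpos : ∀ j : ℕ, 0 < δ₀ / ((j : ℝ) + 1) := fun j => by positivity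
  have hle : ∀ j : ℕ, δ₀ / ((j : ℝ) + 1) ≤ δ₀ := fun j =>
    div_le_self hδ0.le (by linarith [(Nat.cast_nonneg j : (0 : ℝ) ≤ j)])
  obtain ⟨tp, Mp, hMp, bp⟩ := quotient_tendsto (T := t) hδ0
    (fun r hr => h.deriv_p r (hsub hr)) (hpc.mono hsub)
  obtain ⟨tk, -⟩ := quotient_tendsto (T := t) hδ0
    (fun r hr => h.deriv_k r (hsub hr)) (hkc.mono hsub)
  obtain ⟨tF, MF, hMF, bF⟩ := quotient_tendsto (T := t) hδ0
    (fun r hr => hF r (hsub hr)) (hFc.mono hsub)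
  set P : ℕ → ℝ → X := fun j r => (δ₀ / (j + 1))⁻¹ • (p (r + δ₀ / (j + 1)) - p r) with hP
  set K : ℕ → ℝ → Y := fun j r => (δ₀ / (j + 1))⁻¹ • (k (r + δ₀ / (j + 1)) - k r) with hK
  set Φ : ℕ → ℝ → X := fun j r => (δ₀ / (j + 1))⁻¹ • (F (r + δ₀ / (j + 1)) - F r) with hΦ
  have cP : ∀ j, ContinuousOn (P j) (Icc s t) := fun j =>
    continuousOn_quotient hs (hpos j) (by linarith [hle j, hδ₀]) h.deriv_p
  have cK : ∀ j, ContinuousOn (K j) (Icc s t) := fun j =>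
    continuousOn_quotient hs (hpos j) (by linarith [hle j, hδ₀]) h.deriv_k
  have cF : ∀ j, ContinuousOn (Φ j) (Icc s t) := fun j =>
    continuousOn_quotient hs (hpos j) (by linarith [hle j, hδ₀]) hF
  have cI : ∀ j, ContinuousOn (fun r => 2 * (inner ℝ (Φ j r) (P j r) - inner ℝ (A (P j r)) (P j r)))
      (Icc s t) := fun j =>
    continuousOn_const.mul (((cF j).inner (cP j)).sub
      ((A.continuous.comp_continuousOn (cP j)).inner (cP j)))
  have hj : ∀ j, (inner ℝ (C (P j t)) (P j t) + inner ℝ (B (K j t)) (K j t)) -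
      (inner ℝ (C (P j s)) (P j s) + inner ℝ (B (K j s)) (K j s)) =
      ∫ r in s..t, 2 * (inner ℝ (Φ j r) (P j r) - inner ℝ (A (P j r)) (P j r)) := by
    intro j
    have hq := h.quotient (hpos j)
    have hd : ∀ r ∈ Icc s t, HasDerivWithinAt
        (fun t => inner ℝ (C (P j t)) (P j t) + inner ℝ (B (K j t)) (K j t)) _ (Ici 0) r :=
      fun r hr => hq.hasDerivWithinAt_energy
        ⟨hs.trans hr.1, by linarith [hr.2, hle j, hδ₀]⟩
    symm
    refine intervalIntegral.integral_eq_sub_of_hasDerivAt_of_le hst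
      (f := fun t => inner ℝ (C (P j t)) (P j t) + inner ℝ (B (K j t)) (K j t)) ?_ ?_ ?_
    · exact fun r hr => (hd r hr).continuousWithinAt.mono fun r' hr' => hs.trans hr'.1
    · exact fun r hr => (hd r (Ioo_subset_Icc_self hr)).hasDerivAt
        (Ici_mem_nhds (hs.trans_lt hr.1))
    · exact (cI j).intervalIntegrable_of_Icc hst
  have h0s : s ∈ Icc 0 t := ⟨hs, hst⟩
  have h0t : t ∈ Icc 0 t := ⟨hs.trans hst, le_rfl⟩
  have lim1 : Tendsto (fun j => (inner ℝ (C (P j t)) (P j t) + inner ℝ (B (K j t)) (K j t)) -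
      (inner ℝ (C (P j s)) (P j s) + inner ℝ (B (K j s)) (K j s))) atTop
      (𝓝 ((inner ℝ (C (p' t)) (p' t) + inner ℝ (B (k' t)) (k' t)) -
      (inner ℝ (C (p' s)) (p' s) + inner ℝ (B (k' s)) (k' s)))) :=
    ((tendsto_quad C (tp t h0t)).add (tendsto_quad B (tk t h0t))).sub
      ((tendsto_quad C (tp s h0s)).add (tendsto_quad B (tk s h0s)))
  have lim2 : Tendsto (fun j => ∫ r in s..t,
      2 * (inner ℝ (Φ j r) (P j r) - inner ℝ (A (P j r)) (P j r))) atTop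
      (𝓝 (∫ r in s..t, 2 * (inner ℝ (F' r) (p' r) - inner ℝ (A (p' r)) (p' r)))) := by
    refine intervalIntegral.tendsto_integral_filter_of_dominated_convergence
      (fun _ => 2 * (MF * Mp + ‖A‖ * Mp * Mp)) ?_ ?_ ?_ ?_
    · refine Eventually.of_forall fun j => ?_
      rw [uIoc_of_le hst]
      exact ((cI j).mono Ioc_subset_Icc_self).aestronglyMeasurable measurableSet_Ioc
    · refine Eventually.of_forall fun j => Eventually.of_forall fun r hr => ?_
      rw [uIoc_of_le hst] at hr
      have hr' : r ∈ Icc 0 t := ⟨hs.trans hr.1.le, hr.2⟩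
      have b1 := bp j r hr'
      have b2 := bF j r hr'
      rw [norm_mul, Real.norm_of_nonneg (by norm_num : (0 : ℝ) ≤ 2)]
      refine mul_le_mul_of_nonneg_left ((norm_sub_le _ _).trans (add_le_add ?_ ?_)) (by norm_num)
      · exact (norm_inner_le_norm _ _).trans (mul_le_mul b2 b1 (norm_nonneg _) hMF)
      · exact (norm_inner_le_norm _ _).trans (mul_le_mul ((A.le_opNorm _).trans (by gcongr)) b1
          (norm_nonneg _) (by positivity))
    · exact intervalIntegrable_const
    · refine Eventually.of_forall fun r hr => ?_
      rw [uIoc_of_le hst] at hr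
      have hr' : r ∈ Icc 0 t := ⟨hs.trans hr.1.le, hr.2⟩
      exact (((tF r hr').inner (tp r hr')).sub (tendsto_quad A (tp r hr'))).const_mul 2
  refine tendsto_nhds_unique lim1 (lim2.congr fun j => (hj j).symm)

/-- The differential form of `AbstractWave.energy_deriv_sub`. -/
lemma AbstractWave.hasDerivAt_energy_deriv (h : AbstractWave G C A B τ p p' k k' F F')
    (hpc : ContinuousOn p' (Ico 0 τ)) (hkc : ContinuousOn k' (Ico 0 τ))
    (hFc : ContinuousOn F' (Ico 0 τ)) (hF : ∀ t ∈ Ico 0 τ, HasDerivWithinAt F (F' t) (Ici 0) t)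
    {t : ℝ} (ht0 : 0 < t) (ht : t < τ) :
    HasDerivAt (fun t => inner ℝ (C (p' t)) (p' t) + inner ℝ (B (k' t)) (k' t))
      (2 * (inner ℝ (F' t) (p' t) - inner ℝ (A (p' t)) (p' t))) t := by
  set I : ℝ → ℝ := fun r => 2 * (inner ℝ (F' r) (p' r) - inner ℝ (A (p' r)) (p' r)) with hI
  have cI : ContinuousOn I (Ico 0 τ) :=
    continuousOn_const.mul ((hFc.inner hpc).sub ((A.continuous.comp_continuousOn hpc).inner hpc))
  have hIoo : Ioo 0 τ ∈ 𝓝 t := Ioo_mem_nhds ht0 ht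
  have d : HasDerivAt (fun r => (∫ x in (t / 2)..r, I x) + (inner ℝ (C (p' (t / 2))) (p' (t / 2)) +
      inner ℝ (B (k' (t / 2))) (k' (t / 2)))) (I t) t := by
    refine HasDerivAt.add_const _ (intervalIntegral.integral_hasDerivAt_right ?_ ?_ ?_)
    · refine (cI.mono ?_).intervalIntegrable_of_Icc (by linarith)
      exact fun r hr => ⟨by linarith [hr.1], by linarith [hr.2]⟩
    · exact (cI.mono Ioo_subset_Ico_self).stronglyMeasurableAtFilter isOpen_Ioo t ⟨ht0, ht⟩
    · exact cI.continuousAt (mem_of_superset hIoo Ioo_subset_Ico_self)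
  refine d.congr_of_eventuallyEq ?_
  filter_upwards [Ioo_mem_nhds (by linarith : t / 2 < t) ht] with r hr
  rw [← h.energy_deriv_sub hpc hkc hFc hF (by linarith) hr.1.le hr.2]
  ring

end Abstract

/-! ### Curves in `L²` supported in a light cone -/

section

variable {n : ℕ} {a b c : Sp n → ℝ} {q : ℝ → ℝ} {R : ℝ} {m : ℕ} {h : ℝ → Sp n → ℝ}
  {u : ℝ → L2 n} {g : ℝ → L2Vec n}

section Vanish

variable {E : Type*} [NormedAddCommGroup E] [InnerProductSpace ℝ E]

/-- The functions in `L²` that vanish almost everywhere on `S`. -/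
def vanishOn (E : Type*) [NormedAddCommGroup E] [InnerProductSpace ℝ E] (S : Set (Sp n)) :
    Submodule ℝ (Lp E 2 (volume : Measure (Sp n))) :=
  LinearMap.ker (LpToLpRestrictCLM (Sp n) E ℝ volume 2 S).toLinearMap

lemma isClosed_vanishOn (S : Set (Sp n)) :
    IsClosed (vanishOn E S : Set (Lp E 2 (volume : Measure (Sp n)))) :=
  (LpToLpRestrictCLM (Sp n) E ℝ volume 2 S).isClosed_ker

lemma mem_vanishOn {S : Set (Sp n)} (hS : MeasurableSet S)
    {f : Lp E 2 (volume : Measure (Sp n))} :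
    f ∈ vanishOn E S ↔ ∀ᵐ x, x ∈ S → f x = 0 := by
  rw [vanishOn, LinearMap.mem_ker, ContinuousLinearMap.coe_coe, Lp.eq_zero_iff_ae_eq_zero,
    ← ae_restrict_iff' hS]
  have := LpToLpRestrictCLM_coeFn ℝ S f
  constructor
  · intro h1; filter_upwards [h1, this] with x h2 h3; rw [← h3, h2]; rfl
  · intro h1; filter_upwards [h1, this] with x h2 h3; rw [h3, h2]; rfl

end Vanish

/-- The exterior of the light cone at time `t`. -/
def coneExt (n : ℕ) (q : ℝ → ℝ) (R t : ℝ) : Set (Sp n) := {x | t + q R < q ‖x‖}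

lemma Setting.measurableSet_coneExt (hS : Setting a b c q) (R t : ℝ) :
    MeasurableSet (coneExt n q R t) :=
  (isOpen_lt continuous_const hS.continuous_q).measurableSet

lemma coneExt_anti {s t : ℝ} (h : s ≤ t) : coneExt n q R t ⊆ coneExt n q R s := fun x hx => by
  simp only [coneExt, mem_ofPred_eq] at hx ⊢
  linarith

section Cone

variable {E : Type*} [NormedAddCommGroup E] [InnerProductSpace ℝ E]

/-- The support in a growing cone is inherited by derivatives: the derivative at time `t` is supported
in the cone of every later time, and the intersection of these is the cone at time `t`. -/
lemma vanishOn_deriv (hS : Setting a b c q) {f f' : ℝ → Lp E 2 (volume : Measure (Sp n))}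
    (hf : ∀ t, 0 ≤ t → f t ∈ vanishOn E (coneExt n q R t))
    (hd : ∀ t, 0 ≤ t → HasDerivWithinAt f (f' t) (Ici 0) t) {t : ℝ} (ht : 0 ≤ t) :
    f' t ∈ vanishOn E (coneExt n q R t) := by
  have hmono : ∀ s r, 0 ≤ s → s ≤ r → f s ∈ vanishOn E (coneExt n q R r) := by
    intro s r hs hsr
    have := (mem_vanishOn (hS.measurableSet_coneExt R s)).1 (hf s hs)
    exact (mem_vanishOn (hS.measurableSet_coneExt R r)).2
      (this.mono fun x hx hxr => hx (coneExt_anti hsr hxr))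
  have h1 : ∀ r, t < r → f' t ∈ vanishOn E (coneExt n q R r) := by
    intro r hr
    refine mem_of_hasDerivWithinAt (isClosed_vanishOn _) ht (hd t ht) (hmono t r ht hr.le) ?_
    filter_upwards [self_mem_nhdsWithin, mem_nhdsWithin_of_mem_nhds (Iio_mem_nhds hr)]
      with s hs hsr using hmono s r hs (le_of_lt hsr)
  rw [mem_vanishOn (hS.measurableSet_coneExt R t)]
  have h2 : ∀ᵐ x, ∀ k : ℕ, x ∈ coneExt n q R (t + 1 / ((k : ℝ) + 1)) → f' t x = 0 :=
    ae_all_iff.2 fun k => (mem_vanishOn (hS.measurableSet_coneExt R _)).1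
      (h1 _ (by linarith [Nat.one_div_pos_of_nat (α := ℝ) (n := k)]))
  filter_upwards [h2] with x hx hxt
  have hxt' : 0 < q ‖x‖ - (t + q R) := sub_pos.2 hxt
  obtain ⟨k, hk⟩ := exists_nat_one_div_lt hxt'
  refine hx k ?_
  simp only [coneExt, mem_ofPred_eq]
  linarith

/-- A continuous curve in `L²` whose value at time `t` is supported in the light cone. -/
structure ConeCurve (q : ℝ → ℝ) (R : ℝ) (f : ℝ → Lp E 2 (volume : Measure (Sp n))) : Prop where
  cont : ContinuousOn f (Ici 0)
  supp : ∀ t, 0 ≤ t → ∀ᵐ x, t + q R < q ‖x‖ → f t x = 0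

lemma integral_cutoff {κ w : Sp n → ℝ} (hκ : Continuous κ) (hs : HasCompactSupport κ)
    (hw : Continuous w) {f k : Lp E 2 (volume : Measure (Sp n))}
    (hf : ∀ᵐ x, κ x ≠ 1 → f x = 0) :
    Integrable (fun x => w x * inner ℝ (f x) (k x)) ∧
    inner ℝ (mulL E (bcfOfCompact (fun x => κ x * w x) (hκ.mul hw) hs.mul_right) f) k =
      ∫ x, w x * inner ℝ (f x) (k x) := by
  have h1 := integrable_bcf_mul_inner
    (bcfOfCompact (fun x => κ x * w x) (hκ.mul hw) hs.mul_right) f k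
  have h2 : (fun x => bcfOfCompact (fun x => κ x * w x) (hκ.mul hw) hs.mul_right x *
      inner ℝ (f x) (k x)) =ᵐ[volume] fun x => w x * inner ℝ (f x) (k x) := by
    filter_upwards [hf] with x hx
    by_cases h : κ x = 1
    · simp [h]
    · simp [hx h]
  exact ⟨h1.congr h2, (inner_mulL _ _ _).trans (integral_congr_ae h2)⟩

lemma ConeCurve.integrable (hS : Setting a b c q) {f k : ℝ → Lp E 2 (volume : Measure (Sp n))}
    (hf : ConeCurve q R f) {w : Sp n → ℝ} (hw : Continuous w) {t : ℝ} (ht : 0 ≤ t) :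
    Integrable (fun x => w x * inner ℝ (f t x) (k t x)) := by
  obtain ⟨κ, hκ, hκ1⟩ := hS.exists_cutoff (t + q R)
  exact (integral_cutoff hκ.continuous hκ.2 hw ((hf.supp t ht).mono fun x hx h =>
    hx (not_le.1 fun h' => h (hκ1 x h')))).1

lemma ConeCurve.continuousOn_integral (hS : Setting a b c q)
    {f k : ℝ → Lp E 2 (volume : Measure (Sp n))}
    (hf : ConeCurve q R f) (hk : ContinuousOn k (Ici 0)) {w : Sp n → ℝ} (hw : Continuous w) :
    ContinuousOn (fun t => ∫ x, w x * inner ℝ (f t x) (k t x)) (Ici 0) := by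
  intro t ht
  obtain ⟨κ, hκ, hκ1⟩ := hS.exists_cutoff (t + 1 + q R)
  set W := bcfOfCompact (fun x => κ x * w x) (hκ.continuous.mul hw) hκ.2.mul_right
  have h1 : ContinuousWithinAt (fun t => inner ℝ (mulL E W (f t)) (k t)) (Ici 0) t :=
    ContinuousWithinAt.inner ((mulL E W).continuous.continuousAt.comp_continuousWithinAt
      (hf.cont t ht)) (hk t ht)
  have h2 : ∀ s, 0 ≤ s → s < t + 1 → ∫ x, w x * inner ℝ (f s x) (k s x) =
      inner ℝ (mulL E W (f s)) (k s) := fun s hs hst =>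
    (integral_cutoff hκ.continuous hκ.2 hw ((hf.supp s hs).mono fun x hx h =>
      hx (by have := not_le.1 fun h' => h (hκ1 x h'); linarith))).2.symm
  refine h1.congr_of_eventuallyEq ?_ (h2 t ht (by linarith))
  filter_upwards [self_mem_nhdsWithin,
    mem_nhdsWithin_of_mem_nhds (Iio_mem_nhds (by linarith : t < t + 1))] with s hs hst
  exact h2 s hs hst

end Cone

lemma IsSolution.deriv_u (hu : IsSolution m a b c q R h u g) {j : ℕ}
    (hj : j ≤ m) {t : ℝ} (ht : 0 ≤ t) :
    HasDerivWithinAt (dt j u) (dt (j + 1) u t) (Ici 0) t :=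
  hasDerivWithinAt_dt (m := m + 1) (by exact_mod_cast hu.contDiffOn_u) (by omega) ht

lemma IsSolution.deriv_g (hu : IsSolution m a b c q R h u g) {j : ℕ}
    (hj : j < m) {t : ℝ} (ht : 0 ≤ t) :
    HasDerivWithinAt (dt j g) (dt (j + 1) g t) (Ici 0) t :=
  hasDerivWithinAt_dt hu.contDiffOn_grad hj ht

/-- The time derivatives of a solution are supported in the light cone. -/
lemma IsSolution.coneCurve_u (hS : Setting a b c q) (hR : 0 < R) (hm : 1 ≤ m)
    (hu : IsSolution m a b c q R h u g) {j : ℕ} (hj : j ≤ m) : ConeCurve q R (dt (j + 1) u) := by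
  refine ⟨continuousOn_dt (m := m + 1) (by exact_mod_cast hu.contDiffOn_u) (by omega), ?_⟩
  suffices H : ∀ t, 0 ≤ t → dt (j + 1) u t ∈ vanishOn ℝ (coneExt n q R t) from
    fun t ht => (mem_vanishOn (hS.measurableSet_coneExt R t)).1 (H t ht)
  induction j with
  | zero =>
    intro t ht
    exact (mem_vanishOn (hS.measurableSet_coneExt R t)).2
      ((finite_speed hS hR hm hu ht).mono fun x hx h => (hx h).1)
  | succ j ih => exact fun t ht =>
      vanishOn_deriv hS (ih (by omega)) (fun s hs => hu.deriv_u (by omega) hs) ht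

lemma IsSolution.coneCurve_g (hS : Setting a b c q) (hR : 0 < R) (hm : 1 ≤ m)
    (hu : IsSolution m a b c q R h u g) {j : ℕ} (hj : j ≤ m) : ConeCurve q R (dt j g) := by
  refine ⟨continuousOn_dt hu.contDiffOn_grad hj, ?_⟩
  suffices H : ∀ t, 0 ≤ t → dt j g t ∈ vanishOn (Sp n) (coneExt n q R t) from
    fun t ht => (mem_vanishOn (hS.measurableSet_coneExt R t)).1 (H t ht)
  induction j with
  | zero =>
    intro t ht
    rw [dt_zero]
    exact (mem_vanishOn (hS.measurableSet_coneExt R t)).2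
      ((finite_speed hS hR hm hu ht).mono fun x hx h => (hx h).2)
  | succ j ih => exact fun t ht =>
      vanishOn_deriv hS (ih (by omega)) (fun s hs => hu.deriv_g (by omega) hs) ht

/-! ### The source term as a curve in `L²` -/

/-- The `j`-th time derivative of the source. -/
abbrev dth (h : ℝ → Sp n → ℝ) (j : ℕ) (t : ℝ) (x : Sp n) : ℝ := dt j (fun s => h s x) t

lemma dth_zero (h : ℝ → Sp n → ℝ) (t : ℝ) : dth h 0 t = h t := funext fun _ => dt_zero _ _

lemma IsSolution.continuousOn_dth (hu : IsSolution m a b c q R h u g) {j : ℕ}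
    (hj : j ≤ m) : ContinuousOn (fun p : ℝ × Sp n => dth h j p.1 p.2) (Ici 0 ×ˢ univ) :=
  (contDiffOn_dt hu.contDiffOn_source (Nat.sub_add_cancel hj)).continuousOn

lemma IsSolution.continuous_dth (hu : IsSolution m a b c q R h u g) {j : ℕ}
    (hj : j ≤ m) {t : ℝ} (ht : 0 ≤ t) : Continuous (dth h j t) :=
  continuous_slice (hu.continuousOn_dth hj) ht

lemma IsSolution.deriv_dth (hu : IsSolution m a b c q R h u g) {j : ℕ}
    (hj : j < m) {t : ℝ} (ht : 0 ≤ t) (x : Sp n) :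
    HasDerivWithinAt (fun s => dth h j s x) (dth h (j + 1) t x) (Ici 0) t :=
  hasDerivWithinAt_dt (contDiffOn_time hu.contDiffOn_source x) hj ht

lemma IsSolution.dth_eq_zero (hu : IsSolution m a b c q R h u g) {j : ℕ}
    {t : ℝ} (ht : 0 ≤ t) {x : Sp n} (hx : t + q R < q ‖x‖) : dth h j t x = 0 := by
  induction j generalizing t with
  | zero => rw [dth_zero]; exact hu.source_support t ht x hx
  | succ j ih =>
    rw [dth, dt_succ]
    have h1 : dt j (fun s => h s x) =ᶠ[𝓝[Ici 0] t] fun _ => 0 := by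
      filter_upwards [self_mem_nhdsWithin, mem_nhdsWithin_of_mem_nhds
        (Iio_mem_nhds (by linarith : t < q ‖x‖ - q R))] with s hs hst
      exact ih hs (by have := mem_Iio.1 hst; linarith)
    rw [h1.derivWithin_eq (ih ht hx)]
    simp

/-- The `j`-th time derivative of the source, as a curve in `L²`.  No cutoff is needed, since the source
of a solution has compact support at each time. -/
def srcL (h : ℝ → Sp n → ℝ) (j : ℕ) (t : ℝ) : L2 n := cutL2 (fun _ => 1) (dth h j t)

lemma cutL2_congr {κ κ' f : Sp n → ℝ} (h : ∀ x, κ x * f x = κ' x * f x) :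
    cutL2 κ f = cutL2 κ' f :=
  congrArg asL2 (funext h)

lemma IsSolution.srcL_eq (hu : IsSolution m a b c q R h u g)
    {κ : Sp n → ℝ} {L : ℝ} (hκ : ∀ x, q ‖x‖ ≤ L → κ x = 1) (j : ℕ) {t : ℝ} (ht : 0 ≤ t)
    (htL : t + q R ≤ L) : srcL h j t = cutL2 κ (dth h j t) := by
  refine cutL2_congr fun x => ?_
  rcases le_or_gt (q ‖x‖) L with hx | hx
  · rw [hκ x hx]
  · rw [hu.dth_eq_zero ht (by linarith), mul_zero, mul_zero]

lemma IsSolution.coeFn_srcL (hS : Setting a b c q)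
    (hu : IsSolution m a b c q R h u g) {j : ℕ} (hj : j ≤ m) {t : ℝ} (ht : 0 ≤ t) :
    srcL h j t =ᵐ[volume] dth h j t := by
  obtain ⟨κ, hκ, hκ1⟩ := hS.exists_cutoff (t + q R)
  rw [hu.srcL_eq hκ1 j ht le_rfl]
  filter_upwards [coeFn_cutL2 hκ.continuous hκ.2 (hu.continuous_dth hj ht)] with x hx
  rw [hx]
  rcases le_or_gt (q ‖x‖) (t + q R) with h1 | h1
  · rw [hκ1 x h1, one_mul]
  · rw [hu.dth_eq_zero ht h1, mul_zero]

lemma IsSolution.deriv_srcL (hS : Setting a b c q)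
    (hu : IsSolution m a b c q R h u g) {j : ℕ} (hj : j < m) {t : ℝ} (ht : 0 ≤ t) :
    HasDerivWithinAt (srcL h j) (srcL h (j + 1) t) (Ici 0) t := by
  obtain ⟨κ, hκ, hκ1⟩ := hS.exists_cutoff (t + 1 + q R)
  have h1 := hasDerivWithinAt_cutL2 hκ.continuous hκ.2
    (fun s hs => hu.continuous_dth hj.le hs) (hu.continuousOn_dth (j := j + 1) hj)
    (fun s hs x => hu.deriv_dth hj hs x) ht
  rw [← hu.srcL_eq hκ1 (j + 1) ht (by linarith)] at h1
  refine h1.congr_of_eventuallyEq ?_ (hu.srcL_eq hκ1 j ht (by linarith))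
  filter_upwards [self_mem_nhdsWithin,
    mem_nhdsWithin_of_mem_nhds (Iio_mem_nhds (by linarith : t < t + 1))] with s hs hst
  exact hu.srcL_eq hκ1 j hs (by have := mem_Iio.1 hst; linarith)

lemma IsSolution.coneCurve_srcL (hS : Setting a b c q)
    (hu : IsSolution m a b c q R h u g) {j : ℕ} (hj : j ≤ m) : ConeCurve q R (srcL h j) := by
  refine ⟨fun t ht => ?_, fun t ht => ?_⟩
  · obtain ⟨κ, hκ, hκ1⟩ := hS.exists_cutoff (t + 1 + q R)
    refine (continuousOn_cutL2 hκ.continuous hκ.2 (hu.continuousOn_dth hj) t ht)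
      |>.congr_of_eventuallyEq ?_ (hu.srcL_eq hκ1 j ht (by linarith))
    filter_upwards [self_mem_nhdsWithin,
      mem_nhdsWithin_of_mem_nhds (Iio_mem_nhds (by linarith : t < t + 1))] with s hs hst
    exact hu.srcL_eq hκ1 j hs (by have := mem_Iio.1 hst; linarith)
  · filter_upwards [hu.coeFn_srcL hS hj ht] with x hx hxt
    rw [hx, hu.dth_eq_zero ht hxt]

/-! ### The equations satisfied by the time derivatives -/

/-- A continuous vector field with compact support, as an element of `L²`. -/
def ccVec (V : Sp n → Sp n) (hV : Continuous V) (hs : HasCompactSupport V) : L2Vec n :=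
  (hV.memLp_of_hasCompactSupport hs).toLp V

lemma inner_ccVec (V : Sp n → Sp n) (hV : Continuous V) (hs : HasCompactSupport V) (f : L2Vec n) :
    inner ℝ (ccVec V hV hs) f = ∫ x, inner ℝ (V x) (f x) := by
  rw [L2.inner_def]
  refine integral_congr_ae ?_
  filter_upwards [(hV.memLp_of_hasCompactSupport (p := 2) (μ := volume) hs).coeFn_toLp] with x hx
  rw [ccVec, hx]

lemma integral_add_add_sub {f₁ f₂ f₃ f₄ : Sp n → ℝ} (h₁ : Integrable f₁) (h₂ : Integrable f₂)
    (h₃ : Integrable f₃) (h₄ : Integrable f₄) :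
    (∫ x, f₁ x) + (∫ x, f₂ x) - (∫ x, f₃ x) + (∫ x, f₄ x) =
      ∫ x, (f₁ x + f₂ x - f₃ x + f₄ x) := by
  rw [← integral_add h₁ h₂]
  have e1 := integral_sub (h₁.add h₂) h₃
  have e2 := integral_add ((h₁.add h₂).sub h₃) h₄
  simp only [Pi.add_apply, Pi.sub_apply] at e1 e2
  rw [← e1, ← e2]

lemma hasCompactSupport_smul_gradient {φ : Sp n → ℝ} (hφ : HasCompactSupport φ) (b : Sp n → ℝ) :
    HasCompactSupport (fun x => b x • ∇ φ x) :=
  HasCompactSupport.smul_left (f := b) (hasCompactSupport_gradient hφ)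

/-- The terms of the weak equation, as inner products with fixed elements of `L²`. -/
lemma weak_terms_eq {c a b φ : Sp n → ℝ} (hc : Continuous c) (ha : Continuous a)
    (hb : Continuous b) (hφ : IsTest φ) (f₂ f₁ s : L2 n) (k : L2Vec n) :
    inner ℝ (ccL2 (fun x => c x * φ x) (hc.mul hφ.continuous) hφ.2.mul_left) f₂ +
      inner ℝ (ccL2 (fun x => a x * φ x) (ha.mul hφ.continuous) hφ.2.mul_left) f₁ -
      inner ℝ (ccL2 φ hφ.continuous hφ.2) s +
      inner ℝ (ccVec (fun x => b x • ∇ φ x) (hb.smul (continuous_gradient hφ.one))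
        (hasCompactSupport_smul_gradient hφ.2 b)) k =
    ∫ x, ((c x * f₂ x + a x * f₁ x - s x) * φ x + inner ℝ (b x • k x) (∇ φ x)) := by
  have i4 : Integrable (fun x => inner ℝ (b x • ∇ φ x) (k x)) := by
    have := ((locL2_lp k).continuous_smul hb).integrable_inner
      (continuous_gradient hφ.one) (hasCompactSupport_gradient hφ.2)
    refine this.congr (Eventually.of_forall fun x => ?_)
    simp only
    rw [real_inner_smul_left, real_inner_smul_left, real_inner_comm (k x)]
  have i1 : Integrable (fun x => (c x * φ x) * f₂ x) :=
    integrable_cc_mul (hc.mul hφ.continuous) hφ.2.mul_left f₂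
  have i2 : Integrable (fun x => (a x * φ x) * f₁ x) :=
    integrable_cc_mul (ha.mul hφ.continuous) hφ.2.mul_left f₁
  have i3 : Integrable (fun x => φ x * s x) := integrable_cc_mul hφ.continuous hφ.2 s
  rw [inner_ccL2, inner_ccL2, inner_ccL2, inner_ccVec, integral_add_add_sub i1 i2 i3 i4]
  refine integral_congr_ae (Eventually.of_forall fun x => ?_)
  simp only
  rw [real_inner_smul_left, real_inner_smul_left, real_inner_comm (k x)]
  ring

/-- The equation, differentiated `j` times. -/
lemma IsSolution.equation_dt (hS : Setting a b c q)
    (hu : IsSolution m a b c q R h u g) {j : ℕ} (hj : j + 1 ≤ m) {t : ℝ} (ht : 0 ≤ t)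
    {φ : Sp n → ℝ} (hφ : IsTest φ) :
    ∫ x, ((c x * dt (j + 2) u t x + a x * dt (j + 1) u t x - dth h j t x) * φ x +
      inner ℝ (b x • dt j g t x) (∇ φ x)) = 0 := by
  have hφc := hφ.continuous
  set Fc := ccL2 (fun x => c x * φ x) (hS.smooth_c.continuous.mul hφc) hφ.2.mul_left
  set Fa := ccL2 (fun x => a x * φ x) (hS.smooth_a.continuous.mul hφc) hφ.2.mul_left
  set F1 := ccL2 φ hφc hφ.2
  set Fb := ccVec (fun x => b x • ∇ φ x)
    (hS.smooth_b.continuous.smul (continuous_gradient hφ.one))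
    (hasCompactSupport_smul_gradient hφ.2 b)
  set Λ : ℕ → ℝ → ℝ := fun j t => inner ℝ Fc (dt (j + 2) u t) + inner ℝ Fa (dt (j + 1) u t) -
    inner ℝ F1 (srcL h j t) + inner ℝ Fb (dt j g t) with hΛ
  have hΛe : ∀ j, j + 1 ≤ m → ∀ t, 0 ≤ t → Λ j t =
      ∫ x, ((c x * dt (j + 2) u t x + a x * dt (j + 1) u t x - dth h j t x) * φ x +
      inner ℝ (b x • dt j g t x) (∇ φ x)) := by
    intro j hj t ht
    refine (weak_terms_eq hS.smooth_c.continuous hS.smooth_a.continuous hS.smooth_b.continuous hφ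
      (dt (j + 2) u t) (dt (j + 1) u t) (srcL h j t) (dt j g t)).trans ?_
    refine integral_congr_ae ?_
    filter_upwards [hu.coeFn_srcL hS (by omega : j ≤ m) ht] with x hx
    rw [hx]
  rw [← hΛe j hj t ht]
  induction j generalizing t with
  | zero =>
    rw [hΛe 0 hj t ht]
    simp only [dt_zero]
    exact hu.equation_div hS ht hφ
  | succ j ih =>
    have d1 := (hasDerivWithinAt_const t (Ici 0) Fc).inner ℝ (hu.deriv_u (j := j + 2) (by omega) ht)
    have d2 := (hasDerivWithinAt_const t (Ici 0) Fa).inner ℝ (hu.deriv_u (j := j + 1) (by omega) ht)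
    have d3 := (hasDerivWithinAt_const t (Ici 0) F1).inner ℝ
      (hu.deriv_srcL hS (j := j) (by omega) ht)
    have d4 := (hasDerivWithinAt_const t (Ici 0) Fb).inner ℝ (hu.deriv_g (j := j) (by omega) ht)
    have d : HasDerivWithinAt (Λ j) (Λ (j + 1) t) (Ici 0) t :=
      (((d1.add d2).sub d3).add d4).congr_deriv (by
        simp only [inner_zero_left, add_zero]
        rfl)
    have := mem_of_hasDerivWithinAt (K := (⊥ : Submodule ℝ ℝ))
      (by simp) ht d
      (by simpa using ih (by omega) ht)
      (eventually_mem_nhdsWithin.mono fun s hs => by simpa using ih (by omega) hs)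
    simpa using this

/-- The combination `C f₂ + A f₁ - s` of elements of `L²`. -/
def waveResidual (C A : Sp n →ᵇ ℝ) (f₂ f₁ s : L2 n) : L2 n := mulL ℝ C f₂ + mulL ℝ A f₁ - s

lemma inner_waveResidual (C A : Sp n →ᵇ ℝ) (f₂ f₁ s v : L2 n) :
    inner ℝ (waveResidual C A f₂ f₁ s) v =
      inner ℝ (mulL ℝ C f₂) v + inner ℝ (mulL ℝ A f₁) v - inner ℝ s v := by
  rw [waveResidual, inner_sub_left, inner_add_left]

lemma coeFn_waveResidual (C A : Sp n →ᵇ ℝ) (f₂ f₁ s : L2 n) :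
    waveResidual C A f₂ f₁ s =ᵐ[volume] fun x => C x * f₂ x + A x * f₁ x - s x := by
  unfold waveResidual
  filter_upwards [coeFn_mulL C f₂, coeFn_mulL A f₁, Lp.coeFn_add (mulL ℝ C f₂) (mulL ℝ A f₁),
    Lp.coeFn_sub (mulL ℝ C f₂ + mulL ℝ A f₁) s] with x h1 h2 h3 h4
  rw [h4, Pi.sub_apply, h3, Pi.add_apply, h1, h2, smul_eq_mul, smul_eq_mul]

/-- A time derivative of a solution solves an abstract damped wave equation.  The coefficients, which
may be unbounded, are cut off outside of the light cone of a later time, where the solution is zero. -/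
lemma IsSolution.abstractWave (hS : Setting a b c q) (hR : 0 < R)
    (hu : IsSolution m a b c q R h u g) {j : ℕ} (hj : j + 1 ≤ m) {τ : ℝ} {κ : Sp n → ℝ}
    (hκ : IsTest κ) (hκ1 : ∀ x, q ‖x‖ ≤ τ + q R → κ x = 1) :
    AbstractWave (weakPairs n)
      (mulL ℝ (bcfOfCompact (fun x => κ x * c x)
        (hκ.continuous.mul hS.smooth_c.continuous) hκ.2.mul_right))
      (mulL ℝ (bcfOfCompact (fun x => κ x * a x)
        (hκ.continuous.mul hS.smooth_a.continuous) hκ.2.mul_right))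
      (mulL (Sp n) (bcfOfCompact (fun x => κ x * b x)
        (hκ.continuous.mul hS.smooth_b.continuous) hκ.2.mul_right)) τ
      (dt (j + 1) u) (dt (j + 2) u) (dt j g) (dt (j + 1) g) (srcL h j) (srcL h (j + 1)) where
  symm_C x y := (inner_mulL_right _ _ _).symm
  symm_A x y := (inner_mulL_right _ _ _).symm
  symm_B x y := (inner_mulL_right _ _ _).symm
  deriv_p t ht := hu.deriv_u hj ht.1
  deriv_k t ht := hu.deriv_g hj ht.1
  mem t ht := mem_weakPairs.2 (hu.weakGradient_dt hj ht.1)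
  eq t ht w hw := by
    set Cm := bcfOfCompact (fun x => κ x * c x)
        (hκ.continuous.mul hS.smooth_c.continuous) hκ.2.mul_right with hC
    set Am := bcfOfCompact (fun x => κ x * a x)
        (hκ.continuous.mul hS.smooth_a.continuous) hκ.2.mul_right with hA
    set Bm := bcfOfCompact (fun x => κ x * b x)
        (hκ.continuous.mul hS.smooth_b.continuous) hκ.2.mul_right with hB
    have key := inner_add_inner_eq_zero_of_weak
      (F := waveResidual Cm Am (dt (j + 2) u t) (dt (j + 1) u t) (srcL h j t))
      (G := mulL (Sp n) Bm (dt j g t)) (v := w.1) (w := w.2) ?_ (mem_weakPairs.1 hw)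
    · rw [inner_waveResidual] at key
      linarith
    · intro φ hφ
      rw [← hu.equation_dt hS hj ht.1 hφ]
      refine integral_congr_ae ?_
      have hm : 1 ≤ m := by omega
      filter_upwards [coeFn_waveResidual Cm Am (dt (j + 2) u t) (dt (j + 1) u t) (srcL h j t),
        coeFn_mulL Bm (dt j g t), hu.coeFn_srcL hS (by omega : j ≤ m) ht.1,
        (hu.coneCurve_u hS hR hm (j := j + 1) hj).supp t ht.1,
        (hu.coneCurve_u hS hR hm (j := j) (by omega)).supp t ht.1,
        (hu.coneCurve_g hS hR hm (j := j) (by omega)).supp t ht.1] with x h1 h3 h4 h7 h8 h9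
      rw [h1, h3, h4]
      rcases le_or_gt (q ‖x‖) (τ + q R) with hx | hx
      · simp only [hC, hA, hB, bcfOfCompact_apply, hκ1 x hx, one_mul]
      · have hx' : t + q R < q ‖x‖ := by linarith [ht.2]
        rw [h7 hx', h8 hx', h9 hx']
        simp

end

/-! ### Weighted energy inequalities for functions of time -/

/-- The differential inequality behind the weighted estimates; `W` stands for `w ^ (s - 3)`, `X` for
`∫ c ∂_t^{j+1} u ∂_t^j u`, and `S₁`, `S₂` for the source terms of the energy and virial identities.
The kinetic terms on the left amount to at most `(3 s / 2 + s (s - 1) / 2) W w² K`, a quarter of the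
dissipation `W w³ D`. -/
lemma level_pointwise {s ε W w K P D F S₁ S₂ X K' D' : ℝ} (hs : 1 ≤ s) (hW : 0 < W) (hw : 1 ≤ w)
    (h1 : S₁ ≤ D / 4 + F) (h2 : S₂ ≤ w / 2 * F + w⁻¹ / 2 * D')
    (h3 : X ≤ w / 2 * K + w⁻¹ / 2 * K') (hK : K ≤ ε * w * D) (hD : 0 ≤ D)
    (hε : (3 * s / 2 + s * (s - 1) / 2) * ε ≤ 1 / 4) :
    s * (W * w ^ 2) * ((K + P) / 2) + W * w ^ 3 * (S₁ - D) +
      (s * (s - 1) * (W * w) * (X + D' / 2) + s * (W * w ^ 2) * (S₂ + K - P)) ≤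
    (1 + s / 2) * (W * w ^ 3 * F) + (s / 2 + s * (s - 1) / 2) * (W * w * D') +
      s * (s - 1) / 2 * (W * K') - 1 / 2 * (W * w ^ 3 * D) - s / 2 * (W * w ^ 2 * P) := by
  have hw0 : 0 < w := by linarith
  have hs1 : 0 ≤ s - 1 := by linarith
  have hs0 : 0 ≤ s := by linarith
  have e1 := mul_le_mul_of_nonneg_left h1 (by positivity : 0 ≤ W * w ^ 3)
  have e2 := mul_le_mul_of_nonneg_left h2 (by positivity : 0 ≤ s * (W * w ^ 2))
  have e3 := mul_le_mul_of_nonneg_left h3 (by positivity : 0 ≤ s * (s - 1) * (W * w))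
  have e4 := mul_le_mul_of_nonneg_left hK
    (by positivity : 0 ≤ (3 * s / 2 + s * (s - 1) / 2) * (W * w ^ 2))
  have e5 := mul_le_mul_of_nonneg_right hε (by positivity : 0 ≤ W * w ^ 3 * D)
  have i2 : s * (W * w ^ 2) * (w / 2 * F + w⁻¹ / 2 * D') =
      s / 2 * (W * w ^ 3 * F) + s / 2 * (W * w * D') := by field_simp
  have i3 : s * (s - 1) * (W * w) * (w / 2 * K + w⁻¹ / 2 * K') =
      s * (s - 1) / 2 * (W * w ^ 2 * K) + s * (s - 1) / 2 * (W * K') := by field_simp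
  rw [i2] at e2
  rw [i3] at e3
  nlinarith

lemma integral_lin_five {T₀ T : ℝ} (hT : T₀ ≤ T) {f₁ f₂ f₃ f₄ f₅ : ℝ → ℝ} (c₁ c₂ c₃ c₄ c₅ : ℝ)
    (h₁ : ContinuousOn f₁ (Icc T₀ T)) (h₂ : ContinuousOn f₂ (Icc T₀ T))
    (h₃ : ContinuousOn f₃ (Icc T₀ T)) (h₄ : ContinuousOn f₄ (Icc T₀ T))
    (h₅ : ContinuousOn f₅ (Icc T₀ T)) :
    ∫ t in T₀..T, (c₁ * f₁ t + c₂ * f₂ t + c₃ * f₃ t - c₄ * f₄ t - c₅ * f₅ t) =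
      c₁ * (∫ t in T₀..T, f₁ t) + c₂ * (∫ t in T₀..T, f₂ t) + c₃ * (∫ t in T₀..T, f₃ t) -
        c₄ * (∫ t in T₀..T, f₄ t) - c₅ * (∫ t in T₀..T, f₅ t) := by
  have i₁ := (h₁.intervalIntegrable_of_Icc hT (μ := volume)).const_mul c₁
  have i₂ := (h₂.intervalIntegrable_of_Icc hT (μ := volume)).const_mul c₂
  have i₃ := (h₃.intervalIntegrable_of_Icc hT (μ := volume)).const_mul c₃
  have i₄ := (h₄.intervalIntegrable_of_Icc hT (μ := volume)).const_mul c₄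
  have i₅ := (h₅.intervalIntegrable_of_Icc hT (μ := volume)).const_mul c₅
  rw [intervalIntegral.integral_sub (((i₁.add i₂).add i₃).sub i₄) i₅,
    intervalIntegral.integral_sub ((i₁.add i₂).add i₃) i₄,
    intervalIntegral.integral_add (i₁.add i₂) i₃, intervalIntegral.integral_add i₁ i₂]
  simp only [intervalIntegral.integral_const_mul]

lemma hasDerivAt_weight {A t : ℝ} (ht : 0 < A + t) (s : ℝ) :
    HasDerivAt (fun t => (A + t) ^ s) (s * (A + t) ^ (s - 1)) t := by
  have := ((hasDerivAt_id t).const_add A).rpow_const (p := s) (Or.inl ht.ne')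
  simpa using this

lemma continuousOn_weight {A T₀ T : ℝ} (hA : 1 ≤ A) (hT₀ : 0 ≤ T₀) (s : ℝ) :
    ContinuousOn (fun t => (A + t) ^ s) (Icc T₀ T) := fun t ht =>
  (hasDerivAt_weight (by linarith [ht.1]) s).continuousAt.continuousWithinAt

/-- Bounding a combination of nonnegative numbers by a multiple of their sum. -/
lemma level_combine {Φ₀ k₀ k₀' e e' d p f d' l z c₀ c₁ c₂ c₃ c₄ : ℝ} (h0 : Φ₀ ≤ c₀ * (k₀ + k₀'))
    (hk : 0 ≤ k₀ + k₀') (hf : 0 ≤ f) (hd' : 0 ≤ d') (hl : 0 ≤ l) (he' : 0 ≤ e')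
    (hc₀ : 0 ≤ c₀) (hc₁ : 0 ≤ c₁) (hc₂ : 0 ≤ c₂) (hc₃ : 0 ≤ c₃) (hc₄ : 0 ≤ c₄) (hp : 0 ≤ p)
    (hz : z ≤ d + p) {s : ℝ} (hs : 1 ≤ s)
    (h : e / 4 - c₁ * e' - Φ₀ ≤ c₂ * f + c₃ * d' + c₄ * l - 1 / 2 * d - s / 2 * p) :
    e + d + z ≤ 4 * (c₀ + c₁ + c₂ + c₃ + c₄) * (k₀ + k₀' + f + (e' + d' + l)) := by
  have e1 : c₀ * (k₀ + k₀') ≤ (c₀ + c₁ + c₂ + c₃ + c₄) * (k₀ + k₀') :=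
    mul_le_mul_of_nonneg_right (by linarith) hk
  have e2 : c₁ * e' ≤ (c₀ + c₁ + c₂ + c₃ + c₄) * e' := mul_le_mul_of_nonneg_right (by linarith) he'
  have e3 : c₂ * f ≤ (c₀ + c₁ + c₂ + c₃ + c₄) * f := mul_le_mul_of_nonneg_right (by linarith) hf
  have e4 : c₃ * d' ≤ (c₀ + c₁ + c₂ + c₃ + c₄) * d' := mul_le_mul_of_nonneg_right (by linarith) hd'
  have e5 : c₄ * l ≤ (c₀ + c₁ + c₂ + c₃ + c₄) * l := mul_le_mul_of_nonneg_right (by linarith) hl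
  have e6 : p ≤ s * p := le_mul_of_one_le_left hp hs
  nlinarith

/-- One step of the induction: the weighted energy of a level is controlled by the one of the
preceding level.  Here `K`, `P` are the kinetic and potential energies of the level, `D` its
dissipation, `F` the source, and primes denote the preceding level. -/
lemma level_step {A s T₀ B ε : ℝ} (hA : 1 ≤ A) (hs : 1 ≤ s) (hT₀ : 0 ≤ T₀) (hB : 0 ≤ B)
    (hε1 : ε ≤ 1) (hε : (3 * s / 2 + s * (s - 1) / 2) * ε ≤ 1 / 4) :
    ∃ C : ℝ, 0 ≤ C ∧ ∀ (K P D F S₁ S₂ X K' P' D' : ℝ → ℝ) (T : ℝ), T₀ ≤ T →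
      ContinuousOn K (Icc T₀ T) → ContinuousOn P (Icc T₀ T) → ContinuousOn D (Icc T₀ T) →
      ContinuousOn F (Icc T₀ T) → ContinuousOn X (Icc T₀ T) → ContinuousOn K' (Icc T₀ T) →
      ContinuousOn P' (Icc T₀ T) → ContinuousOn D' (Icc T₀ T) →
      (∀ t ∈ Icc T₀ T, 0 ≤ K t ∧ 0 ≤ P t ∧ 0 ≤ D t ∧ 0 ≤ F t ∧ 0 ≤ K' t ∧ 0 ≤ P' t ∧ 0 ≤ D' t) →
      (∀ t ∈ Ioo T₀ T, HasDerivAt (fun t => K t + P t) (2 * (S₁ t - D t)) t) →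
      (∀ t ∈ Ioo T₀ T, HasDerivAt (fun t => X t + D' t / 2) (S₂ t + K t - P t) t) →
      (∀ t ∈ Icc T₀ T, S₁ t ≤ D t / 4 + F t) →
      (∀ t ∈ Icc T₀ T, ∀ r, 0 < r → S₂ t ≤ r / 2 * F t + r⁻¹ / 2 * D' t) →
      (∀ t ∈ Icc T₀ T, ∀ r, 0 < r → |X t| ≤ r / 2 * K t + r⁻¹ / 2 * K' t) →
      (∀ t ∈ Icc T₀ T, K t ≤ ε * (A + t) * D t) →
      D' T₀ ≤ B * K' T₀ →
      (A + T) ^ s * (K T + P T) + (∫ t in T₀..T, (A + t) ^ s * D t) +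
          (∫ t in T₀..T, (A + t) ^ (s - 1) * (K t + P t)) ≤
        C * ((K T₀ + P T₀) + (K' T₀ + P' T₀) + (∫ t in T₀..T, (A + t) ^ s * F t) +
          ((A + T) ^ (s - 2) * (K' T + P' T) + (∫ t in T₀..T, (A + t) ^ (s - 2) * D' t) +
            (∫ t in T₀..T, (A + t) ^ (s - 3) * (K' t + P' t)))) := by
  have hs0 : 0 < s := by linarith
  have hs1 : 0 ≤ s - 1 := by linarith
  have hw0 : 0 < A + T₀ := by linarith
  refine ⟨4 * (((A + T₀) ^ s + s * (A + T₀) ^ (s - 1) * (1 + B)) + s ^ 2 + (1 + s / 2) +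
    (s / 2 + s * (s - 1) / 2) + s * (s - 1) / 2), by positivity, ?_⟩
  intro K P D F S₁ S₂ X K' P' D' T hT cK cP cD cF cX cK' cP' cD' hn he hN h1 h2 h3 hK hD'
  have hT0 : T₀ ∈ Icc T₀ T := left_mem_Icc.2 hT
  have hTT : T ∈ Icc T₀ T := right_mem_Icc.2 hT
  have hpos : ∀ t ∈ Icc T₀ T, 0 < A + t := fun t ht => by linarith [ht.1]
  have hw := continuousOn_weight (T := T) hA hT₀
  have hwm : ∀ (s : ℝ) (f : ℝ → ℝ), ContinuousOn f (Icc T₀ T) →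
      ContinuousOn (fun t => (A + t) ^ s * f t) (Icc T₀ T) := fun s f hf => (hw s).mul hf
  have hpw : ∀ t ∈ Icc T₀ T, ∀ r : ℝ, 0 ≤ (A + t) ^ r := fun t ht r =>
    (Real.rpow_pos_of_pos (hpos t ht) r).le
  set Φ : ℝ → ℝ := fun t => (A + t) ^ s * ((K t + P t) / 2) +
    s * ((A + t) ^ (s - 1) * (X t + D' t / 2)) with hΦ
  have hpow : ∀ t ∈ Icc T₀ T, (A + t) ^ s = (A + t) ^ (s - 3) * (A + t) ^ 3 ∧
      (A + t) ^ (s - 1) = (A + t) ^ (s - 3) * (A + t) ^ 2 ∧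
      (A + t) ^ (s - 2) = (A + t) ^ (s - 3) * (A + t) := by
    intro t ht
    refine ⟨?_, ?_, ?_⟩
    · rw [← Real.rpow_add_natCast (hpos t ht).ne']; congr 1; push_cast; ring
    · rw [← Real.rpow_add_natCast (hpos t ht).ne']; congr 1; push_cast; ring
    · rw [← Real.rpow_add_one (hpos t ht).ne']; congr 1; ring
  have hint := intervalIntegral.sub_le_integral_of_hasDeriv_right_of_le hT (g := Φ)
    (g' := fun t => s * (A + t) ^ (s - 1) * ((K t + P t) / 2) +
      (A + t) ^ s * (2 * (S₁ t - D t) / 2) + s * ((s - 1) * (A + t) ^ (s - 1 - 1) *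
        (X t + D' t / 2) + (A + t) ^ (s - 1) * (S₂ t + K t - P t)))
    (φ := fun t => (1 + s / 2) * ((A + t) ^ s * F t) +
      (s / 2 + s * (s - 1) / 2) * ((A + t) ^ (s - 2) * D' t) +
      s * (s - 1) / 2 * ((A + t) ^ (s - 3) * (K' t + P' t)) - 1 / 2 * ((A + t) ^ s * D t) -
      s / 2 * ((A + t) ^ (s - 1) * P t)) ?_ ?_ ?_ ?_
  rotate_left
  · exact ((hw s).mul ((cK.add cP).div_const 2)).add
      (continuousOn_const.mul ((hw (s - 1)).mul (cX.add (cD'.div_const 2))))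
  · intro t ht
    have ht' := hpos t (Ioo_subset_Icc_self ht)
    exact (((hasDerivAt_weight ht' s).mul ((he t ht).div_const 2)).add
      (((hasDerivAt_weight ht' (s - 1)).mul (hN t ht)).const_mul s)).hasDerivWithinAt
  · refine ContinuousOn.integrableOn_Icc ?_
    exact ((((continuousOn_const.mul ((hw s).mul cF)).add
      (continuousOn_const.mul ((hw (s - 2)).mul cD'))).add
      (continuousOn_const.mul ((hw (s - 3)).mul (cK'.add cP')))).sub
      (continuousOn_const.mul ((hw s).mul cD))).sub
      (continuousOn_const.mul ((hw (s - 1)).mul cP))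
  · intro t ht
    have ht' := Ioo_subset_Icc_self ht
    obtain ⟨n1, n2, n3, n4, n5, n6, n7⟩ := hn t ht'
    obtain ⟨p1, p2, p3⟩ := hpow t ht'
    have hW : 0 < (A + t) ^ (s - 3) := Real.rpow_pos_of_pos (hpos t ht') _
    have hX := (abs_le.1 (h3 t ht' (A + t) (hpos t ht'))).2
    have key := level_pointwise (P := P t) hs hW (by linarith [ht'.1] : 1 ≤ A + t) (h1 t ht')
      (h2 t ht' _ (hpos t ht')) hX (hK t ht') n3 hε
    have hP' : 0 ≤ s * (s - 1) / 2 * ((A + t) ^ (s - 3) * P' t) := by positivity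
    have hs2 : (s - 1 - 1 : ℝ) = s - 2 := by ring
    simp only [hs2, p1, p2, p3]
    linarith
  rw [integral_lin_five hT _ _ _ _ _ (hwm s F cF) (hwm (s - 2) D' cD')
    (hwm (s - 3) (fun t => K' t + P' t) (cK'.add cP')) (hwm s D cD) (hwm (s - 1) P cP)] at hint
  have int_nonneg : ∀ (r : ℝ) (f : ℝ → ℝ), (∀ t ∈ Icc T₀ T, 0 ≤ f t) →
      0 ≤ ∫ t in T₀..T, (A + t) ^ r * f t := fun r f hf =>
    intervalIntegral.integral_nonneg hT fun t ht => mul_nonneg (hpw t ht r) (hf t ht)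
  refine level_combine (Φ₀ := Φ T₀) (c₁ := s ^ 2) (p := ∫ t in T₀..T, (A + t) ^ (s - 1) * P t)
    ?_ ?_ (int_nonneg s F fun t ht => (hn t ht).2.2.2.1)
    (int_nonneg _ D' fun t ht => (hn t ht).2.2.2.2.2.2)
    (int_nonneg _ _ fun t ht => add_nonneg (hn t ht).2.2.2.2.1 (hn t ht).2.2.2.2.2.1)
    (mul_nonneg (hpw T hTT _) (add_nonneg (hn T hTT).2.2.2.2.1 (hn T hTT).2.2.2.2.2.1))
    (by positivity) (by positivity) (by positivity) (by positivity) (by positivity)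
    (int_nonneg _ P fun t ht => (hn t ht).2.1) ?_ hs (le_trans ?_ hint)
  · obtain ⟨n1, n2, n3, n4, n5, n6, n7⟩ := hn T₀ hT0
    have hX := (abs_le.1 (h3 T₀ hT0 1 one_pos)).2
    have e1 : s * ((A + T₀) ^ (s - 1) * (X T₀ + D' T₀ / 2)) ≤
        s * (A + T₀) ^ (s - 1) * (1 + B) * ((K T₀ + P T₀) + (K' T₀ + P' T₀)) := by
      rw [← mul_assoc, mul_assoc (s * (A + T₀) ^ (s - 1))]
      refine mul_le_mul_of_nonneg_left ?_ (mul_nonneg hs0.le (hpw T₀ hT0 _))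
      have : 0 ≤ B * (K T₀ + P T₀ + P' T₀) := by positivity
      have : 0 ≤ B * K' T₀ := by positivity
      simp only [inv_one] at hX
      linarith
    have e2 : (A + T₀) ^ s * ((K T₀ + P T₀) / 2) ≤
        (A + T₀) ^ s * ((K T₀ + P T₀) + (K' T₀ + P' T₀)) :=
      mul_le_mul_of_nonneg_left (by linarith) (hpw T₀ hT0 _)
    calc Φ T₀ ≤ _ := add_le_add e2 e1
      _ = _ := by ring
  · obtain ⟨n1, n2, n3, n4, n5, n6, n7⟩ := hn T₀ hT0
    linarith
  · rw [← intervalIntegral.integral_add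
      ((hwm s D cD).intervalIntegrable_of_Icc hT)
      ((hwm (s - 1) P cP).intervalIntegrable_of_Icc hT)]
    refine intervalIntegral.integral_mono_on hT
      (((hw (s - 1)).mul (cK.add cP)).intervalIntegrable_of_Icc hT)
      (((hwm s D cD).add (hwm (s - 1) P cP)).intervalIntegrable_of_Icc hT) fun t ht => ?_
    obtain ⟨n1, n2, n3, n4, n5, n6, n7⟩ := hn t ht
    have hKD : K t ≤ (A + t) * D t := (hK t ht).trans (by
      have := mul_le_mul_of_nonneg_right hε1 (mul_nonneg (hpos t ht).le n3)
      linarith)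
    have := mul_le_mul_of_nonneg_left hKD (hpw t ht (s - 1))
    have e : (A + t) ^ s = (A + t) ^ (s - 1) * (A + t) := by
      rw [← Real.rpow_add_one (hpos t ht).ne']; congr 1; ring
    rw [e, mul_add]
    linarith
  · obtain ⟨n1, n2, n3, n4, n5, n6, n7⟩ := hn T hTT
    obtain ⟨p1, p2, p3⟩ := hpow T hTT
    -- The Young parameter `(A + T) / (2 s)` makes the kinetic part of the cross term half of the
    -- kinetic part of the energy.
    have hX := (abs_le.1 (h3 T hTT ((A + T) / (2 * s)) (div_pos (hpos T hTT) (by linarith)))).1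
    have hWp : 0 < (A + T) ^ (s - 3) := Real.rpow_pos_of_pos (hpos T hTT) _
    have hwT := hpos T hTT
    have e1 := mul_le_mul_of_nonneg_left hX (by positivity : 0 ≤ s * (A + T) ^ (s - 1))
    have e2 : s * (A + T) ^ (s - 1) * -((A + T) / (2 * s) / 2 * K T +
        ((A + T) / (2 * s))⁻¹ / 2 * K' T) =
        -((A + T) ^ s * K T / 4 + s ^ 2 * ((A + T) ^ (s - 2) * K' T)) := by
      rw [p1, p2, p3]; field_simp; ring
    have e3 : 0 ≤ s * ((A + T) ^ (s - 1) * (D' T / 2)) := by positivity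
    have e4 : 0 ≤ s ^ 2 * ((A + T) ^ (s - 2) * P' T) := by positivity
    have e5 : 0 ≤ (A + T) ^ s * P T := by positivity
    rw [e2] at e1
    simp only [hΦ]
    linarith

/-- The weighted energy inequality for the solution itself.  There is no preceding level: the weighted
integral of the energy stays on the right-hand side. -/
lemma level_zero {A θ T₀ : ℝ} (hA : 1 ≤ A) (hθ : 0 < θ) (hT₀ : 0 ≤ T₀) :
    ∃ C : ℝ, 0 ≤ C ∧ ∀ (K P D F S₁ : ℝ → ℝ) (T : ℝ), T₀ ≤ T →
      ContinuousOn K (Icc T₀ T) → ContinuousOn P (Icc T₀ T) → ContinuousOn D (Icc T₀ T) →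
      ContinuousOn F (Icc T₀ T) →
      (∀ t ∈ Icc T₀ T, 0 ≤ K t ∧ 0 ≤ P t ∧ 0 ≤ D t ∧ 0 ≤ F t) →
      (∀ t ∈ Ioo T₀ T, HasDerivAt (fun t => K t + P t) (2 * (S₁ t - D t)) t) →
      (∀ t ∈ Icc T₀ T, S₁ t ≤ D t / 4 + F t) →
      (A + T) ^ (θ + 1) * (K T + P T) + (∫ t in T₀..T, (A + t) ^ (θ + 1) * D t) +
          (∫ t in T₀..T, (A + t) ^ θ * (K t + P t)) ≤
        C * ((K T₀ + P T₀) + (∫ t in T₀..T, (A + t) ^ θ * (K t + P t)) +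
          (∫ t in T₀..T, (A + t) ^ (θ + 1) * F t)) := by
  have hw0 : 0 < A + T₀ := by linarith
  refine ⟨4 * ((A + T₀) ^ (θ + 1) + (θ + 1) + 1), by positivity, ?_⟩
  intro K P D F S₁ T hT cK cP cD cF hn he h1
  have hT0 : T₀ ∈ Icc T₀ T := left_mem_Icc.2 hT
  have hTT : T ∈ Icc T₀ T := right_mem_Icc.2 hT
  have hpos : ∀ t ∈ Icc T₀ T, 0 < A + t := fun t ht => by linarith [ht.1]
  have hw := continuousOn_weight (T := T) hA hT₀
  have hwm : ∀ (s : ℝ) (f : ℝ → ℝ), ContinuousOn f (Icc T₀ T) →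
      ContinuousOn (fun t => (A + t) ^ s * f t) (Icc T₀ T) := fun s f hf => (hw s).mul hf
  have hpw : ∀ t ∈ Icc T₀ T, ∀ r : ℝ, 0 ≤ (A + t) ^ r := fun t ht r =>
    (Real.rpow_pos_of_pos (hpos t ht) r).le
  have hint := intervalIntegral.sub_le_integral_of_hasDeriv_right_of_le hT
    (g := fun t => (A + t) ^ (θ + 1) * ((K t + P t) / 2))
    (g' := fun t => (θ + 1) * (A + t) ^ (θ + 1 - 1) * ((K t + P t) / 2) +
      (A + t) ^ (θ + 1) * (2 * (S₁ t - D t) / 2))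
    (φ := fun t => (θ + 1) / 2 * ((A + t) ^ θ * (K t + P t)) +
      1 * ((A + t) ^ (θ + 1) * F t) + 0 * ((A + t) ^ θ * (K t + P t)) -
      1 / 2 * ((A + t) ^ (θ + 1) * D t) - 0 * ((A + t) ^ θ * (K t + P t))) ?_ ?_ ?_ ?_
  rotate_left
  · exact (hw (θ + 1)).mul ((cK.add cP).div_const 2)
  · intro t ht
    exact ((hasDerivAt_weight (hpos t (Ioo_subset_Icc_self ht)) (θ + 1)).mul
      ((he t ht).div_const 2)).hasDerivWithinAt
  · refine ContinuousOn.integrableOn_Icc ?_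
    have c1 := (hw θ).mul (cK.add cP)
    exact ((((continuousOn_const.mul c1).add
      (continuousOn_const.mul ((hw (θ + 1)).mul cF))).add
      (continuousOn_const.mul c1)).sub
      (continuousOn_const.mul ((hw (θ + 1)).mul cD))).sub (continuousOn_const.mul c1)
  · intro t ht
    have ht' := Ioo_subset_Icc_self ht
    obtain ⟨n1, n2, n3, n4⟩ := hn t ht'
    have key := mul_le_mul_of_nonneg_left (h1 t ht') (hpw t ht' (θ + 1))
    have hD : 0 ≤ (A + t) ^ (θ + 1) * D t := mul_nonneg (hpw t ht' _) n3
    have hs2 : (θ + 1 - 1 : ℝ) = θ := by ring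
    simp only [hs2]
    linarith
  have c1 := hwm θ (fun t => K t + P t) (cK.add cP)
  rw [integral_lin_five hT _ _ _ _ _ c1 (hwm (θ + 1) F cF) c1 (hwm (θ + 1) D cD) c1] at hint
  have int_nonneg : ∀ (r : ℝ) (f : ℝ → ℝ), (∀ t ∈ Icc T₀ T, 0 ≤ f t) →
      0 ≤ ∫ t in T₀..T, (A + t) ^ r * f t := fun r f hf =>
    intervalIntegral.integral_nonneg hT fun t ht => mul_nonneg (hpw t ht r) (hf t ht)
  have i1 := int_nonneg θ _ fun t ht => add_nonneg (hn t ht).1 (hn t ht).2.1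
  have i2 := int_nonneg (θ + 1) F fun t ht => (hn t ht).2.2.2
  have i4 : 0 ≤ (A + T) ^ (θ + 1) * (K T + P T) :=
    mul_nonneg (hpw T hTT _) (add_nonneg (hn T hTT).1 (hn T hTT).2.1)
  have i5 : 0 ≤ K T₀ + P T₀ := add_nonneg (hn T₀ hT0).1 (hn T₀ hT0).2.1
  have i6 := mul_nonneg (hpw T₀ hT0 (θ + 1)) i5
  have i7 := mul_nonneg (hpw T₀ hT0 (θ + 1)) i1
  have i8 := mul_nonneg (hpw T₀ hT0 (θ + 1)) i2
  have i9 := mul_nonneg hθ.le i1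
  have i10 := mul_nonneg hθ.le i2
  have i11 := mul_nonneg hθ.le i5
  linarith

/-! ### Weighted integrals of a solution -/

section

variable {n : ℕ} {a b c : Sp n → ℝ} {q : ℝ → ℝ} {R : ℝ} {m : ℕ} {h : ℝ → Sp n → ℝ}
  {u : ℝ → L2 n} {g : ℝ → L2Vec n}

section WInt

variable {E : Type*} [NormedAddCommGroup E] [InnerProductSpace ℝ E]

/-- The weighted integral `∫ w ⟨f, k⟩`. -/
def wInt (w : Sp n → ℝ) (f k : Lp E 2 (volume : Measure (Sp n))) : ℝ :=
  ∫ x, w x * inner ℝ (f x) (k x)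

lemma wInt_nonneg {w : Sp n → ℝ} (hw : ∀ x, 0 < w x) (f : Lp E 2 (volume : Measure (Sp n))) :
    0 ≤ wInt w f f :=
  integral_nonneg fun x => mul_nonneg (hw x).le real_inner_self_nonneg

lemma wInt_const_mul (r : ℝ) (w : Sp n → ℝ) (f k : Lp E 2 (volume : Measure (Sp n))) :
    wInt (fun x => r * w x) f k = r * wInt w f k := by
  simp only [wInt, mul_assoc, integral_const_mul]

lemma wInt_one (f k : Lp E 2 (volume : Measure (Sp n))) : wInt (fun _ => 1) f k = inner ℝ f k := by
  simp only [wInt, one_mul, L2.inner_def]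

end WInt

/-- A pointwise quadratic inequality in the light cone can be integrated. -/
lemma wInt_le_add (hS : Setting a b c q) {f k : ℝ → L2 n} (hf : ConeCurve q R f)
    (hk : ConeCurve q R k) {t : ℝ} (ht : 0 ≤ t) {w w₁ w₂ : Sp n → ℝ} (hw : Continuous w)
    (hw₁ : Continuous w₁) (hw₂ : Continuous w₂)
    (hle : ∀ x, q ‖x‖ ≤ t + q R → ∀ y z : ℝ, w x * (y * z) ≤ w₁ x * y ^ 2 + w₂ x * z ^ 2) :
    wInt w (f t) (k t) ≤ wInt w₁ (f t) (f t) + wInt w₂ (k t) (k t) := by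
  have i1 := hf.integrable hS hw₁ (k := f) ht
  have i2 := hk.integrable hS hw₂ (k := k) ht
  rw [wInt, wInt, wInt, ← integral_add i1 i2]
  refine integral_mono_ae (hf.integrable hS hw ht) (i1.add i2) ?_
  filter_upwards [hf.supp t ht, hk.supp t ht] with x h1 h2
  simp only [real_inner_eq_mul]
  rcases le_or_gt (q ‖x‖) (t + q R) with hx | hx
  · have := hle x hx (f t x) (k t x)
    nlinarith
  · rw [h1 hx, h2 hx]
    simp

lemma wInt_mono (hS : Setting a b c q) {f : ℝ → L2 n} (hf : ConeCurve q R f) {t : ℝ} (ht : 0 ≤ t)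
    {w w₁ : Sp n → ℝ} (hw : Continuous w) (hw₁ : Continuous w₁)
    (hle : ∀ x, q ‖x‖ ≤ t + q R → w x ≤ w₁ x) : wInt w (f t) (f t) ≤ wInt w₁ (f t) (f t) := by
  refine integral_mono_ae (hf.integrable hS hw ht) (hf.integrable hS hw₁ ht) ?_
  filter_upwards [hf.supp t ht] with x h1
  rcases le_or_gt (q ‖x‖) (t + q R) with hx | hx
  · exact mul_le_mul_of_nonneg_right (hle x hx) real_inner_self_nonneg
  · simp [h1 hx]

/-- `∫ c (∂_t^{j+1} u)²`.  With `c` replaced by `a` this is the dissipation. -/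
def kin (c : Sp n → ℝ) (u : ℝ → L2 n) (j : ℕ) (t : ℝ) : ℝ :=
  wInt c (dt (j + 1) u t) (dt (j + 1) u t)

/-- `∫ b |∇ ∂_t^j u|²`. -/
def pot (b : Sp n → ℝ) (g : ℝ → L2Vec n) (j : ℕ) (t : ℝ) : ℝ := wInt b (dt j g t) (dt j g t)

/-- `∫ a⁻¹ (∂_t^j h)²`. -/
def srcE (a : Sp n → ℝ) (h : ℝ → Sp n → ℝ) (j : ℕ) (t : ℝ) : ℝ :=
  wInt (fun x => (a x)⁻¹) (srcL h j t) (srcL h j t)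

lemma Setting.continuous_inv_a (hS : Setting a b c q) : Continuous fun x => (a x)⁻¹ :=
  hS.smooth_a.continuous.inv₀ fun x => (hS.pos_a x).ne'

lemma continuousOn_kin (hS : Setting a b c q) (hR : 0 < R) (hm : 1 ≤ m)
    (hu : IsSolution m a b c q R h u g) {w : Sp n → ℝ} (hw : Continuous w) {j : ℕ} (hj : j ≤ m) :
    ContinuousOn (kin w u j) (Ici 0) :=
  have h1 := hu.coneCurve_u hS hR hm hj
  h1.continuousOn_integral hS h1.cont hw

lemma continuousOn_pot (hS : Setting a b c q) (hR : 0 < R) (hm : 1 ≤ m)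
    (hu : IsSolution m a b c q R h u g) {j : ℕ} (hj : j ≤ m) :
    ContinuousOn (pot b g j) (Ici 0) :=
  have h1 := hu.coneCurve_g hS hR hm hj
  h1.continuousOn_integral hS h1.cont hS.smooth_b.continuous

lemma continuousOn_srcE (hS : Setting a b c q)
    (hu : IsSolution m a b c q R h u g) {j : ℕ} (hj : j ≤ m) :
    ContinuousOn (srcE a h j) (Ici 0) :=
  have h1 := hu.coneCurve_srcL hS hj
  h1.continuousOn_integral hS h1.cont hS.continuous_inv_a

/-- The energy identity for `∂_t^j u`. -/
lemma hasDerivAt_kin_add_pot (hS : Setting a b c q) (hR : 0 < R) (hm : 1 ≤ m)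
    (hu : IsSolution m a b c q R h u g) {j : ℕ} (hj : j ≤ m) {t : ℝ} (ht : 0 < t) :
    HasDerivAt (fun t => kin c u j t + pot b g j t)
      (2 * (wInt (fun _ => 1) (srcL h j t) (dt (j + 1) u t) - kin a u j t)) t := by
  obtain ⟨κ, hκ, hκ1⟩ := hS.exists_cutoff (t + 1 + q R)
  have cu := hu.coneCurve_u hS hR hm hj
  have cg := hu.coneCurve_g hS hR hm hj
  set Cm := mulL ℝ (bcfOfCompact (fun x => κ x * c x)
        (hκ.continuous.mul hS.smooth_c.continuous) hκ.2.mul_right)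
  set Am := mulL ℝ (bcfOfCompact (fun x => κ x * a x)
        (hκ.continuous.mul hS.smooth_a.continuous) hκ.2.mul_right)
  set Bm := mulL (Sp n) (bcfOfCompact (fun x => κ x * b x)
        (hκ.continuous.mul hS.smooth_b.continuous) hκ.2.mul_right)
  have hcut : ∀ s ∈ Ioo 0 (t + 1), ∀ x, κ x ≠ 1 → s + q R < q ‖x‖ := fun s hs x hx => by
    have := not_le.1 fun h' => hx (hκ1 x h')
    linarith [hs.2]
  have e1 : ∀ s ∈ Ioo 0 (t + 1), kin c u j s = inner ℝ (Cm (dt (j + 1) u s)) (dt (j + 1) u s) :=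
    fun s hs => (integral_cutoff hκ.continuous hκ.2 hS.smooth_c.continuous
      ((cu.supp s hs.1.le).mono fun x hx h' => hx (hcut s hs x h'))).2.symm
  have e2 : ∀ s ∈ Ioo 0 (t + 1), kin a u j s = inner ℝ (Am (dt (j + 1) u s)) (dt (j + 1) u s) :=
    fun s hs => (integral_cutoff hκ.continuous hκ.2 hS.smooth_a.continuous
      ((cu.supp s hs.1.le).mono fun x hx h' => hx (hcut s hs x h'))).2.symm
  have e3 : ∀ s ∈ Ioo 0 (t + 1), pot b g j s = inner ℝ (Bm (dt j g s)) (dt j g s) :=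
    fun s hs => (integral_cutoff hκ.continuous hκ.2 hS.smooth_b.continuous
      ((cg.supp s hs.1.le).mono fun x hx h' => hx (hcut s hs x h'))).2.symm
  have htI : t ∈ Ioo 0 (t + 1) := ⟨ht, by linarith⟩
  have hI : Ioo 0 (t + 1) ∈ 𝓝 t := Ioo_mem_nhds ht (by linarith)
  rw [e2 t htI, wInt_one]
  refine HasDerivAt.congr_of_eventuallyEq (f := fun t =>
    inner ℝ (Cm (dt (j + 1) u t)) (dt (j + 1) u t) + inner ℝ (Bm (dt j g t)) (dt j g t)) ?_ ?_
  · cases j with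
    | zero =>
      exact ((hu.abstractWave hS hR (j := 0) hm hκ hκ1).hasDerivWithinAt_energy
        ⟨ht.le, htI.2⟩).hasDerivAt (Ici_mem_nhds ht)
    | succ i =>
      refine (hu.abstractWave hS hR (j := i) hj hκ hκ1).hasDerivAt_energy_deriv
        (cu.cont.mono Ico_subset_Ici_self) (cg.cont.mono Ico_subset_Ici_self)
        ((hu.coneCurve_srcL hS hj).cont.mono Ico_subset_Ici_self)
        (fun s hs => hu.deriv_srcL hS (by omega) hs.1) ht htI.2
  · filter_upwards [hI] with s hs
    rw [e1 s hs, e3 s hs]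

/-- The virial identity for `∂_t^{j+1} u`. -/
lemma hasDerivAt_virial (hS : Setting a b c q) (hR : 0 < R)
    (hu : IsSolution m a b c q R h u g) {j : ℕ} (hj : j + 1 ≤ m) {t : ℝ} (ht : 0 < t) :
    HasDerivAt (fun t => wInt c (dt (j + 2) u t) (dt (j + 1) u t) + kin a u j t / 2)
      (wInt (fun _ => 1) (srcL h (j + 1) t) (dt (j + 1) u t) + kin c u (j + 1) t -
        pot b g (j + 1) t) t := by
  have hm : 1 ≤ m := by omega
  obtain ⟨κ, hκ, hκ1⟩ := hS.exists_cutoff (t + 1 + q R)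
  have cu := hu.coneCurve_u hS hR hm (j := j) (by omega)
  have cu' := hu.coneCurve_u hS hR hm (j := j + 1) hj
  have cg := hu.coneCurve_g hS hR hm (j := j + 1) hj
  set Cm := mulL ℝ (bcfOfCompact (fun x => κ x * c x)
        (hκ.continuous.mul hS.smooth_c.continuous) hκ.2.mul_right)
  set Am := mulL ℝ (bcfOfCompact (fun x => κ x * a x)
        (hκ.continuous.mul hS.smooth_a.continuous) hκ.2.mul_right)
  set Bm := mulL (Sp n) (bcfOfCompact (fun x => κ x * b x)
        (hκ.continuous.mul hS.smooth_b.continuous) hκ.2.mul_right)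
  have hcut : ∀ s ∈ Ioo 0 (t + 1), ∀ x, κ x ≠ 1 → s + q R < q ‖x‖ := fun s hs x hx => by
    have := not_le.1 fun h' => hx (hκ1 x h')
    linarith [hs.2]
  have e1 : ∀ s ∈ Ioo 0 (t + 1), kin c u (j + 1) s =
      inner ℝ (Cm (dt (j + 2) u s)) (dt (j + 2) u s) :=
    fun s hs => (integral_cutoff hκ.continuous hκ.2 hS.smooth_c.continuous
      ((cu'.supp s hs.1.le).mono fun x hx h' => hx (hcut s hs x h'))).2.symm
  have e0 : ∀ s ∈ Ioo 0 (t + 1), wInt c (dt (j + 2) u s) (dt (j + 1) u s) =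
      inner ℝ (Cm (dt (j + 2) u s)) (dt (j + 1) u s) :=
    fun s hs => (integral_cutoff hκ.continuous hκ.2 hS.smooth_c.continuous
      ((cu'.supp s hs.1.le).mono fun x hx h' => hx (hcut s hs x h'))).2.symm
  have e2 : ∀ s ∈ Ioo 0 (t + 1), kin a u j s = inner ℝ (Am (dt (j + 1) u s)) (dt (j + 1) u s) :=
    fun s hs => (integral_cutoff hκ.continuous hκ.2 hS.smooth_a.continuous
      ((cu.supp s hs.1.le).mono fun x hx h' => hx (hcut s hs x h'))).2.symm
  have e3 : ∀ s ∈ Ioo 0 (t + 1), pot b g (j + 1) s =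
      inner ℝ (Bm (dt (j + 1) g s)) (dt (j + 1) g s) :=
    fun s hs => (integral_cutoff hκ.continuous hκ.2 hS.smooth_b.continuous
      ((cg.supp s hs.1.le).mono fun x hx h' => hx (hcut s hs x h'))).2.symm
  have htI : t ∈ Ioo 0 (t + 1) := ⟨ht, by linarith⟩
  have hI : Ioo 0 (t + 1) ∈ 𝓝 t := Ioo_mem_nhds ht (by linarith)
  rw [e1 t htI, e3 t htI, wInt_one]
  refine HasDerivAt.congr_of_eventuallyEq (f := fun t =>
    inner ℝ (Cm (dt (j + 2) u t)) (dt (j + 1) u t) +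
      inner ℝ (Am (dt (j + 1) u t)) (dt (j + 1) u t) / 2) ?_ ?_
  · exact ((hu.abstractWave hS hR hj hκ hκ1).hasDerivWithinAt_virial
      (cg.cont.mono Ico_subset_Ici_self) ⟨ht.le, htI.2⟩
      (hu.deriv_srcL hS (by omega) ht.le)).hasDerivAt (Ici_mem_nhds ht)
  · filter_upwards [hI] with s hs
    rw [e0 s hs, e2 s hs]

/-! ### Weighted energy estimates of all orders -/

/-- The damping is effective in the light cone: `c / a = o(t)` there. -/
def EffectiveDamping (a c : Sp n → ℝ) (q : ℝ → ℝ) (R : ℝ) : Prop :=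
  ∀ ε : ℝ, 0 < ε → ∃ A : ℝ, 1 ≤ A ∧ ∀ t : ℝ, 0 ≤ t → ∀ x, q ‖x‖ ≤ t + q R →
    c x ≤ ε * (A + t) * a x

/-- `w^{s} (K + P)(T) + ∫ w^s D + ∫ w^{s-1} (K + P)` for `s = θ + 2 j + 1` and `w = A + t`: the
quantities of order `j` which are to be bounded. -/
def levelL (a b c : Sp n → ℝ) (A θ T₀ : ℝ) (u : ℝ → L2 n) (g : ℝ → L2Vec n) (j : ℕ) (T : ℝ) : ℝ :=
  (A + T) ^ (θ + 2 * j + 1) * (kin c u j T + pot b g j T) +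
    (∫ t in T₀..T, (A + t) ^ (θ + 2 * j + 1) * kin a u j t) +
    (∫ t in T₀..T, (A + t) ^ (θ + 2 * j) * (kin c u j t + pot b g j t))

/-- The right-hand side of the weighted energy estimate of order `j`. -/
def levelR (a b c : Sp n → ℝ) (A θ T₀ : ℝ) (h : ℝ → Sp n → ℝ) (u : ℝ → L2 n) (g : ℝ → L2Vec n)
    (j : ℕ) (T : ℝ) : ℝ :=
  (∑ i ∈ Finset.range (j + 1), (kin c u i T₀ + pot b g i T₀)) +
    (∫ t in T₀..T, (A + t) ^ θ * (kin c u 0 t + pot b g 0 t)) +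
    ∑ i ∈ Finset.range (j + 1), ∫ t in T₀..T, (A + t) ^ (θ + 2 * i + 1) * srcE a h i t

/-- Young's inequality for a quadratic form with nonpositive discriminant. -/
lemma quad_ineq {α β γ y z : ℝ} (hα : 0 ≤ α) (hβ : 0 ≤ β) (hγ : γ ^ 2 ≤ 4 * (α * β)) :
    γ * (y * z) ≤ α * y ^ 2 + β * z ^ 2 := by
  have h1 : |γ * (y * z)| ≤ α * y ^ 2 + β * z ^ 2 := by
    refine abs_le_of_sq_le_sq ?_ (by positivity)
    nlinarith [sq_nonneg (α * y ^ 2 - β * z ^ 2), mul_le_mul_of_nonneg_right hγ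
      (by positivity : 0 ≤ (y * z) ^ 2)]
  exact (le_abs_self _).trans h1

end

/-! ### The induction over the order of the time derivative -/

section

variable {n : ℕ} {a b c : Sp n → ℝ} {q : ℝ → ℝ} {R : ℝ} {m : ℕ} {h : ℝ → Sp n → ℝ}
  {u : ℝ → L2 n} {g : ℝ → L2Vec n}

/-- Young's inequality for the source terms. -/
lemma src_kin_le (hS : Setting a b c q) (hR : 0 < R) (hm : 1 ≤ m)
    (hu : IsSolution m a b c q R h u g) {i j : ℕ} (hi : i ≤ m) (hj : j ≤ m) {t : ℝ} (ht : 0 ≤ t)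
    {r : ℝ} (hr : 0 < r) :
    wInt (fun _ => 1) (srcL h i t) (dt (j + 1) u t) ≤
      r / 2 * srcE a h i t + r⁻¹ / 2 * kin a u j t := by
  rw [srcE, kin, ← wInt_const_mul, ← wInt_const_mul]
  refine wInt_le_add hS (hu.coneCurve_srcL hS hi) (hu.coneCurve_u hS hR hm hj) ht
    continuous_const (continuous_const.mul hS.continuous_inv_a)
    (continuous_const.mul hS.smooth_a.continuous) fun x _ y z => ?_
  have := hS.pos_a x
  refine quad_ineq (by positivity) (by positivity) ?_
  field_simp
  norm_num

/-- Young's inequality for the cross term of the virial identity. -/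
lemma abs_kin_cross_le (hS : Setting a b c q) (hR : 0 < R) (hm : 1 ≤ m)
    (hu : IsSolution m a b c q R h u g) {i j : ℕ} (hi : i ≤ m) (hj : j ≤ m) {t : ℝ} (ht : 0 ≤ t)
    {r : ℝ} (hr : 0 < r) :
    |wInt c (dt (i + 1) u t) (dt (j + 1) u t)| ≤
      r / 2 * kin c u i t + r⁻¹ / 2 * kin c u j t := by
  have cc := hS.smooth_c.continuous
  have key : ∀ σ : ℝ, σ ^ 2 = 1 → σ * wInt c (dt (i + 1) u t) (dt (j + 1) u t) ≤
      r / 2 * kin c u i t + r⁻¹ / 2 * kin c u j t := by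
    intro σ hσ
    rw [kin, kin, ← wInt_const_mul, ← wInt_const_mul, ← wInt_const_mul]
    refine wInt_le_add hS (hu.coneCurve_u hS hR hm hi) (hu.coneCurve_u hS hR hm hj) ht
      (continuous_const.mul cc) (continuous_const.mul cc) (continuous_const.mul cc)
      fun x _ y z => ?_
    have := hS.pos_c x
    refine quad_ineq (by positivity) (by positivity) ?_
    rw [mul_pow, hσ]
    field_simp
    norm_num
  rw [abs_le']
  constructor
  · simpa using key 1 (by norm_num)
  · simpa using key (-1) (by norm_num)

/-- Weights which are comparable in the light cone give comparable kinetic energies. -/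
lemma kin_le_kin (hS : Setting a b c q) (hR : 0 < R) (hm : 1 ≤ m)
    (hu : IsSolution m a b c q R h u g) {j : ℕ} (hj : j ≤ m) {t : ℝ} (ht : 0 ≤ t)
    {w w₁ : Sp n → ℝ} (hw : Continuous w) (hw₁ : Continuous w₁) {r : ℝ}
    (hle : ∀ x, q ‖x‖ ≤ t + q R → w x ≤ r * w₁ x) : kin w u j t ≤ r * kin w₁ u j t := by
  rw [kin, kin, ← wInt_const_mul]
  exact wInt_mono hS (hu.coneCurve_u hS hR hm hj) ht hw (continuous_const.mul hw₁) hle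

/-- On the initial light cone, which is compact, `a` is bounded by a multiple of `c`. -/
lemma Setting.exists_a_le (hS : Setting a b c q) (L : ℝ) :
    ∃ B, 0 ≤ B ∧ ∀ x, q ‖x‖ ≤ L → a x ≤ B * c x := by
  have hcont : Continuous fun x => a x / c x :=
    hS.smooth_a.continuous.div hS.smooth_c.continuous fun x => (hS.pos_c x).ne'
  obtain ⟨B, hB⟩ := (hS.isCompact_cone L).bddAbove_image hcont.continuousOn
  refine ⟨max B 0, le_max_right _ _, fun x hx => ?_⟩
  rw [← div_le_iff₀ (hS.pos_c x)]
  exact (hB (mem_image_of_mem _ hx)).trans (le_max_left _ _)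

/-- Nonnegativity of all the quantities involved. -/
lemma Setting.nonneg (hS : Setting a b c q) (h : ℝ → Sp n → ℝ) (u : ℝ → L2 n) (g : ℝ → L2Vec n)
    (j : ℕ) (t : ℝ) : 0 ≤ kin c u j t ∧ 0 ≤ pot b g j t ∧ 0 ≤ kin a u j t ∧ 0 ≤ srcE a h j t :=
  ⟨wInt_nonneg hS.pos_c _, wInt_nonneg hS.pos_b _, wInt_nonneg hS.pos_a _,
    wInt_nonneg (fun x => inv_pos.2 (hS.pos_a x)) _⟩

/-- The weighted energy estimate of order `0`. -/
lemma level_estimate_zero (hS : Setting a b c q) (hR : 0 < R) {A θ T₀ : ℝ} (hA : 1 ≤ A)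
    (hθ : 0 < θ) (hT₀ : 0 ≤ T₀) :
    ∃ C : ℝ, 0 ≤ C ∧ ∀ m h u g, 1 ≤ m → IsSolution m a b c q R h u g → ∀ T, T₀ ≤ T →
      levelL a b c A θ T₀ u g 0 T ≤ C * levelR a b c A θ T₀ h u g 0 T := by
  obtain ⟨C, hC, hC'⟩ := level_zero hA hθ hT₀
  refine ⟨C, hC, fun m h u g hm hu T hT => ?_⟩
  have hsub : Icc T₀ T ⊆ Ici 0 := fun t ht => hT₀.trans ht.1
  have key := hC' (kin c u 0) (pot b g 0) (kin a u 0) (srcE a h 0)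
    (fun t => wInt (fun _ => 1) (srcL h 0 t) (dt (0 + 1) u t)) T hT
    ((continuousOn_kin hS hR hm hu hS.smooth_c.continuous (Nat.zero_le _)).mono hsub)
    ((continuousOn_pot hS hR hm hu (Nat.zero_le _)).mono hsub)
    ((continuousOn_kin hS hR hm hu hS.smooth_a.continuous (Nat.zero_le _)).mono hsub)
    ((continuousOn_srcE hS hu (Nat.zero_le _)).mono hsub)
    (fun t _ => hS.nonneg h u g 0 t)
    (fun t ht => hasDerivAt_kin_add_pot hS hR hm hu (Nat.zero_le _) (hT₀.trans_lt ht.1))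
    (fun t ht => (src_kin_le hS hR hm hu (Nat.zero_le _) (Nat.zero_le _) (hT₀.trans ht.1)
      two_pos).trans_eq (by ring))
  simpa [levelL, levelR] using key

lemma levelL_nonneg (hS : Setting a b c q) {A θ T₀ T : ℝ} (hA : 1 ≤ A) (hT₀ : 0 ≤ T₀)
    (hT : T₀ ≤ T) (u : ℝ → L2 n) (g : ℝ → L2Vec n) (j : ℕ) :
    0 ≤ (A + T) ^ (θ + 2 * j + 1) * (kin c u j T + pot b g j T) ∧
    0 ≤ (∫ t in T₀..T, (A + t) ^ (θ + 2 * j + 1) * kin a u j t) ∧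
    0 ≤ (∫ t in T₀..T, (A + t) ^ (θ + 2 * j) * (kin c u j t + pot b g j t)) := by
  have hn := fun t => hS.nonneg (fun _ _ => 0) u g j t
  have hw : ∀ t ∈ Icc T₀ T, ∀ r : ℝ, 0 ≤ (A + t) ^ r := fun t ht r =>
    Real.rpow_nonneg (by linarith [ht.1]) r
  refine ⟨mul_nonneg (hw T ⟨hT, le_rfl⟩ _) (add_nonneg (hn T).1 (hn T).2.1),
    intervalIntegral.integral_nonneg hT fun t ht => mul_nonneg (hw t ht _) (hn t).2.2.1,
    intervalIntegral.integral_nonneg hT fun t ht =>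
      mul_nonneg (hw t ht _) (add_nonneg (hn t).1 (hn t).2.1)⟩

/-- The contribution of the new order to the right-hand side, and monotonicity of the latter. -/
lemma levelR_succ (hS : Setting a b c q) {A θ T₀ T : ℝ} (hA : 1 ≤ A) (hT₀ : 0 ≤ T₀)
    (hT : T₀ ≤ T) (h : ℝ → Sp n → ℝ) (u : ℝ → L2 n) (g : ℝ → L2Vec n) (j : ℕ) :
    levelR a b c A θ T₀ h u g j T ≤ levelR a b c A θ T₀ h u g (j + 1) T ∧
    (kin c u (j + 1) T₀ + pot b g (j + 1) T₀) + (kin c u j T₀ + pot b g j T₀) +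
      (∫ t in T₀..T, (A + t) ^ (θ + 2 * (j + 1 : ℕ) + 1) * srcE a h (j + 1) t) ≤
      levelR a b c A θ T₀ h u g (j + 1) T := by
  have hw : ∀ t ∈ Icc T₀ T, ∀ r : ℝ, 0 ≤ (A + t) ^ r := fun t ht r =>
    Real.rpow_nonneg (by linarith [ht.1]) r
  have hn := hS.nonneg h u g
  have n1 : ∀ i, 0 ≤ kin c u i T₀ + pot b g i T₀ := fun i => add_nonneg (hn i _).1 (hn i _).2.1
  have n2 : ∀ i : ℕ, 0 ≤ ∫ t in T₀..T, (A + t) ^ (θ + 2 * i + 1) * srcE a h i t := fun i =>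
    intervalIntegral.integral_nonneg hT fun t ht => mul_nonneg (hw t ht _) (hn i t).2.2.2
  have n3 : 0 ≤ ∫ t in T₀..T, (A + t) ^ θ * (kin c u 0 t + pot b g 0 t) :=
    intervalIntegral.integral_nonneg hT fun t ht =>
      mul_nonneg (hw t ht _) (add_nonneg (hn 0 t).1 (hn 0 t).2.1)
  have s1 := Finset.sum_nonneg fun i (_ : i ∈ Finset.range j) => n1 i
  have s2 := Finset.sum_nonneg fun i (_ : i ∈ Finset.range (j + 1)) => n2 i
  have n1' := n1 (j + 1)
  have n2' := n2 (j + 1)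
  constructor
  · unfold levelR
    rw [Finset.sum_range_succ _ (j + 1), Finset.sum_range_succ _ (j + 1)]
    linarith
  · unfold levelR
    rw [Finset.sum_range_succ _ (j + 1), Finset.sum_range_succ _ (j + 1), Finset.sum_range_succ _ j]
    linarith

/-- The induction step of the weighted energy estimates. -/
lemma level_estimate_succ (hS : Setting a b c q) (hR : 0 < R) {A θ T₀ ε : ℝ} (hA : 1 ≤ A)
    (hθ : 0 < θ) (hT₀ : 0 ≤ T₀) {j : ℕ} (hε1 : ε ≤ 1)
    (hε : (3 * (θ + 2 * (j + 1 : ℕ) + 1) / 2 +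
      (θ + 2 * (j + 1 : ℕ) + 1) * ((θ + 2 * (j + 1 : ℕ) + 1) - 1) / 2) * ε ≤ 1 / 4)
    (hdamp : ∀ t : ℝ, 0 ≤ t → ∀ x, q ‖x‖ ≤ t + q R → c x ≤ ε * (A + t) * a x)
    (ih : ∃ C : ℝ, 0 ≤ C ∧ ∀ m h u g, 1 ≤ m → j ≤ m → IsSolution m a b c q R h u g →
      ∀ T, T₀ ≤ T → levelL a b c A θ T₀ u g j T ≤ C * levelR a b c A θ T₀ h u g j T) :
    ∃ C : ℝ, 0 ≤ C ∧ ∀ m h u g, 1 ≤ m → j + 1 ≤ m → IsSolution m a b c q R h u g →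
      ∀ T, T₀ ≤ T →
        levelL a b c A θ T₀ u g (j + 1) T ≤ C * levelR a b c A θ T₀ h u g (j + 1) T := by
  obtain ⟨C₀, hC₀, ih⟩ := ih
  obtain ⟨B, hB, hBa⟩ := hS.exists_a_le (T₀ + q R)
  have hs : 1 ≤ θ + 2 * ((j + 1 : ℕ) : ℝ) + 1 := by
    have : (0 : ℝ) ≤ ((j + 1 : ℕ) : ℝ) := Nat.cast_nonneg _
    linarith
  obtain ⟨C₁, hC₁, key⟩ := level_step hA hs hT₀ hB hε1 hε
  refine ⟨C₁ * (1 + C₀), by positivity, fun m h u g hm hj hu T hT => ?_⟩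
  have hj' : j ≤ m := by omega
  have hsub : Icc T₀ T ⊆ Ici 0 := fun t ht => hT₀.trans ht.1
  have cc := hS.smooth_c.continuous
  have ca := hS.smooth_a.continuous
  have ck : ∀ i, i ≤ m → ContinuousOn (kin c u i) (Icc T₀ T) := fun i hi =>
    (continuousOn_kin hS hR hm hu cc hi).mono hsub
  have cd : ∀ i, i ≤ m → ContinuousOn (kin a u i) (Icc T₀ T) := fun i hi =>
    (continuousOn_kin hS hR hm hu ca hi).mono hsub
  have cp : ∀ i, i ≤ m → ContinuousOn (pot b g i) (Icc T₀ T) := fun i hi =>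
    (continuousOn_pot hS hR hm hu hi).mono hsub
  have h1 := key (kin c u (j + 1)) (pot b g (j + 1)) (kin a u (j + 1)) (srcE a h (j + 1))
    (fun t => wInt (fun _ => 1) (srcL h (j + 1) t) (dt (j + 1 + 1) u t))
    (fun t => wInt (fun _ => 1) (srcL h (j + 1) t) (dt (j + 1) u t))
    (fun t => wInt c (dt (j + 2) u t) (dt (j + 1) u t))
    (kin c u j) (pot b g j) (kin a u j) T hT (ck _ hj) (cp _ hj) (cd _ hj)
    ((continuousOn_srcE hS hu hj).mono hsub)
    (((hu.coneCurve_u hS hR hm hj).continuousOn_integral hS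
      (hu.coneCurve_u hS hR hm hj').cont cc).mono hsub)
    (ck _ hj') (cp _ hj') (cd _ hj')
    (fun t _ => ⟨(hS.nonneg h u g (j + 1) t).1, (hS.nonneg h u g (j + 1) t).2.1,
      (hS.nonneg h u g (j + 1) t).2.2.1, (hS.nonneg h u g (j + 1) t).2.2.2,
      (hS.nonneg h u g j t).1, (hS.nonneg h u g j t).2.1, (hS.nonneg h u g j t).2.2.1⟩)
    (fun t ht => hasDerivAt_kin_add_pot hS hR hm hu hj (hT₀.trans_lt ht.1))
    (fun t ht => hasDerivAt_virial hS hR hu hj (hT₀.trans_lt ht.1))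
    (fun t ht => (src_kin_le hS hR hm hu hj hj (hT₀.trans ht.1) two_pos).trans_eq (by ring))
    (fun t ht r hr => src_kin_le hS hR hm hu hj hj' (hT₀.trans ht.1) hr)
    (fun t ht r hr => abs_kin_cross_le hS hR hm hu hj hj' (hT₀.trans ht.1) hr)
    (fun t ht => kin_le_kin hS hR hm hu hj (hT₀.trans ht.1) cc ca (hdamp t (hT₀.trans ht.1)))
    (kin_le_kin hS hR hm hu hj' hT₀ ca cc hBa)
  have e2 : θ + 2 * ((j + 1 : ℕ) : ℝ) + 1 - 2 = θ + 2 * j + 1 := by push_cast; ring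
  have e1 : θ + 2 * ((j + 1 : ℕ) : ℝ) + 1 - 1 = θ + 2 * ((j + 1 : ℕ) : ℝ) := by ring
  have e3 : θ + 2 * ((j + 1 : ℕ) : ℝ) + 1 - 3 = θ + 2 * j := by push_cast; ring
  rw [e1, e2, e3] at h1
  obtain ⟨r1, r2⟩ := levelR_succ (θ := θ) hS hA hT₀ hT h u g j
  have h2 := ih m h u g hm hj' hu T hT
  have h3 : C₀ * levelR a b c A θ T₀ h u g j T ≤ C₀ * levelR a b c A θ T₀ h u g (j + 1) T :=
    mul_le_mul_of_nonneg_left r1 hC₀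
  unfold levelL at h2
  have h4 := mul_le_mul_of_nonneg_left (add_le_add r2 (h2.trans h3)) hC₁
  have h5 := h1.trans h4
  unfold levelL
  linarith

/-- The weighted energy estimates of all orders. -/
theorem level_estimate (hS : Setting a b c q) (hR : 0 < R) (hdamp : EffectiveDamping a c q R)
    {θ T₀ : ℝ} (hθ : 0 < θ) (hT₀ : 0 ≤ T₀) (J : ℕ) :
    ∃ A : ℝ, 1 ≤ A ∧ (∀ t : ℝ, 0 ≤ t → ∀ x, q ‖x‖ ≤ t + q R → c x ≤ (A + t) * a x) ∧
      ∀ j, j ≤ J → ∃ C : ℝ, 0 ≤ C ∧ ∀ m h u g, 1 ≤ m → j ≤ m → IsSolution m a b c q R h u g →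
        ∀ T, T₀ ≤ T → levelL a b c A θ T₀ u g j T ≤ C * levelR a b c A θ T₀ h u g j T := by
  set M : ℝ → ℝ := fun s => 3 * s / 2 + s * (s - 1) / 2 with hM
  set S : ℝ := θ + 2 * J + 1
  have hS1 : 1 ≤ S := by
    have : (0 : ℝ) ≤ (J : ℝ) := Nat.cast_nonneg _
    linarith
  have hMS : 1 ≤ M S := by
    have := mul_nonneg (by linarith : (0 : ℝ) ≤ S) (sub_nonneg.2 hS1)
    simp only [hM]; linarith
  -- The absorption constant grows with the order, so the one of order `J` serves for all orders.
  obtain ⟨A, hA, hA'⟩ := hdamp (1 / (4 * M S)) (by positivity)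
  have hε1 : 1 / (4 * M S) ≤ 1 := by
    rw [div_le_one (by positivity)]; linarith
  refine ⟨A, hA, fun t ht x hx => (hA' t ht x hx).trans ?_, fun j => ?_⟩
  · exact mul_le_mul_of_nonneg_right (mul_le_of_le_one_left (by linarith) hε1) (hS.pos_a x).le
  induction j with
  | zero =>
    intro _
    obtain ⟨C, hC, hC'⟩ := level_estimate_zero hS hR hA hθ hT₀
    exact ⟨C, hC, fun m h u g hm _ => hC' m h u g hm⟩
  | succ j ih =>
    intro hj
    refine level_estimate_succ hS hR hA hθ hT₀ hε1 ?_ hA' (ih (by omega))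
    have hjS : θ + 2 * ((j + 1 : ℕ) : ℝ) + 1 ≤ S := by
      have : ((j + 1 : ℕ) : ℝ) ≤ J := by exact_mod_cast hj
      linarith
    have h0 : 1 ≤ θ + 2 * ((j + 1 : ℕ) : ℝ) + 1 := by
      have : (0 : ℝ) ≤ ((j + 1 : ℕ) : ℝ) := Nat.cast_nonneg _
      linarith
    have hMM : M (θ + 2 * ((j + 1 : ℕ) : ℝ) + 1) ≤ M S := by
      simp only [hM]; nlinarith
    calc M (θ + 2 * ((j + 1 : ℕ) : ℝ) + 1) * (1 / (4 * M S)) ≤ M S * (1 / (4 * M S)) :=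
          mul_le_mul_of_nonneg_right hMM (by positivity)
      _ = 1 / 4 := by field_simp

end

/-! ### Consequences of the growth conditions -/

section

variable {n : ℕ} {a b c : Sp n → ℝ} {q : ℝ → ℝ} {R : ℝ} {m : ℕ} {h : ℝ → Sp n → ℝ}
  {u : ℝ → L2 n} {g : ℝ → L2Vec n}

lemma PowerGrowth.pos {f : Sp n → ℝ} {f₀ f₁ e : ℝ} (hf : PowerGrowth f f₀ f₁ e) (h₀ : 0 < f₀)
    (x : Sp n) : 0 < f x :=
  (mul_pos h₀ (Real.rpow_pos_of_pos (by positivity) e)).trans_le (hf x).1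

/-- The lower bound `q r ≥ q₀ r^p` with `p > 0` makes the sublevel sets of `q` bounded. -/
lemma setting_of_growth (ha : ContDiff ℝ ∞ a) (hb : ContDiff ℝ ∞ b) (hc : ContDiff ℝ ∞ c)
    (ha' : ∀ x, 0 < a x) (hb' : ∀ x, 0 < b x) (hc' : ∀ x, 0 < c x) {q₀ p : ℝ} (hq₀ : 0 < q₀)
    (hp : 0 < p) (hq : IsSpeedBound b c q q₀ p) : Setting a b c q where
  smooth_a := ha
  smooth_b := hb
  smooth_c := hc
  pos_a := ha'
  pos_b := hb'
  pos_c := hc'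
  q_contDiffOn := hq.contDiffOn
  q_deriv_pos := hq.deriv_pos
  q_deriv_le := hq.deriv_le
  q_proper L := by
    refine ⟨(L / q₀) ^ p⁻¹, fun r hr hL => ?_⟩
    have h1 : r ^ p ≤ L / q₀ := by
      rw [le_div_iff₀ hq₀, mul_comm]
      exact (hq.lower r hr).trans hL
    calc r = (r ^ p) ^ p⁻¹ := (Real.rpow_rpow_inv hr hp.ne').symm
      _ ≤ (L / q₀) ^ p⁻¹ := Real.rpow_le_rpow (by positivity) h1 (by positivity)

/-- A lower power is bounded by an arbitrarily small multiple of a higher one and a constant. -/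
lemma rpow_le_small_mul_rpow {δ p η : ℝ} (hδ : δ < p) (hη : 0 < η) :
    ∃ B : ℝ, 0 ≤ B ∧ ∀ y : ℝ, 1 ≤ y → y ^ δ ≤ η * y ^ p + B := by
  obtain ⟨Y, hY⟩ := eventually_atTop.1
    ((tendsto_rpow_neg_atTop (sub_pos.2 hδ)).eventually_le_const hη)
  refine ⟨(max Y 1) ^ max δ 0, by positivity, fun y hy => ?_⟩
  have hy0 : 0 < y := by linarith
  rcases le_or_gt Y y with h | h
  · have e : y ^ δ = y ^ (-(p - δ)) * y ^ p := by
      rw [← Real.rpow_add hy0]; congr 1; ring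
    rw [e]
    have := mul_le_mul_of_nonneg_right (hY y h) (by positivity : 0 ≤ y ^ p)
    have : 0 ≤ (max Y 1) ^ max δ 0 := by positivity
    linarith
  · have h1 : y ^ δ ≤ y ^ max δ 0 := Real.rpow_le_rpow_of_exponent_le hy (le_max_left _ _)
    have h2 : y ^ max δ 0 ≤ (max Y 1) ^ max δ 0 :=
      Real.rpow_le_rpow hy0.le (h.le.trans (le_max_left _ _)) (le_max_right _ _)
    have : 0 ≤ η * y ^ p := by positivity
    linarith

/-- Since `2 α + β - γ < 2`, the quotient `c / a` is `o(t)` in the light cone. -/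
lemma effectiveDamping_of_growth {α γ p a₀ a₁ c₀ c₁ q₀ : ℝ} (ha₀ : 0 < a₀) (hc₁ : 0 < c₁)
    (ha : PowerGrowth a a₀ a₁ (-α)) (hc : PowerGrowth c c₀ c₁ (-γ)) (hq₀ : 0 < q₀)
    (hp : 0 < p) (hαγ : α - γ < p) (hq : IsSpeedBound b c q q₀ p) :
    EffectiveDamping a c q R := by
  intro ε hε
  have h2p : (0 : ℝ) < 2 ^ p := by positivity
  obtain ⟨B, hB, hB'⟩ := rpow_le_small_mul_rpow (η := ε * q₀ * a₀ / (c₁ * 2 ^ p)) hαγ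
    (by positivity)
  refine ⟨max 1 (q₀ + q R + c₁ * B / (a₀ * ε)), le_max_left _ _, fun t ht x hx => ?_⟩
  set y := 1 + ‖x‖ with hy
  have hy1 : 1 ≤ y := by simp [hy]
  have hy0 : 0 < y := by linarith
  have h1 : ‖x‖ ^ p ≤ (t + q R) / q₀ := by
    rw [le_div_iff₀ hq₀, mul_comm]
    exact (hq.lower _ (norm_nonneg x)).trans hx
  have h2 : y ^ p ≤ 2 ^ p * (1 + ‖x‖ ^ p) := by
    have e1 : y ≤ 2 * max 1 ‖x‖ := by
      rw [hy]; linarith [le_max_left 1 ‖x‖, le_max_right 1 ‖x‖]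
    refine (Real.rpow_le_rpow hy0.le e1 hp.le).trans ?_
    rw [Real.mul_rpow zero_le_two (by positivity)]
    refine mul_le_mul_of_nonneg_left ?_ h2p.le
    have : 0 ≤ ‖x‖ ^ p := by positivity
    rcases le_total 1 ‖x‖ with h | h
    · rw [max_eq_right h]; linarith
    · rw [max_eq_left h, Real.one_rpow]; linarith
  have h3 : c₁ / a₀ * y ^ (α - γ) ≤ ε * (max 1 (q₀ + q R + c₁ * B / (a₀ * ε)) + t) := by
    calc c₁ / a₀ * y ^ (α - γ)
        ≤ c₁ / a₀ * (ε * q₀ * a₀ / (c₁ * 2 ^ p) * (2 ^ p * (1 + (t + q R) / q₀)) + B) := by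
          refine mul_le_mul_of_nonneg_left ((hB' y hy1).trans ?_) (by positivity)
          gcongr
          refine h2.trans ?_
          gcongr
      _ = ε * (q₀ + q R + c₁ * B / (a₀ * ε) + t) := by field_simp; ring
      _ ≤ _ := by gcongr; exact le_max_right _ _
  have e : y ^ (-γ) = y ^ (α - γ) * y ^ (-α) := by
    rw [← Real.rpow_add hy0]; congr 1; ring
  calc c x ≤ c₁ * y ^ (-γ) := (hc x).2
    _ = c₁ / a₀ * y ^ (α - γ) * (a₀ * y ^ (-α)) := by rw [e]; field_simp
    _ ≤ ε * (max 1 (q₀ + q R + c₁ * B / (a₀ * ε)) + t) * (a₀ * y ^ (-α)) := by gcongr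
    _ ≤ _ := by
      refine mul_le_mul_of_nonneg_left (ha x).1 ?_
      have := le_max_left 1 (q₀ + q R + c₁ * B / (a₀ * ε))
      have : 0 ≤ max 1 (q₀ + q R + c₁ * B / (a₀ * ε)) + t := by linarith
      positivity

/-! ### Energies and source terms as extended nonnegative numbers -/

lemma energy_eq (hS : Setting a b c q) (hR : 0 < R) (hm : 1 ≤ m)
    (hu : IsSolution m a b c q R h u g) {j : ℕ} (hj : j ≤ m) {t : ℝ} (ht : 0 ≤ t) :
    energy b c u g j t = ENNReal.ofReal ((kin c u j t + pot b g j t) / 2) := by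
  have i1 := (hu.coneCurve_u hS hR hm hj).integrable hS hS.smooth_c.continuous
    (k := dt (j + 1) u) ht
  have i2 := (hu.coneCurve_g hS hR hm hj).integrable hS hS.smooth_b.continuous
    (k := dt j g) ht
  have i3 : Integrable fun x => (c x * inner ℝ (dt (j + 1) u t x) (dt (j + 1) u t x) +
      b x * inner ℝ (dt j g t x) (dt j g t x)) / 2 := (i1.add i2).div_const 2
  rw [energy, kin, pot, wInt, wInt, ← integral_add i1 i2, ← integral_div,
    ofReal_integral_eq_lintegral_ofReal i3 (Eventually.of_forall fun x => ?_)]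
  · refine lintegral_congr fun x => ?_
    rw [real_inner_eq_mul, real_inner_self_eq_norm_sq, sq (dt (j + 1) u t x)]
  · exact div_nonneg (add_nonneg (mul_nonneg (hS.pos_c x).le real_inner_self_nonneg)
      (mul_nonneg (hS.pos_b x).le real_inner_self_nonneg)) two_pos.le

/-- `∫ a⁻¹ (∂_t^j h)²` as a classical integral. -/
lemma srcE_eq (hS : Setting a b c q) (hu : IsSolution m a b c q R h u g) {j : ℕ} (hj : j ≤ m)
    {t : ℝ} (ht : 0 ≤ t) :
    Integrable (fun x => (dth h j t x) ^ 2 / a x) ∧ srcE a h j t = ∫ x, (dth h j t x) ^ 2 / a x := by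
  have i1 := (hu.coneCurve_srcL hS hj).integrable hS hS.continuous_inv_a (k := srcL h j) ht
  have e : (fun x => (a x)⁻¹ * inner ℝ (srcL h j t x) (srcL h j t x)) =ᵐ[volume]
      fun x => (dth h j t x) ^ 2 / a x := by
    filter_upwards [hu.coeFn_srcL hS hj ht] with x hx
    rw [hx, real_inner_eq_mul]
    ring
  exact ⟨i1.congr e, integral_congr_ae e⟩

lemma lintegral_Icc_ofReal {T₀ T : ℝ} (hT : T₀ ≤ T) {f : ℝ → ℝ} (hf : ContinuousOn f (Icc T₀ T))
    (h0 : ∀ t ∈ Icc T₀ T, 0 ≤ f t) :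
    ∫⁻ t in Icc T₀ T, ENNReal.ofReal (f t) = ENNReal.ofReal (∫ t in T₀..T, f t) := by
  rw [intervalIntegral.integral_of_le hT, ← integral_Icc_eq_integral_Ioc,
    ofReal_integral_eq_lintegral_ofReal hf.integrableOn_Icc]
  exact (ae_restrict_iff' measurableSet_Icc).2 (Eventually.of_forall h0)

lemma continuousOn_one_add_rpow {T₀ T : ℝ} (hT₀ : 0 ≤ T₀) (s : ℝ) :
    ContinuousOn (fun t => (1 + t) ^ s) (Icc T₀ T) := continuousOn_weight le_rfl hT₀ s

lemma sourceTerm_eq (hS : Setting a b c q)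
    (hu : IsSolution m a b c q R h u g) {j : ℕ} (hj : j ≤ m) (θ : ℝ) {T₀ T : ℝ} (hT₀ : 0 ≤ T₀)
    (hT : T₀ ≤ T) :
    sourceTerm a θ h j T₀ T = ENNReal.ofReal (∑ i ∈ Finset.range (j + 1),
      ∫ t in T₀..T, (1 + t) ^ (θ + 2 * i + 1) * srcE a h i t) := by
  have hlt : ∀ i ∈ Finset.range (j + 1), i ≤ m := fun i hi => by
    have := Finset.mem_range.1 hi; omega
  have hsub : Icc T₀ T ⊆ Ici 0 := fun t ht => hT₀.trans ht.1
  have hc : ∀ i ∈ Finset.range (j + 1), ContinuousOn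
      (fun t => (1 + t) ^ (θ + 2 * i + 1) * srcE a h i t) (Icc T₀ T) := fun i hi =>
    (continuousOn_one_add_rpow hT₀ _).mul ((continuousOn_srcE hS hu (hlt i hi)).mono hsub)
  have hpos : ∀ i : ℕ, ∀ t ∈ Icc T₀ T, 0 ≤ (1 + t) ^ (θ + 2 * i + 1) * srcE a h i t :=
    fun i t ht => mul_nonneg (Real.rpow_nonneg (by linarith [mem_Ici.1 (hsub ht)]) _)
      (hS.nonneg h (fun _ => (0 : L2 n)) (fun _ => (0 : L2Vec n)) i t).2.2.2
  rw [← intervalIntegral.integral_finsetSum fun i hi =>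
      (hc i hi).intervalIntegrable_of_Icc hT,
    ← lintegral_Icc_ofReal hT (continuousOn_finsetSum _ hc)
      (fun t ht => Finset.sum_nonneg fun i _ => hpos i t ht)]
  refine setLIntegral_congr_fun measurableSet_Icc fun t ht => ?_
  have ht0 : 0 ≤ t := hsub ht
  have h1t : (0 : ℝ) < 1 + t := by linarith
  have i1 : ∀ i ∈ Finset.range (j + 1), Integrable fun x =>
      (1 + t) ^ (θ + 2 * i + 1) * ((dth h i t x) ^ 2 / a x) := fun i hi =>
    (srcE_eq hS hu (hlt i hi) ht0).1.const_mul _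
  have e1 : ∑ i ∈ Finset.range (j + 1), (1 + t) ^ (θ + 2 * i + 1) * srcE a h i t =
      ∫ x, ∑ i ∈ Finset.range (j + 1), (1 + t) ^ (θ + 2 * i + 1) * ((dth h i t x) ^ 2 / a x) := by
    rw [integral_finsetSum _ i1]
    refine Finset.sum_congr rfl fun i hi => ?_
    rw [(srcE_eq hS hu (hlt i hi) ht0).2, integral_const_mul]
  rw [e1, ofReal_integral_eq_lintegral_ofReal (integrable_finsetSum _ i1)
    (Eventually.of_forall fun x => Finset.sum_nonneg fun i _ => ?_)]
  · refine lintegral_congr fun x => ?_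
    congr 1
    rw [Finset.mul_sum]
    refine Finset.sum_congr rfl fun i _ => ?_
    have : (1 + t) ^ (θ + 2 * i + 1) = (1 + t) ^ (θ + 1) * (1 + t) ^ (2 * i) := by
      rw [← Real.rpow_add_natCast h1t.ne']; congr 1; push_cast; ring
    rw [this]
    simp only [dth]
    ring
  · have := hS.pos_a x
    positivity

/-- Comparison of the right-hand side of the weighted estimates with its extended version. -/
lemma ofReal_levelR_le (hS : Setting a b c q) (hR : 0 < R) (hm : 1 ≤ m)
    (hu : IsSolution m a b c q R h u g) {j : ℕ} (hj : j ≤ m) {A θ T₀ T : ℝ} (hA : 1 ≤ A)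
    (hθ : 0 < θ) (hT₀ : 0 ≤ T₀) (hT : T₀ ≤ T) :
    ENNReal.ofReal (levelR a b c A θ T₀ h u g j T) ≤
      ENNReal.ofReal (2 * A ^ (θ + 2 * j + 1)) *
        ((∑ i ∈ Finset.range (j + 1), energy b c u g i T₀) +
        (∫⁻ t in Icc T₀ T, ENNReal.ofReal ((1 + t) ^ θ) * energy b c u g 0 t) +
        sourceTerm a θ h j T₀ T) := by
  have hsub : Icc T₀ T ⊆ Ici 0 := fun t ht => hT₀.trans ht.1
  have hlt : ∀ i ∈ Finset.range (j + 1), i ≤ m := fun i hi => by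
    have := Finset.mem_range.1 hi; omega
  have hn := hS.nonneg h u g
  have ck := (continuousOn_kin hS hR hm hu hS.smooth_c.continuous (Nat.zero_le _)).mono hsub
  have cp := (continuousOn_pot hS hR hm hu (Nat.zero_le _)).mono hsub
  have ce : ContinuousOn (fun t => (1 + t) ^ θ * ((kin c u 0 t + pot b g 0 t) / 2)) (Icc T₀ T) :=
    (continuousOn_one_add_rpow hT₀ θ).mul ((ck.add cp).div_const 2)
  have pe : ∀ i t, 0 ≤ (kin c u i t + pot b g i t) / 2 := fun i t =>
    div_nonneg (add_nonneg (hn i t).1 (hn i t).2.1) two_pos.le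
  have p1 : ∀ t ∈ Icc T₀ T, ∀ s : ℝ, 0 ≤ (1 + t) ^ s := fun t ht s =>
    Real.rpow_nonneg (by linarith [mem_Ici.1 (hsub ht)]) s
  have E1 : ∑ i ∈ Finset.range (j + 1), energy b c u g i T₀ =
      ENNReal.ofReal (∑ i ∈ Finset.range (j + 1), (kin c u i T₀ + pot b g i T₀) / 2) := by
    rw [ENNReal.ofReal_sum_of_nonneg fun i _ => pe i T₀]
    exact Finset.sum_congr rfl fun i hi => energy_eq hS hR hm hu (hlt i hi) hT₀
  have E2 : ∫⁻ t in Icc T₀ T, ENNReal.ofReal ((1 + t) ^ θ) * energy b c u g 0 t =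
      ENNReal.ofReal (∫ t in T₀..T, (1 + t) ^ θ * ((kin c u 0 t + pot b g 0 t) / 2)) := by
    rw [← lintegral_Icc_ofReal hT ce fun t ht => mul_nonneg (p1 t ht θ) (pe 0 t)]
    refine setLIntegral_congr_fun measurableSet_Icc fun t ht => ?_
    rw [energy_eq hS hR hm hu (Nat.zero_le _) (hsub ht), ENNReal.ofReal_mul (p1 t ht θ)]
  have N1 : 0 ≤ ∑ i ∈ Finset.range (j + 1), (kin c u i T₀ + pot b g i T₀) / 2 :=
    Finset.sum_nonneg fun i _ => pe i T₀
  have N2 : 0 ≤ ∫ t in T₀..T, (1 + t) ^ θ * ((kin c u 0 t + pot b g 0 t) / 2) :=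
    intervalIntegral.integral_nonneg hT fun t ht => mul_nonneg (p1 t ht θ) (pe 0 t)
  have N3 : 0 ≤ ∑ i ∈ Finset.range (j + 1),
      ∫ t in T₀..T, (1 + t) ^ (θ + 2 * i + 1) * srcE a h i t :=
    Finset.sum_nonneg fun i _ => intervalIntegral.integral_nonneg hT fun t ht =>
      mul_nonneg (p1 t ht _) (hn i t).2.2.2
  rw [E1, E2, sourceTerm_eq hS hu hj θ hT₀ hT, ← ENNReal.ofReal_add N1 N2,
    ← ENNReal.ofReal_add (add_nonneg N1 N2) N3, ← ENNReal.ofReal_mul (by positivity)]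
  refine ENNReal.ofReal_le_ofReal ?_
  set Q := A ^ (θ + 2 * j + 1)
  have hj0 : (0 : ℝ) ≤ j := Nat.cast_nonneg j
  have hQ : 1 ≤ Q := Real.one_le_rpow hA (by positivity)
  have hpow : ∀ s, 0 ≤ s → s ≤ θ + 2 * j + 1 → ∀ t ∈ Icc T₀ T,
      (A + t) ^ s ≤ Q * (1 + t) ^ s := by
    intro s hs hs' t ht
    have ht0 : 0 ≤ t := hsub ht
    have : A + t ≤ A * (1 + t) := by nlinarith
    calc (A + t) ^ s ≤ (A * (1 + t)) ^ s := Real.rpow_le_rpow (by linarith) this hs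
      _ = A ^ s * (1 + t) ^ s := Real.mul_rpow (by linarith) (by linarith)
      _ ≤ _ := mul_le_mul_of_nonneg_right (Real.rpow_le_rpow_of_exponent_le hA hs') (p1 t ht s)
  have B1 : ∑ i ∈ Finset.range (j + 1), (kin c u i T₀ + pot b g i T₀) ≤
      2 * Q * ∑ i ∈ Finset.range (j + 1), (kin c u i T₀ + pot b g i T₀) / 2 := by
    rw [← Finset.sum_div]
    rw [← Finset.sum_div] at N1
    nlinarith
  have B2 : ∫ t in T₀..T, (A + t) ^ θ * (kin c u 0 t + pot b g 0 t) ≤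
      2 * Q * ∫ t in T₀..T, (1 + t) ^ θ * ((kin c u 0 t + pot b g 0 t) / 2) := by
    rw [← intervalIntegral.integral_const_mul]
    refine intervalIntegral.integral_mono_on hT
      (((continuousOn_weight hA hT₀ θ).mul (ck.add cp)).intervalIntegrable_of_Icc hT)
      ((continuousOn_const.mul ce).intervalIntegrable_of_Icc hT) fun t ht => ?_
    have := mul_le_mul_of_nonneg_right (hpow θ hθ.le (by linarith) t ht) (pe 0 t)
    linarith
  have B3 : ∑ i ∈ Finset.range (j + 1),
      (∫ t in T₀..T, (A + t) ^ (θ + 2 * i + 1) * srcE a h i t) ≤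
      2 * Q * ∑ i ∈ Finset.range (j + 1),
      ∫ t in T₀..T, (1 + t) ^ (θ + 2 * i + 1) * srcE a h i t := by
    rw [Finset.mul_sum]
    refine Finset.sum_le_sum fun i hi => ?_
    rw [← intervalIntegral.integral_const_mul]
    have ci := (continuousOn_srcE hS hu (hlt i hi)).mono hsub
    refine intervalIntegral.integral_mono_on hT
      (((continuousOn_weight hA hT₀ _).mul ci).intervalIntegrable_of_Icc hT)
      ((continuousOn_const.mul ((continuousOn_one_add_rpow hT₀ _).mul ci)).intervalIntegrable_of_Icc
        hT) fun t ht => ?_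
    have hij : (i : ℝ) ≤ j := by exact_mod_cast (by have := Finset.mem_range.1 hi; omega : i ≤ j)
    have hi0 : (0 : ℝ) ≤ i := Nat.cast_nonneg i
    have h1 := mul_le_mul_of_nonneg_right
      (hpow (θ + 2 * i + 1) (by positivity) (by linarith) t ht) (hn i t).2.2.2
    have h2 : 0 ≤ Q * ((1 + t) ^ (θ + 2 * i + 1) * srcE a h i t) :=
      mul_nonneg (by linarith) (mul_nonneg (p1 t ht _) (hn i t).2.2.2)
    linarith
  unfold levelR
  linarith

end

/-! ### The operator `M` in the sense of distributions -/

section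

variable {n : ℕ} {a b c : Sp n → ℝ}

lemma divergence_smul {f : Sp n → ℝ} {V : Sp n → Sp n} {x : Sp n} (hf : DifferentiableAt ℝ f x)
    (hV : ∀ i, DifferentiableAt ℝ (fun y => V y i) x) :
    divergence (fun y => f y • V y) x = f x * divergence V x + inner ℝ (∇ f x) (V x) := by
  have h1 : ∀ i, fderiv ℝ (fun y => (f y • V y) i) x (EuclideanSpace.single i 1) =
      f x * fderiv ℝ (fun y => V y i) x (EuclideanSpace.single i 1) + pd i f x * V x i := fun i =>
    (pd_mul hf (hV i) i).trans (by rw [mul_comm (pd i f x)]; rfl)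
  rw [divergence, Finset.sum_congr rfl fun i _ => h1 i, Finset.sum_add_distrib, ← Finset.mul_sum,
    inner_eq_sum]
  simp only [gradient_apply]
  rfl

lemma smul_gradient_apply (b φ : Sp n → ℝ) (i : Fin n) :
    (fun y => (b y • ∇ φ y) i) = fun y => b y * pd i φ y := funext fun y => by
  rw [← gradient_apply]
  rfl

lemma divGrad_eq_sum (b φ : Sp n → ℝ) (x : Sp n) :
    divGrad b φ x = ∑ i, pd i (fun y => b y * pd i φ y) x := by
  rw [divGrad, divergence]
  refine Finset.sum_congr rfl fun i _ => ?_
  rw [smul_gradient_apply]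
  rfl

lemma continuous_divGrad {φ : Sp n → ℝ} (hb : ContDiff ℝ ∞ b) (hφ : ContDiff ℝ 2 φ) :
    Continuous (divGrad b φ) := by
  have : divGrad b φ = fun x => ∑ i, pd i (fun y => b y * pd i φ y) x :=
    funext (divGrad_eq_sum b φ)
  rw [this]
  refine continuous_finsetSum _ fun i _ => continuous_pd ?_ i
  exact (hb.of_le (by exact_mod_cast le_top)).mul (contDiff_pd hφ (by norm_num) i)

lemma hasCompactSupport_divGrad {φ : Sp n → ℝ} (hφ : HasCompactSupport φ) :
    HasCompactSupport (divGrad b φ) := by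
  have h1 : divGrad b φ = fun x => ∑ i, pd i (fun y => b y * pd i φ y) x :=
    funext (divGrad_eq_sum b φ)
  refine HasCompactSupport.intro hφ fun x hx => ?_
  rw [h1]
  refine Finset.sum_eq_zero fun i _ => ?_
  by_contra hne
  have h2 := subset_closure.trans
    (closure_minimal (fun y hy => ?_) (isClosed_tsupport φ)) (Function.mem_support.2 hne)
  · exact hx h2
  · have h3 : y ∈ tsupport (fun y => b y * pd i φ y) :=
      support_fderiv_subset ℝ (fun h0 => hy (by rw [pd, h0]; rfl))
    refine closure_minimal ?_ (isClosed_tsupport φ) h3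
    intro z hz
    exact support_fderiv_subset ℝ (fun h0 => hz (by simp [pd, h0]))

/-- The product rule `div (b ∇ (m φ)) = m div (b ∇ φ) + 2 b ⟨∇ m, ∇ φ⟩ + φ div (b ∇ m)`. -/
lemma divGrad_mul {m φ : Sp n → ℝ} (hb : ContDiff ℝ ∞ b) (hm : ContDiff ℝ ∞ m)
    (hφ : ContDiff ℝ ∞ φ) (x : Sp n) :
    divGrad b (fun y => m y * φ y) x =
      m x * divGrad b φ x + 2 * (b x * inner ℝ (∇ m x) (∇ φ x)) + φ x * divGrad b m x := by
  have hd : ∀ {f : Sp n → ℝ}, ContDiff ℝ ∞ f → ∀ y, DifferentiableAt ℝ f y := fun hf y =>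
    hf.differentiable (by simp) y
  have hpd : ∀ {f : Sp n → ℝ}, ContDiff ℝ ∞ f → ∀ i, ContDiff ℝ ∞ (pd i f) := fun hf i =>
    contDiff_pd hf (by simp) i
  have h1 : ∀ i, pd i (fun y => b y * pd i (fun z => m z * φ z) y) x =
      m x * pd i (fun y => b y * pd i φ y) x + 2 * (b x * (pd i m x * pd i φ x)) +
        φ x * pd i (fun y => b y * pd i m y) x := by
    intro i
    have e : (fun y => b y * pd i (fun z => m z * φ z) y) =
        fun y => m y * (b y * pd i φ y) + φ y * (b y * pd i m y) := funext fun y => by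
      rw [pd_mul (hd hm y) (hd hφ y) i]; ring
    have d1 := hd (hb.mul (hpd hφ i)) x
    have d2 := hd (hb.mul (hpd hm i)) x
    have e2 : pd i (fun y => m y * (b y * pd i φ y) + φ y * (b y * pd i m y)) x =
        pd i (fun y => m y * (b y * pd i φ y)) x + pd i (fun y => φ y * (b y * pd i m y)) x := by
      have := fderiv_add (𝕜 := ℝ) ((hd hm x).mul d1) ((hd hφ x).mul d2)
      exact congrArg (fun L => L (EuclideanSpace.single i 1)) this
    rw [e, e2, pd_mul (hd hm x) d1 i, pd_mul (hd hφ x) d2 i]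
    ring
  rw [divGrad_eq_sum, divGrad_eq_sum, divGrad_eq_sum, Finset.sum_congr rfl fun i _ => h1 i,
    Finset.sum_add_distrib, Finset.sum_add_distrib, ← Finset.mul_sum, ← Finset.mul_sum,
    ← Finset.mul_sum, ← Finset.mul_sum, inner_eq_sum]
  simp only [gradient_apply]

/-- Integration by parts against a weakly differentiable function. -/
lemma integral_mul_divergence {v : L2 n} {w : L2Vec n} (hv : IsWeakGradient v w)
    {V : Sp n → Sp n} (hV : ∀ i, IsTest fun y => V y i) :
    Integrable (fun x => v x * divergence V x) ∧
      ∫ x, v x * divergence V x = - ∫ x, inner ℝ (w x) (V x) := by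
  have i1 : ∀ i ∈ Finset.univ, Integrable fun x => pd i (fun y => V y i) x * v x := fun i _ =>
    integrable_cc_mul ((hV i).pd i).continuous ((hV i).pd i).2 v
  have i2 : ∀ i ∈ Finset.univ, Integrable fun x => V x i * compL i w x := fun i _ =>
    integrable_cc_mul (hV i).continuous (hV i).2 _
  have e1 : (fun x => v x * divergence V x) = fun x => ∑ i, pd i (fun y => V y i) x * v x :=
    funext fun x => by rw [divergence, Finset.mul_sum]; simp only [mul_comm (v x)]; rfl
  have e2 : (fun x => inner ℝ (w x) (V x)) =ᵐ[volume] fun x => ∑ i, V x i * compL i w x := by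
    have : ∀ᵐ x, ∀ i, compL i w x = w x i := ae_all_iff.2 fun i => coeFn_compL i w
    filter_upwards [this] with x hx
    rw [inner_eq_sum]
    exact Finset.sum_congr rfl fun i _ => by rw [hx i, mul_comm]
  rw [e1, integral_congr_ae e2]
  refine ⟨integrable_finsetSum _ i1, ?_⟩
  rw [integral_finsetSum _ i1, integral_finsetSum _ i2, ← Finset.sum_neg_distrib]
  exact Finset.sum_congr rfl fun i _ => isWeakGradient_iff.1 hv _ (hV i) i

lemma isTest_smul_gradient (hb : ContDiff ℝ ∞ b) {φ : Sp n → ℝ} (hφ : IsTest φ) (i : Fin n) :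
    IsTest fun y => (b y • ∇ φ y) i := by
  rw [smul_gradient_apply]
  exact (hφ.pd i).mul_left hb

lemma integrable_mul_of_locallyIntegrable {f ψ : Sp n → ℝ} (hf : LocallyIntegrable f)
    (hψ : Continuous ψ) (hs : HasCompactSupport ψ) : Integrable fun x => f x * ψ x :=
  hf.integrable_smul_right_of_hasCompactSupport hψ hs

lemma IsTest.two {φ : Sp n → ℝ} (hφ : IsTest φ) : ContDiff ℝ 2 φ :=
  contDiff_infty.1 hφ.1 2

lemma integrable_mul_divGrad (hb : ContDiff ℝ ∞ b) {f φ : Sp n → ℝ} (hf : LocallyIntegrable f)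
    (hφ : IsTest φ) : Integrable fun x => f x * divGrad b φ x :=
  integrable_mul_of_locallyIntegrable hf (continuous_divGrad hb hφ.two)
    (hasCompactSupport_divGrad hφ.2)

lemma integrable_weight_mul (ha : Continuous a) {w φ : Sp n → ℝ} (hw : LocallyIntegrable w)
    (hφ : IsTest φ) : Integrable fun x => a x * w x * φ x := by
  refine (integrable_mul_of_locallyIntegrable hw (ha.mul hφ.continuous) hφ.2.mul_left).congr
    (Eventually.of_forall fun x => ?_)
  simp only [Pi.mul_apply]
  ring

lemma IsWeakM.add (ha : Continuous a) (hb : ContDiff ℝ ∞ b) {f₁ f₂ w₁ w₂ : Sp n → ℝ}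
    (h₁ : IsWeakM a b f₁ w₁) (h₂ : IsWeakM a b f₂ w₂) :
    IsWeakM a b (fun x => f₁ x + f₂ x) (fun x => w₁ x + w₂ x) := by
  refine ⟨h₁.1.add h₂.1, h₁.2.1.add h₂.2.1, fun φ hφ => ?_⟩
  simp only [add_mul, mul_add]
  rw [integral_add (integrable_mul_divGrad hb h₁.1 hφ) (integrable_mul_divGrad hb h₂.1 hφ),
    integral_add (integrable_weight_mul ha h₁.2.1 hφ) (integrable_weight_mul ha h₂.2.1 hφ),
    h₁.2.2 φ hφ, h₂.2.2 φ hφ]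

lemma IsWeakM.sub (ha : Continuous a) (hb : ContDiff ℝ ∞ b) {f₁ f₂ w₁ w₂ : Sp n → ℝ}
    (h₁ : IsWeakM a b f₁ w₁) (h₂ : IsWeakM a b f₂ w₂) :
    IsWeakM a b (fun x => f₁ x - f₂ x) (fun x => w₁ x - w₂ x) := by
  refine ⟨h₁.1.sub h₂.1, h₁.2.1.sub h₂.2.1, fun φ hφ => ?_⟩
  simp only [sub_mul, mul_sub]
  rw [integral_sub (integrable_mul_divGrad hb h₁.1 hφ) (integrable_mul_divGrad hb h₂.1 hφ),
    integral_sub (integrable_weight_mul ha h₁.2.1 hφ) (integrable_weight_mul ha h₂.2.1 hφ),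
    h₁.2.2 φ hφ, h₂.2.2 φ hφ]

/-- The classical operator agrees with the weak one on `C²` functions. -/
lemma isWeakM_opM (ha : Continuous a) (ha' : ∀ x, 0 < a x) (hb : ContDiff ℝ ∞ b) {s : Sp n → ℝ}
    (hs : ContDiff ℝ 2 s) : IsWeakM a b s (opM a b s) := by
  have hcont : Continuous (opM a b s) :=
    (ha.inv₀ fun x => (ha' x).ne').mul (continuous_divGrad hb hs)
  refine ⟨hs.continuous.locallyIntegrable, hcont.locallyIntegrable, fun φ hφ => ?_⟩
  have hb1 : ContDiff ℝ 1 b := hb.of_le (by exact_mod_cast le_top)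
  have hs1 : ContDiff ℝ 1 s := hs.of_le (by norm_num)
  have t1 : ∀ i, IsTest fun y => b y * pd i φ y := fun i => (hφ.pd i).mul_left hb
  have t2 : ∀ i, ContDiff ℝ 1 fun y => b y * pd i s y := fun i =>
    hb1.mul (contDiff_pd hs (by norm_num) i)
  have e1 : (fun x => s x * divGrad b φ x) =
      fun x => ∑ i, pd i (fun y => b y * pd i φ y) x * s x :=
    funext fun x => by rw [divGrad_eq_sum, Finset.mul_sum]; simp only [mul_comm (s x)]
  have e2 : (fun x => a x * opM a b s x * φ x) =
      fun x => ∑ i, φ x * pd i (fun y => b y * pd i s y) x := funext fun x => by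
    rw [opM, mul_inv_cancel_left₀ (ha' x).ne', divGrad_eq_sum, mul_comm, Finset.mul_sum]
  have i1 : ∀ i ∈ Finset.univ, Integrable fun x => pd i (fun y => b y * pd i φ y) x * s x :=
    fun i _ => ((continuous_pd (t1 i).one i).mul hs.continuous).integrable_of_hasCompactSupport
      (hasCompactSupport_pd (t1 i).2 i).mul_right
  have i2 : ∀ i ∈ Finset.univ, Integrable fun x => φ x * pd i (fun y => b y * pd i s y) x :=
    fun i _ => (hφ.continuous.mul (continuous_pd (t2 i) i)).integrable_of_hasCompactSupport
      hφ.2.mul_right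
  rw [e1, e2, integral_finsetSum _ i1, integral_finsetSum _ i2]
  refine Finset.sum_congr rfl fun i _ => ?_
  have h1 := integral_pd_mul (t1 i).one (t1 i).2 hs1 i
  have h2 := integral_pd_mul hφ.one hφ.2 (t2 i) i
  rw [h1, ← neg_eq_iff_eq_neg.2 h2, neg_inj]
  refine integral_congr_ae (Eventually.of_forall fun x => ?_)
  simp only
  ring

/-- The product rule for the weak operator `M`. -/
lemma IsWeakM.smooth_mul (ha : Continuous a) (ha' : ∀ x, 0 < a x) (hb : ContDiff ℝ ∞ b)
    {v : L2 n} {k : L2Vec n} {W : Sp n → ℝ} (hv : IsWeakGradient v k) (hM : IsWeakM a b v W)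
    {m : Sp n → ℝ} (hm : ContDiff ℝ ∞ m) :
    IsWeakM a b (fun x => m x * v x) (fun x => m x * W x +
      2 * (b x / a x * inner ℝ (k x) (∇ m x)) + v x * opM a b m x) := by
  have hm1 : ContDiff ℝ 1 m := hm.of_le (by exact_mod_cast le_top)
  have hm2 : ContDiff ℝ 2 m := contDiff_infty.1 hm 2
  have hmc := hm.continuous
  have hbc := hb.continuous
  have cM : Continuous (opM a b m) :=
    (ha.inv₀ fun x => (ha' x).ne').mul (continuous_divGrad hb hm2)
  have l1 : LocallyIntegrable fun x => m x * W x := hM.2.1.continuous_smul hmc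
  have l2 : LocL2 fun x => 2 * (b x / a x * inner ℝ (k x) (∇ m x)) :=
    (((locL2_lp k).inner_continuous (continuous_gradient hm1)).continuous_mul
      (hbc.div ha fun x => (ha' x).ne')).continuous_mul continuous_const
  have l3 : LocL2 fun x => v x * opM a b m x := by
    simpa only [mul_comm] using (locL2_lp v).continuous_mul cM
  refine ⟨((locL2_lp v).continuous_mul hmc).locallyIntegrable,
    (l1.add l2.locallyIntegrable).add l3.locallyIntegrable, fun φ hφ => ?_⟩
  have hmφ : IsTest fun y => m y * φ y := hφ.mul_left hm
  -- The test function `m φ` for `M v` produces, besides `m div (b ∇ φ)`, the terms of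
  -- `2 div (φ b ∇ m) - φ div (b ∇ m)`.
  set Y : Sp n → Sp n := fun y => φ y • (b y • ∇ m y) with hY
  have hcomp : ∀ i, ContDiff ℝ ∞ fun y => (b y • ∇ m y) i := fun i => by
    rw [smul_gradient_apply]
    exact hb.mul (contDiff_pd hm (by simp) i)
  have hYt : ∀ i, IsTest fun y => Y y i := fun i => by
    have e : (fun y => Y y i) = fun y => (b y • ∇ m y) i * φ y :=
      funext fun y => mul_comm (φ y) _
    rw [e]
    exact hφ.mul_left (hcomp i)
  have hdiv : ∀ x, divergence Y x = φ x * divGrad b m x + b x * inner ℝ (∇ m x) (∇ φ x) := by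
    intro x
    rw [hY, divergence_smul (hφ.one.differentiable (by norm_num) x)
      fun i => (hcomp i).differentiable (by simp) x, real_inner_smul_right, real_inner_comm]
    rfl
  obtain ⟨j1, j2⟩ := integral_mul_divergence hv hYt
  have j3 : Integrable fun x => inner ℝ (k x) (Y x) :=
    (locL2_lp k).integrable_inner (hφ.continuous.smul (hbc.smul (continuous_gradient hm1)))
      hφ.2.smul_right
  have j4 := integrable_mul_divGrad hb hM.1 hmφ
  have j5 : Integrable fun x => a x * W x * (m x * φ x) := integrable_weight_mul ha hM.2.1 hmφ
  have j6 : Integrable fun x => a x * (v x * opM a b m x) * φ x :=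
    integrable_weight_mul ha l3.locallyIntegrable hφ
  calc ∫ x, m x * v x * divGrad b φ x
      = ∫ x, (v x * divGrad b (fun y => m y * φ y) x - 2 * (v x * divergence Y x) +
          a x * (v x * opM a b m x) * φ x) := by
        refine integral_congr_ae (Eventually.of_forall fun x => ?_)
        have h2 : a x * (v x * opM a b m x) * φ x = v x * (φ x * divGrad b m x) := by
          rw [opM]
          have := (ha' x).ne'
          field_simp
        simp only
        rw [divGrad_mul hb hm hφ.1, hdiv, h2]
        ring
    _ = ∫ x, (a x * W x * (m x * φ x) + 2 * inner ℝ (k x) (Y x) +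
          a x * (v x * opM a b m x) * φ x) := by
        have e1 := integral_add (j4.sub (j1.const_mul 2)) j6
        have e2 := integral_sub j4 (j1.const_mul 2)
        have e3 := integral_add (j5.add (j3.const_mul 2)) j6
        have e4 := integral_add j5 (j3.const_mul 2)
        simp only [Pi.add_apply, Pi.sub_apply] at e1 e2 e3 e4
        rw [e1, e2, e3, e4, integral_const_mul, integral_const_mul, j2, hM.2.2 _ hmφ]
        ring
    _ = _ := by
        refine integral_congr_ae (Eventually.of_forall fun x => ?_)
        have := (ha' x).ne'
        simp only [hY, real_inner_smul_right]
        field_simp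

/-- The operator `M` is local. -/
lemma IsWeakM.eq_zero_of_isOpen (ha : Continuous a) (ha' : ∀ x, 0 < a x) {f w : Sp n → ℝ}
    (hM : IsWeakM a b f w) {U : Set (Sp n)} (hU : IsOpen U) (h0 : ∀ᵐ x, x ∈ U → f x = 0) :
    ∀ᵐ x, x ∈ U → w x = 0 := by
  have h1 : LocallyIntegrable fun x => a x * w x := hM.2.1.continuous_smul ha
  have h2 := hU.ae_eq_zero_of_integral_contDiff_smul_eq_zero (h1.locallyIntegrableOn U) ?_
  · filter_upwards [h2] with x hx hxU
    exact (mul_eq_zero.1 (hx hxU)).resolve_left (ha' x).ne'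
  · intro φ hφ hs hsU
    have h3 := hM.2.2 φ ⟨hφ, hs⟩
    have h4 : ∫ x, f x * divGrad b φ x = 0 := by
      refine integral_eq_zero_of_ae ?_
      filter_upwards [h0] with x hx
      by_cases hxU : x ∈ U
      · simp [hx hxU]
      · have : divGrad b φ x = 0 := by
          rw [divGrad_eq_sum]
          have hev : φ =ᶠ[𝓝 x] fun _ => 0 :=
            notMem_tsupport_iff_eventuallyEq.1 fun h => hxU (hsU h)
          refine Finset.sum_eq_zero fun i _ => ?_
          have hev2 : (fun y => b y * pd i φ y) =ᶠ[𝓝 x] fun _ => 0 := by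
            filter_upwards [hev.eventuallyEq_nhds] with y hy
            rw [pd, hy.fderiv_eq]
            simp
          rw [pd, hev2.fderiv_eq]
          simp
        simp [this]
    rw [h4] at h3
    rw [h3]
    refine integral_congr_ae (Eventually.of_forall fun x => ?_)
    simp only [smul_eq_mul]
    ring

/-- Outside of the support of `f`, also `M² f` vanishes. -/
lemma IsWeakM.eq_zero_of_notMem_essSupport (ha : Continuous a) (ha' : ∀ x, 0 < a x)
    {f w w' : Sp n → ℝ} (hM : IsWeakM a b f w) (hM' : IsWeakM a b w w') :
    ∀ᵐ x, x ∉ essSupport f → w' x = 0 := by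
  have : volume {x | ¬ (x ∉ essSupport f → w' x = 0)} = 0 := by
    refine measure_null_of_locally_null _ fun x hx => ?_
    simp only [mem_ofPred_eq, Classical.not_imp, essSupport, not_not] at hx
    obtain ⟨⟨U, hU, h0⟩, -⟩ := hx
    have h1 := hM'.eq_zero_of_isOpen ha ha' isOpen_interior
      (hM.eq_zero_of_isOpen ha ha' isOpen_interior
        (h0.mono fun y hy hyU => hy (interior_subset hyU)))
    refine ⟨interior U ∩ {x | ¬ (x ∉ essSupport f → w' x = 0)}, ?_, ?_⟩
    · exact inter_mem (mem_nhdsWithin_of_mem_nhds (interior_mem_nhds.2 hU)) self_mem_nhdsWithin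
    · refine measure_mono_null (fun y hy => ?_) h1
      simp only [mem_inter_iff, mem_ofPred_eq, Classical.not_imp] at hy
      simp only [mem_compl_iff, mem_ofPred_eq, Classical.not_imp]
      exact ⟨hy.1, hy.2.2⟩
  exact this

end

/-! ### `M u` and `M² u` for a solution -/

section

variable {n : ℕ} {a b c : Sp n → ℝ} {q : ℝ → ℝ} {R : ℝ} {m : ℕ} {h : ℝ → Sp n → ℝ}
  {u : ℝ → L2 n} {g : ℝ → L2Vec n}

/-- The value of `M ∂_t^j u` prescribed by the equation:
`(c / a) ∂_t^{j+2} u + ∂_t^{j+1} u - ∂_t^j h / a`. -/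
def spatialM (a c : Sp n → ℝ) (h : ℝ → Sp n → ℝ) (u : ℝ → L2 n) (j : ℕ) (t : ℝ) (x : Sp n) : ℝ :=
  c x / a x * dt (j + 2) u t x + dt (j + 1) u t x - dth h j t x / a x

lemma Setting.contDiff_ratio (hS : Setting a b c q) : ContDiff ℝ ∞ fun x => c x / a x :=
  hS.smooth_c.div hS.smooth_a fun x => (hS.pos_a x).ne'

lemma IsSolution.locL2_spatialM (hS : Setting a b c q)
    (hu : IsSolution m a b c q R h u g) {j : ℕ} (hj : j ≤ m) {t : ℝ} (ht : 0 ≤ t) :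
    LocL2 (spatialM a c h u j t) :=
  (((locL2_lp _).continuous_mul hS.contDiff_ratio.continuous).add (locL2_lp _)).sub
    (locL2_of_continuous ((hu.continuous_dth hj ht).div hS.smooth_a.continuous
      fun x => (hS.pos_a x).ne'))

/-- The equation, as an identity for the weak operator `M`. -/
lemma IsSolution.isWeakM_dt (hS : Setting a b c q)
    (hu : IsSolution m a b c q R h u g) {j : ℕ} (hj : j + 1 ≤ m) {t : ℝ} (ht : 0 ≤ t) :
    IsWeakM a b (dt j u t : L2 n) (spatialM a c h u j t) := by
  have hW := hu.locL2_spatialM hS (by omega : j ≤ m) ht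
  refine ⟨(locL2_lp _).locallyIntegrable, hW.locallyIntegrable, fun φ hφ => ?_⟩
  have hbc := hS.smooth_b.continuous
  have e1 := (integral_mul_divergence (hu.weakGradient_dt (by omega : j ≤ m) ht)
    (isTest_smul_gradient hS.smooth_b hφ)).2
  have i1 := integrable_weight_mul hS.smooth_a.continuous hW.locallyIntegrable hφ
  have i2 : Integrable fun x => inner ℝ (b x • dt j g t x) (∇ φ x) :=
    ((locL2_lp (dt j g t)).continuous_smul hbc).integrable_inner
      (continuous_gradient hφ.one) (hasCompactSupport_gradient hφ.2)
  have e2 := hu.equation_dt hS hj ht hφ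
  have e3 : (fun x => (c x * dt (j + 2) u t x + a x * dt (j + 1) u t x - dth h j t x) * φ x +
      inner ℝ (b x • dt j g t x) (∇ φ x)) = fun x => a x * spatialM a c h u j t x * φ x +
      inner ℝ (b x • dt j g t x) (∇ φ x) := funext fun x => by
    have := (hS.pos_a x).ne'
    congr 1
    rw [spatialM]
    field_simp
  rw [e3, integral_add i1 i2] at e2
  have e4 : ∫ x, inner ℝ (b x • dt j g t x) (∇ φ x) =
      ∫ x, inner ℝ (dt j g t x) (b x • ∇ φ x) := by
    simp only [real_inner_smul_left, real_inner_smul_right]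
  calc ∫ x, dt j u t x * divGrad b φ x = - ∫ x, inner ℝ (dt j g t x) (b x • ∇ φ x) := e1
    _ = _ := by rw [← e4]; linarith

/-- The value of `M² u`, computed from `M u = (c / a) u_tt + u_t - h / a` by the product rule. -/
def spatialMM (a b c : Sp n → ℝ) (h : ℝ → Sp n → ℝ) (u : ℝ → L2 n) (g : ℝ → L2Vec n) (t : ℝ)
    (x : Sp n) : ℝ :=
  (c x / a x * spatialM a c h u 2 t x +
    2 * (b x / a x * inner ℝ (dt 2 g t x) (∇ (fun y => c y / a y) x)) +
    dt 2 u t x * opM a b (fun y => c y / a y) x) + spatialM a c h u 1 t x -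
    opM a b (fun y => h t y / a y) x

lemma IsSolution.isWeakM_zero (hS : Setting a b c q) (hm : 1 ≤ m)
    (hu : IsSolution m a b c q R h u g) {t : ℝ} (ht : 0 ≤ t) :
    IsWeakM a b (u t) (spatialM a c h u 0 t) := by
  have := hu.isWeakM_dt hS (j := 0) hm ht
  rwa [dt_zero] at this

lemma IsSolution.isWeakM_spatialM (hS : Setting a b c q)
    (hm : 3 ≤ m) (hu : IsSolution m a b c q R h u g) {t : ℝ} (ht : 0 ≤ t) :
    IsWeakM a b (spatialM a c h u 0 t) (spatialMM a b c h u g t) := by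
  have ca := hS.smooth_a.continuous
  have h1 := (hu.isWeakM_dt hS (j := 2) hm ht).smooth_mul ca hS.pos_a hS.smooth_b
    (hu.weakGradient_dt (by omega : 2 ≤ m) ht) hS.contDiff_ratio
  have h2 := hu.isWeakM_dt hS (j := 1) (by omega) ht
  have hs : ContDiff ℝ 2 fun y => h t y / a y := by
    refine ContDiff.div ?_ (contDiff_infty.1 hS.smooth_a 2) fun x => (hS.pos_a x).ne'
    exact (contDiff_space hu.contDiffOn_source ht).of_le (by exact_mod_cast (by omega : 2 ≤ m))
  have h3 := isWeakM_opM ca hS.pos_a hS.smooth_b hs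
  have h4 := (h1.add ca hS.smooth_b h2).sub ca hS.smooth_b h3
  have e : spatialM a c h u 0 t = fun x => c x / a x * dt 2 u t x + dt 1 u t x - h t x / a x :=
    funext fun x => by rw [spatialM, dth_zero]
  rw [e]
  exact h4

/-! ### Bounds for the weighted norms of `M u` and `M² u` -/

/-- The function `f` is integrable with integral `I`. -/
def HasInt (f : Sp n → ℝ) (I : ℝ) : Prop := Integrable f ∧ ∫ x, f x = I

lemma HasInt.add {f f' : Sp n → ℝ} {I I' : ℝ} (hf : HasInt f I) (hf' : HasInt f' I') :
    HasInt (fun x => f x + f' x) (I + I') :=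
  ⟨hf.1.add hf'.1, by rw [integral_add hf.1 hf'.1, hf.2, hf'.2]⟩

lemma HasInt.const_mul {f : Sp n → ℝ} {I : ℝ} (hf : HasInt f I) (r : ℝ) :
    HasInt (fun x => r * f x) (r * I) :=
  ⟨hf.1.const_mul r, by rw [integral_const_mul, hf.2]⟩

lemma HasInt.lintegral_eq {f : Sp n → ℝ} {I : ℝ} (hf : HasInt f I) (h0 : ∀ x, 0 ≤ f x) :
    ∫⁻ x, ENNReal.ofReal (f x) = ENNReal.ofReal I := by
  rw [← hf.2, ofReal_integral_eq_lintegral_ofReal hf.1 (Eventually.of_forall h0)]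

lemma hasInt_kin (hS : Setting a b c q) (hR : 0 < R) (hm : 1 ≤ m)
    (hu : IsSolution m a b c q R h u g) {j : ℕ} (hj : j ≤ m) {t : ℝ} (ht : 0 ≤ t) :
    HasInt (fun x => a x * dt (j + 1) u t x ^ 2) (kin a u j t) := by
  have i1 := (hu.coneCurve_u hS hR hm hj).integrable hS hS.smooth_a.continuous
    (k := dt (j + 1) u) ht
  have e : (fun x => a x * inner ℝ (dt (j + 1) u t x) (dt (j + 1) u t x)) =
      fun x => a x * dt (j + 1) u t x ^ 2 := funext fun x => by rw [real_inner_eq_mul, sq]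
  rw [← e]
  exact ⟨i1, rfl⟩

lemma hasInt_pot (hS : Setting a b c q) (hR : 0 < R) (hm : 1 ≤ m)
    (hu : IsSolution m a b c q R h u g) {j : ℕ} (hj : j ≤ m) {t : ℝ} (ht : 0 ≤ t) :
    HasInt (fun x => b x * ‖dt j g t x‖ ^ 2) (pot b g j t) := by
  have i1 := (hu.coneCurve_g hS hR hm hj).integrable hS hS.smooth_b.continuous
    (k := dt j g) ht
  have e : (fun x => b x * inner ℝ (dt j g t x) (dt j g t x)) =
      fun x => b x * ‖dt j g t x‖ ^ 2 := funext fun x => by rw [real_inner_self_eq_norm_sq]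
  rw [← e]
  exact ⟨i1, rfl⟩

lemma hasInt_srcE (hS : Setting a b c q)
    (hu : IsSolution m a b c q R h u g) {j : ℕ} (hj : j ≤ m) {t : ℝ} (ht : 0 ≤ t) :
    HasInt (fun x => dth h j t x ^ 2 / a x) (srcE a h j t) :=
  ⟨(srcE_eq hS hu hj ht).1, (srcE_eq hS hu hj ht).2.symm⟩

/-- The function `f` is continuous and nonnegative on `[T₀, T]`, and its integral is at most `B`. -/
structure TimeBound (T₀ T : ℝ) (f : ℝ → ℝ) (B : ℝ) : Prop where
  cont : ContinuousOn f (Icc T₀ T)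
  nonneg : ∀ t ∈ Icc T₀ T, 0 ≤ f t
  le : ∫ t in T₀..T, f t ≤ B

lemma TimeBound.add {T₀ T B B' : ℝ} {f f' : ℝ → ℝ} (hT : T₀ ≤ T) (hf : TimeBound T₀ T f B)
    (hf' : TimeBound T₀ T f' B') : TimeBound T₀ T (fun t => f t + f' t) (B + B') :=
  ⟨hf.cont.add hf'.cont, fun t ht => add_nonneg (hf.nonneg t ht) (hf'.nonneg t ht), by
    rw [intervalIntegral.integral_add (hf.cont.intervalIntegrable_of_Icc hT)
      (hf'.cont.intervalIntegrable_of_Icc hT)]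
    exact add_le_add hf.le hf'.le⟩

lemma TimeBound.const_mul {T₀ T B : ℝ} {f : ℝ → ℝ} (hf : TimeBound T₀ T f B) {r : ℝ}
    (hr : 0 ≤ r) : TimeBound T₀ T (fun t => r * f t) (r * B) :=
  ⟨continuousOn_const.mul hf.cont, fun t ht => mul_nonneg hr (hf.nonneg t ht), by
    rw [intervalIntegral.integral_const_mul]
    exact mul_le_mul_of_nonneg_left hf.le hr⟩

lemma TimeBound.lintegral_le {T₀ T B : ℝ} {f : ℝ → ℝ} (hT : T₀ ≤ T) (hf : TimeBound T₀ T f B) :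
    ∫⁻ t in Icc T₀ T, ENNReal.ofReal (f t) ≤ ENNReal.ofReal B := by
  rw [lintegral_Icc_ofReal hT hf.cont hf.nonneg]
  exact ENNReal.ofReal_le_ofReal hf.le

lemma levelR_mono (hS : Setting a b c q) {A θ T₀ T : ℝ} (hA : 1 ≤ A) (hT₀ : 0 ≤ T₀)
    (hT : T₀ ≤ T) (h : ℝ → Sp n → ℝ) (u : ℝ → L2 n) (g : ℝ → L2Vec n) {i j : ℕ} (hij : i ≤ j) :
    levelR a b c A θ T₀ h u g i T ≤ levelR a b c A θ T₀ h u g j T :=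
  monotone_nat_of_le_succ (f := fun j => levelR a b c A θ T₀ h u g j T)
    (fun k => (levelR_succ hS hA hT₀ hT h u g k).1) hij

lemma timeBound_srcE (hS : Setting a b c q) (hu : IsSolution m a b c q R h u g) {i j : ℕ}
    (hi : i ≤ m) (hij : i ≤ j) {A θ T₀ T : ℝ} (hA : 1 ≤ A) (hT₀ : 0 ≤ T₀) (hT : T₀ ≤ T) :
    TimeBound T₀ T (fun t => (A + t) ^ (θ + 2 * i + 1) * srcE a h i t)
      (levelR a b c A θ T₀ h u g j T) := by
  have hw : ∀ t ∈ Icc T₀ T, ∀ r : ℝ, 0 ≤ (A + t) ^ r := fun t ht r =>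
    Real.rpow_nonneg (by linarith [ht.1]) r
  have hn := hS.nonneg h u g
  refine ⟨(continuousOn_weight hA hT₀ _).mul ((continuousOn_srcE hS hu hi).mono
    fun t ht => hT₀.trans ht.1), fun t ht => mul_nonneg (hw t ht _) (hn i t).2.2.2, ?_⟩
  have h1 := Finset.single_le_sum (f := fun i : ℕ =>
    ∫ t in T₀..T, (A + t) ^ (θ + 2 * i + 1) * srcE a h i t) (s := Finset.range (j + 1))
    (fun i _ => intervalIntegral.integral_nonneg hT fun t ht =>
      mul_nonneg (hw t ht _) (hn i t).2.2.2) (Finset.mem_range.2 (Nat.lt_succ_of_le hij))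
  have h2 : 0 ≤ ∑ i ∈ Finset.range (j + 1), (kin c u i T₀ + pot b g i T₀) :=
    Finset.sum_nonneg fun i _ => add_nonneg (hn i _).1 (hn i _).2.1
  have h3 : 0 ≤ ∫ t in T₀..T, (A + t) ^ θ * (kin c u 0 t + pot b g 0 t) :=
    intervalIntegral.integral_nonneg hT fun t ht =>
      mul_nonneg (hw t ht _) (add_nonneg (hn 0 t).1 (hn 0 t).2.1)
  unfold levelR
  linarith

lemma timeBound_kin (hS : Setting a b c q) (hR : 0 < R) (hm : 1 ≤ m)
    (hu : IsSolution m a b c q R h u g) {j : ℕ} (hj : j ≤ m) {A θ T₀ T B : ℝ}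
    (hA : 1 ≤ A) (hT₀ : 0 ≤ T₀) (hT : T₀ ≤ T) (hB : levelL a b c A θ T₀ u g j T ≤ B) :
    TimeBound T₀ T (fun t => (A + t) ^ (θ + 2 * j + 1) * kin a u j t) B := by
  obtain ⟨n1, n2, n3⟩ := levelL_nonneg (θ := θ) hS hA hT₀ hT u g j
  refine ⟨(continuousOn_weight hA hT₀ _).mul ((continuousOn_kin hS hR hm hu
    hS.smooth_a.continuous hj).mono fun t ht => hT₀.trans ht.1), fun t ht =>
    mul_nonneg (Real.rpow_nonneg (by linarith [ht.1]) _) (hS.nonneg h u g j t).2.2.1, ?_⟩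
  unfold levelL at hB
  linarith

lemma timeBound_pot (hS : Setting a b c q) (hR : 0 < R) (hm : 1 ≤ m)
    (hu : IsSolution m a b c q R h u g) {j : ℕ} (hj : j ≤ m) {A θ T₀ T B : ℝ}
    (hA : 1 ≤ A) (hT₀ : 0 ≤ T₀) (hT : T₀ ≤ T) (hB : levelL a b c A θ T₀ u g j T ≤ B) :
    TimeBound T₀ T (fun t => (A + t) ^ (θ + 2 * j) * pot b g j t) B := by
  obtain ⟨n1, n2, n3⟩ := levelL_nonneg (θ := θ) hS hA hT₀ hT u g j
  have hsub : Icc T₀ T ⊆ Ici 0 := fun t ht => hT₀.trans ht.1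
  have ck := (continuousOn_kin hS hR hm hu hS.smooth_c.continuous hj).mono hsub
  have cp := (continuousOn_pot hS hR hm hu hj).mono hsub
  have hw := continuousOn_weight (T := T) hA hT₀ (θ + 2 * j)
  refine ⟨hw.mul cp, fun t ht =>
    mul_nonneg (Real.rpow_nonneg (by linarith [ht.1]) _) (hS.nonneg h u g j t).2.1, ?_⟩
  have h1 : ∫ t in T₀..T, (A + t) ^ (θ + 2 * j) * pot b g j t ≤
      ∫ t in T₀..T, (A + t) ^ (θ + 2 * j) * (kin c u j t + pot b g j t) :=
    intervalIntegral.integral_mono_on hT ((hw.mul cp).intervalIntegrable_of_Icc hT)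
      ((hw.mul (ck.add cp)).intervalIntegrable_of_Icc hT) fun t ht =>
      mul_le_mul_of_nonneg_left (by linarith [(hS.nonneg h u g j t).1])
        (Real.rpow_nonneg (by linarith [ht.1]) _)
  unfold levelL at hB
  linarith

/-- Pointwise bound for the weighted square of `M u`. -/
lemma spatialM_pointwise {a m w W Ω y₂ y₁ s : ℝ} (ha : 0 < a) (hm : 0 ≤ m) (hmw : m ≤ w)
    (hΩ : 0 ≤ Ω) (hΩW : Ω ≤ W) :
    Ω * (a * (m * y₂ + y₁ - s / a) ^ 2) ≤
      3 * (W * w ^ 2 * (a * y₂ ^ 2) + (W * (a * y₁ ^ 2) + W * (s ^ 2 / a))) := by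
  have h1 : (m * y₂ + y₁ - s / a) ^ 2 ≤ 3 * ((m * y₂) ^ 2 + y₁ ^ 2 + (s / a) ^ 2) := by
    nlinarith [sq_nonneg (m * y₂ - y₁), sq_nonneg (m * y₂ + s / a), sq_nonneg (y₁ + s / a)]
  have hW : 0 ≤ W := hΩ.trans hΩW
  calc Ω * (a * (m * y₂ + y₁ - s / a) ^ 2)
      ≤ W * (a * (3 * ((w ^ 2 * y₂ ^ 2) + y₁ ^ 2 + (s / a) ^ 2))) := by
        have : (m * y₂) ^ 2 ≤ w ^ 2 * y₂ ^ 2 := by rw [mul_pow]; gcongr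
        gcongr
        refine h1.trans ?_
        gcongr
    _ = _ := by field_simp; ring

lemma sq_sum_eight_le (s₁ s₂ s₃ s₄ s₅ s₆ s₇ s₈ : ℝ) :
    (s₁ + s₂ + s₃ + s₄ + (s₅ + s₆ + s₇ + s₈)) ^ 2 ≤
      8 * (s₁ ^ 2 + s₂ ^ 2 + s₃ ^ 2 + s₄ ^ 2 + s₅ ^ 2 + s₆ ^ 2 + s₇ ^ 2 + s₈ ^ 2) := by
  have h : ∀ x y : ℝ, (x + y) ^ 2 ≤ 2 * (x ^ 2 + y ^ 2) := fun x y => by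
    nlinarith [sq_nonneg (x - y)]
  have h1 := h (s₁ + s₂ + s₃ + s₄) (s₅ + s₆ + s₇ + s₈)
  have h2 := h (s₁ + s₂) (s₃ + s₄)
  have h3 := h (s₅ + s₆) (s₇ + s₈)
  have e2 : s₁ + s₂ + s₃ + s₄ = s₁ + s₂ + (s₃ + s₄) := by ring
  have e3 : s₅ + s₆ + s₇ + s₈ = s₅ + s₆ + (s₇ + s₈) := by ring
  rw [← e2] at h2
  rw [← e3] at h3
  linarith [h s₁ s₂, h s₃ s₄, h s₅ s₆, h s₇ s₈]

/-- Pointwise bound for the weighted square of `M² u`. -/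
lemma spatialMM_pointwise {a m w W Ω y₄ y₃ y₂ h₂ h₁ Z I O κ K K' ρ₁ ρ₂ : ℝ} (ha : 0 < a)
    (hm : 0 ≤ m) (hmw : m ≤ w) (hΩ : 0 ≤ Ω) (hΩW : Ω ≤ W * w ^ 2) (hΩ₁ : Ω * ρ₁ ≤ W * w ^ 3)
    (hΩ₂ : Ω * ρ₂ ≤ W * w ^ 2) (hκ : 0 ≤ κ) (hK : 0 ≤ K) (hK' : 0 ≤ K')
    (hI : a * (2 * I) ^ 2 ≤ 4 * (κ * (K * ρ₁))) (hO : O ^ 2 ≤ K' * ρ₂) :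
    Ω * (a * (m * (m * y₄ + y₃ - h₂ / a) + 2 * I + y₂ * O + (m * y₃ + y₂ - h₁ / a) - Z) ^ 2) ≤
      8 * (W * w ^ 6 * (a * y₄ ^ 2) + (4 * (W * w ^ 4 * (a * y₃ ^ 2)) +
        ((K' + 1) * (W * w ^ 2 * (a * y₂ ^ 2)) + (4 * K * (W * w ^ 3 * κ) +
        (W * w ^ 4 * (h₂ ^ 2 / a) + W * w ^ 2 * (h₁ ^ 2 / a)))))) + 8 * (Ω * (a * Z ^ 2)) := by
  have hw : 0 ≤ w := hm.trans hmw
  have h0 := sq_sum_eight_le (m ^ 2 * y₄) (2 * m * y₃) (-(m * (h₂ / a))) (2 * I) (y₂ * O) y₂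
    (-(h₁ / a)) (-Z)
  have e0 : m * (m * y₄ + y₃ - h₂ / a) + 2 * I + y₂ * O + (m * y₃ + y₂ - h₁ / a) - Z =
      m ^ 2 * y₄ + 2 * m * y₃ + -(m * (h₂ / a)) + 2 * I + (y₂ * O + y₂ + -(h₁ / a) + -Z) := by ring
  rw [← e0] at h0
  have hWw : 0 ≤ W * w ^ 2 := hΩ.trans hΩW
  have hm4 : m ^ 4 ≤ w ^ 4 := by gcongr
  have hm2 : m ^ 2 ≤ w ^ 2 := by gcongr
  have b1 : Ω * (a * (m ^ 2 * y₄) ^ 2) ≤ W * w ^ 6 * (a * y₄ ^ 2) := by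
    calc Ω * (a * (m ^ 2 * y₄) ^ 2) = Ω * m ^ 4 * (a * y₄ ^ 2) := by ring
      _ ≤ W * w ^ 2 * w ^ 4 * (a * y₄ ^ 2) := by gcongr
      _ = _ := by ring
  have b2 : Ω * (a * (2 * m * y₃) ^ 2) ≤ 4 * (W * w ^ 4 * (a * y₃ ^ 2)) := by
    calc Ω * (a * (2 * m * y₃) ^ 2) = 4 * (Ω * m ^ 2 * (a * y₃ ^ 2)) := by ring
      _ ≤ 4 * (W * w ^ 2 * w ^ 2 * (a * y₃ ^ 2)) := by gcongr
      _ = _ := by ring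
  have b3 : Ω * (a * (-(m * (h₂ / a))) ^ 2) ≤ W * w ^ 4 * (h₂ ^ 2 / a) := by
    calc Ω * (a * (-(m * (h₂ / a))) ^ 2) = Ω * m ^ 2 * (h₂ ^ 2 / a) := by field_simp
      _ ≤ W * w ^ 2 * w ^ 2 * (h₂ ^ 2 / a) := by gcongr
      _ = _ := by ring
  have b4 : Ω * (a * (2 * I) ^ 2) ≤ 4 * K * (W * w ^ 3 * κ) := by
    calc Ω * (a * (2 * I) ^ 2) ≤ Ω * (4 * (κ * (K * ρ₁))) := by gcongr
      _ = 4 * K * (Ω * ρ₁ * κ) := by ring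
      _ ≤ _ := by gcongr
  have b5 : Ω * (a * (y₂ * O) ^ 2) ≤ K' * (W * w ^ 2 * (a * y₂ ^ 2)) := by
    calc Ω * (a * (y₂ * O) ^ 2) = Ω * (a * (y₂ ^ 2 * O ^ 2)) := by ring
      _ ≤ Ω * (a * (y₂ ^ 2 * (K' * ρ₂))) := by gcongr
      _ = K' * (Ω * ρ₂ * (a * y₂ ^ 2)) := by ring
      _ ≤ _ := by gcongr
  have b6 : Ω * (a * y₂ ^ 2) ≤ W * w ^ 2 * (a * y₂ ^ 2) := by gcongr
  have b7 : Ω * (a * (-(h₁ / a)) ^ 2) ≤ W * w ^ 2 * (h₁ ^ 2 / a) := by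
    calc Ω * (a * (-(h₁ / a)) ^ 2) = Ω * (h₁ ^ 2 / a) := by field_simp
      _ ≤ _ := by gcongr
  have h1 := mul_le_mul_of_nonneg_left h0 (mul_nonneg hΩ ha.le)
  linarith

end

/-! ### Integration in time -/

section

variable {n : ℕ} {a b c : Sp n → ℝ} {q : ℝ → ℝ} {R : ℝ} {m : ℕ} {h : ℝ → Sp n → ℝ}
  {u : ℝ → L2 n} {g : ℝ → L2Vec n}

lemma weight_pow {A t : ℝ} (hw : 0 < A + t) (θ : ℝ) (j : ℕ) :
    (A + t) ^ (θ + 2 * (j : ℝ) + 1) = (A + t) ^ (θ + 2 * ((0 : ℕ) : ℝ) + 1) * (A + t) ^ (2 * j) := by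
  rw [← Real.rpow_add_natCast hw.ne']
  congr 1
  push_cast
  ring

/-- Bound for the weighted norm of `M u` at time `t`. -/
lemma lintegral_spatialM_le (hS : Setting a b c q) (hR : 0 < R) (hm : 1 ≤ m)
    (hu : IsSolution m a b c q R h u g) {A θ : ℝ} (hA : 1 ≤ A) (hθ : 0 < θ)
    (hdamp : ∀ t : ℝ, 0 ≤ t → ∀ x, q ‖x‖ ≤ t + q R → c x ≤ (A + t) * a x) {t : ℝ} (ht : 0 ≤ t) :
    ∫⁻ x, ENNReal.ofReal ((1 + t) ^ (θ + 1) * (a x * (spatialM a c h u 0 t x) ^ 2)) ≤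
      ENNReal.ofReal (3 * ((A + t) ^ (θ + 2 * ((1 : ℕ) : ℝ) + 1) * kin a u 1 t +
        ((A + t) ^ (θ + 2 * ((0 : ℕ) : ℝ) + 1) * kin a u 0 t +
          (A + t) ^ (θ + 2 * ((0 : ℕ) : ℝ) + 1) * srcE a h 0 t))) := by
  have hw : 0 < A + t := by linarith
  have hI := (((hasInt_kin hS hR hm hu hm ht).const_mul
    ((A + t) ^ (θ + 2 * ((1 : ℕ) : ℝ) + 1))).add
    (((hasInt_kin hS hR hm hu (Nat.zero_le _) ht).const_mul
      ((A + t) ^ (θ + 2 * ((0 : ℕ) : ℝ) + 1))).add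
    ((hasInt_srcE hS hu (Nat.zero_le _) ht).const_mul
      ((A + t) ^ (θ + 2 * ((0 : ℕ) : ℝ) + 1))))).const_mul 3
  rw [← hI.lintegral_eq fun x => by
    have := hS.pos_a x
    positivity]
  refine lintegral_mono_ae ?_
  filter_upwards [(hu.coneCurve_u hS hR hm hm).supp t ht,
    (hu.coneCurve_u hS hR hm (Nat.zero_le _)).supp t ht] with x h2 h1
  refine ENNReal.ofReal_le_ofReal ?_
  have hax := hS.pos_a x
  rcases le_or_gt (q ‖x‖) (t + q R) with hx | hx
  · have hmw : c x / a x ≤ A + t := by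
      rw [div_le_iff₀ hax]
      exact hdamp t ht x hx
    have hΩW : (1 + t) ^ (θ + 1) ≤ (A + t) ^ (θ + 2 * ((0 : ℕ) : ℝ) + 1) := by
      have e : θ + 2 * ((0 : ℕ) : ℝ) + 1 = θ + 1 := by push_cast; ring
      rw [e]
      exact Real.rpow_le_rpow (by linarith) (by linarith) (by linarith)
    have key := spatialM_pointwise (y₂ := dt (0 + 2) u t x) (y₁ := dt (0 + 1) u t x)
      (s := dth h 0 t x) hax (div_nonneg (hS.pos_c x).le hax.le) hmw (by positivity) hΩW
    rw [weight_pow hw θ 1]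
    exact key
  · have e : spatialM a c h u 0 t x = 0 := by
      rw [spatialM, h1 hx, hu.dth_eq_zero ht hx]
      have : dt (0 + 2) u t x = 0 := h2 hx
      rw [this]
      simp
    rw [e]
    simp only [ne_eq, OfNat.ofNat_ne_zero, not_false_eq_true, zero_pow, mul_zero]
    positivity

/-- Bound for the weighted norm of `M u`. -/
lemma exists_spatialM_bound (hS : Setting a b c q) (hR : 0 < R)
    (hdamp : EffectiveDamping a c q R) {θ T₀ : ℝ} (hθ : 0 < θ) (hT₀ : 0 ≤ T₀) :
    ∃ C : ℝ≥0, ∀ h u g, IsSolution 1 a b c q R h u g → ∀ T, T₀ ≤ T →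
      ∫⁻ t in Icc T₀ T, ∫⁻ x,
        ENNReal.ofReal ((1 + t) ^ (θ + 1) * (a x * (spatialM a c h u 0 t x) ^ 2)) ≤
      C * ((∑ i ∈ Finset.range 2, energy b c u g i T₀) +
        (∫⁻ t in Icc T₀ T, ENNReal.ofReal ((1 + t) ^ θ) * energy b c u g 0 t) +
        sourceTerm a θ h 1 T₀ T) := by
  obtain ⟨A, hA, hA', hlev⟩ := level_estimate hS hR hdamp hθ hT₀ 1
  obtain ⟨C₀, hC₀, hl₀⟩ := hlev 0 (by norm_num)
  obtain ⟨C₁, hC₁, hl₁⟩ := hlev 1 le_rfl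
  refine ⟨(3 * (C₁ + (C₀ + 1)) * (2 * A ^ (θ + 2 * ((1 : ℕ) : ℝ) + 1))).toNNReal, ?_⟩
  intro h u g hu T hT
  set Λ := levelR a b c A θ T₀ h u g 1 T
  have hΛ : levelR a b c A θ T₀ h u g 0 T ≤ Λ := levelR_mono hS hA hT₀ hT h u g (Nat.zero_le _)
  have k1 := timeBound_kin hS hR le_rfl hu le_rfl hA hT₀ hT (hl₁ 1 h u g le_rfl le_rfl hu T hT)
  have k0 := timeBound_kin hS hR le_rfl hu (Nat.zero_le _) hA hT₀ hT
    ((hl₀ 1 h u g le_rfl (Nat.zero_le _) hu T hT).trans (mul_le_mul_of_nonneg_left hΛ hC₀))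
  have s0 := timeBound_srcE (θ := θ) hS hu (Nat.zero_le 1) (Nat.zero_le 1) hA hT₀ hT (g := g)
  have hb := (k1.add hT (k0.add hT s0)).const_mul (r := 3) (by norm_num)
  calc _ ≤ ∫⁻ t in Icc T₀ T, ENNReal.ofReal (3 * ((A + t) ^ (θ + 2 * ((1 : ℕ) : ℝ) + 1) *
        kin a u 1 t + ((A + t) ^ (θ + 2 * ((0 : ℕ) : ℝ) + 1) * kin a u 0 t +
          (A + t) ^ (θ + 2 * ((0 : ℕ) : ℝ) + 1) * srcE a h 0 t))) :=
        setLIntegral_mono' measurableSet_Icc fun t ht =>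
          lintegral_spatialM_le hS hR le_rfl hu hA hθ hA' (hT₀.trans ht.1)
    _ ≤ ENNReal.ofReal (3 * (C₁ * Λ + (C₀ * Λ + Λ))) := hb.lintegral_le hT
    _ = ENNReal.ofReal (3 * (C₁ + (C₀ + 1))) * ENNReal.ofReal Λ := by
        rw [← ENNReal.ofReal_mul (by positivity)]
        congr 1
        ring
    _ ≤ _ := mul_le_mul' le_rfl (ofReal_levelR_le hS hR le_rfl hu le_rfl hA hθ hT₀ hT)
    _ = _ := by
        rw [← mul_assoc, ← ENNReal.ofReal_mul (by positivity)]
        rfl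

/-- Bound for the weighted norm of `M² u` at time `t`.  The constants `K₁`, `K₂` may be negative, whence
the maxima. -/
lemma lintegral_spatialMM_le (hS : Setting a b c q) (hR : 0 < R) (hm : 3 ≤ m)
    (hu : IsSolution m a b c q R h u g) {A θ lam₁ lam₂ K₁ K₂ : ℝ} (hA : 1 ≤ A) (hθ : 0 < θ)
    (hlam₁ : lam₁ ∈ Icc (0 : ℝ) 1) (hlam₂ : lam₂ ∈ Icc (0 : ℝ) 1)
    (hdamp : ∀ t : ℝ, 0 ≤ t → ∀ x, q ‖x‖ ≤ t + q R → c x ≤ (A + t) * a x)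
    (hc1 : CoeffCond1 a b c lam₁ K₁ u) (hc2 : CoeffCond2 a b c lam₂ K₂ u) {t : ℝ} (ht : 0 ≤ t) :
    ∫⁻ x, ENNReal.ofReal ((1 + t) ^ (θ + 3 - lam₂) * (a x * (spatialMM a b c h u g t x) ^ 2)) ≤
      ENNReal.ofReal (8 * ((A + t) ^ (θ + 2 * ((3 : ℕ) : ℝ) + 1) * kin a u 3 t +
        (4 * ((A + t) ^ (θ + 2 * ((2 : ℕ) : ℝ) + 1) * kin a u 2 t) +
        ((max K₂ 0 + 1) * ((A + t) ^ (θ + 2 * ((1 : ℕ) : ℝ) + 1) * kin a u 1 t) +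
        (4 * max K₁ 0 * ((A + t) ^ (θ + 2 * ((2 : ℕ) : ℝ)) * pot b g 2 t) +
        ((A + t) ^ (θ + 2 * ((2 : ℕ) : ℝ) + 1) * srcE a h 2 t +
        (A + t) ^ (θ + 2 * ((1 : ℕ) : ℝ) + 1) * srcE a h 1 t)))))) +
      8 * ∫⁻ x, ENNReal.ofReal ((1 + t) ^ (θ + 3 - lam₂) *
        (a x * (opM a b (fun y => h t y / a y) x) ^ 2)) := by
  have hm1 : 1 ≤ m := by omega
  have hw : 0 < A + t := by linarith
  have h1t : 0 < 1 + t := by linarith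
  have hI := (((hasInt_kin hS hR hm1 hu (j := 3) hm ht).const_mul
      ((A + t) ^ (θ + 2 * ((3 : ℕ) : ℝ) + 1))).add
    ((((hasInt_kin hS hR hm1 hu (j := 2) (by omega) ht).const_mul
      ((A + t) ^ (θ + 2 * ((2 : ℕ) : ℝ) + 1))).const_mul 4).add
    ((((hasInt_kin hS hR hm1 hu (j := 1) (by omega) ht).const_mul
      ((A + t) ^ (θ + 2 * ((1 : ℕ) : ℝ) + 1))).const_mul (max K₂ 0 + 1)).add
    ((((hasInt_pot hS hR hm1 hu (j := 2) (by omega) ht).const_mul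
      ((A + t) ^ (θ + 2 * ((2 : ℕ) : ℝ)))).const_mul (4 * max K₁ 0)).add
    (((hasInt_srcE hS hu (j := 2) (by omega) ht).const_mul
      ((A + t) ^ (θ + 2 * ((2 : ℕ) : ℝ) + 1))).add
    ((hasInt_srcE hS hu (j := 1) (by omega) ht).const_mul
      ((A + t) ^ (θ + 2 * ((1 : ℕ) : ℝ) + 1)))))))).const_mul 8
  have hp : ∀ x, 0 < a x ∧ 0 < b x := fun x => ⟨hS.pos_a x, hS.pos_b x⟩
  have hnn : ∀ x, 0 ≤ 8 * ((A + t) ^ (θ + 2 * ((3 : ℕ) : ℝ) + 1) * (a x * dt (3 + 1) u t x ^ 2) +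
      (4 * ((A + t) ^ (θ + 2 * ((2 : ℕ) : ℝ) + 1) * (a x * dt (2 + 1) u t x ^ 2)) +
      ((max K₂ 0 + 1) * ((A + t) ^ (θ + 2 * ((1 : ℕ) : ℝ) + 1) * (a x * dt (1 + 1) u t x ^ 2)) +
      (4 * max K₁ 0 * ((A + t) ^ (θ + 2 * ((2 : ℕ) : ℝ)) * (b x * ‖dt 2 g t x‖ ^ 2)) +
      ((A + t) ^ (θ + 2 * ((2 : ℕ) : ℝ) + 1) * (dth h 2 t x ^ 2 / a x) +
      (A + t) ^ (θ + 2 * ((1 : ℕ) : ℝ) + 1) * (dth h 1 t x ^ 2 / a x)))))) := fun x => by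
    obtain ⟨h1, h2⟩ := hp x
    positivity
  rw [← hI.lintegral_eq hnn, ← lintegral_const_mul' _ _ (by norm_num),
    ← lintegral_add_left' hI.1.aemeasurable.ennreal_ofReal]
  refine lintegral_mono_ae ?_
  filter_upwards [(hu.coneCurve_u hS hR hm1 (j := 3) hm).supp t ht,
    (hu.coneCurve_u hS hR hm1 (j := 2) (by omega)).supp t ht,
    (hu.coneCurve_u hS hR hm1 (j := 1) (by omega)).supp t ht,
    (hu.coneCurve_g hS hR hm1 (j := 2) (by omega)).supp t ht,
    (hu.isWeakM_zero hS hm1 ht).eq_zero_of_notMem_essSupport hS.smooth_a.continuous hS.pos_a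
      (hu.isWeakM_spatialM hS hm ht)] with x z4 z3 z2 zg hess
  obtain ⟨hax, hbx⟩ := hp x
  have hΩ : 0 ≤ (1 + t) ^ (θ + 3 - lam₂) := by positivity
  have e8 : (8 : ℝ≥0∞) = ENNReal.ofReal 8 := by norm_num
  rw [e8, ← ENNReal.ofReal_mul (by norm_num), ← ENNReal.ofReal_add (hnn x) (by positivity)]
  refine ENNReal.ofReal_le_ofReal ?_
  have hZ : 0 ≤ 8 * ((1 + t) ^ (θ + 3 - lam₂) *
      (a x * (opM a b (fun y => h t y / a y) x) ^ 2)) := by positivity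
  by_cases hxs : x ∈ essSupport (u t)
  swap
  · rw [hess hxs]
    have h0 := hnn x
    simp only [ne_eq, OfNat.ofNat_ne_zero, not_false_eq_true, zero_pow, mul_zero]
    linarith
  rcases le_or_gt (q ‖x‖) (t + q R) with hx | hx
  · have hmw : c x / a x ≤ A + t := by
      rw [div_le_iff₀ hax]
      exact hdamp t ht x hx
    have hm0 : 0 ≤ c x / a x := div_nonneg (hS.pos_c x).le hax.le
    -- The worst weight, `(1 + t)^(θ + 3 - λ₂ + λ₁)` in the term with `∇ u_tt`, is at most `w^(θ + 4)`.
    have hpow : ∀ (s : ℝ) (k : ℕ), s ≤ θ + 1 + k →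
        (1 + t) ^ s ≤ (A + t) ^ (θ + 2 * ((0 : ℕ) : ℝ) + 1) * (A + t) ^ k := by
      intro s k hs
      have e : (A + t) ^ (θ + 2 * ((0 : ℕ) : ℝ) + 1) * (A + t) ^ k = (A + t) ^ (θ + 1 + k) := by
        rw [← Real.rpow_add_natCast hw.ne']
        congr 1
        push_cast
        ring
      rw [e]
      exact (Real.rpow_le_rpow_of_exponent_le (by linarith) hs).trans
        (Real.rpow_le_rpow h1t.le (by linarith) (by positivity))
    have hK₁ : b x / a x * ‖∇ (fun y => c y / a y) x‖ ^ 2 ≤ max K₁ 0 * (1 + t) ^ lam₁ := by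
      have h1 := hc1 t ht x hxs
      have h2 : K₁ * (1 + t) ^ lam₁ ≤ max K₁ 0 * (1 + t) ^ lam₁ := by
        gcongr
        exact le_max_left _ _
      linarith
    have hK₂ : opM a b (fun y => c y / a y) x ^ 2 ≤ max K₂ 0 * (1 + t) ^ lam₂ :=
      (hc2 t ht x hxs).trans (by gcongr; exact le_max_left _ _)
    have key := spatialMM_pointwise (W := (A + t) ^ (θ + 2 * ((0 : ℕ) : ℝ) + 1))
      (Ω := (1 + t) ^ (θ + 3 - lam₂)) (y₄ := dt (3 + 1) u t x) (y₃ := dt (2 + 1) u t x)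
      (y₂ := dt (1 + 1) u t x) (h₂ := dth h 2 t x) (h₁ := dth h 1 t x)
      (Z := opM a b (fun y => h t y / a y) x)
      (I := b x / a x * inner ℝ (dt 2 g t x) (∇ (fun y => c y / a y) x))
      (κ := b x * ‖dt 2 g t x‖ ^ 2) (ρ₁ := (1 + t) ^ lam₁) (K := max K₁ 0) hax hm0 hmw hΩ
      (hpow _ 2 (by push_cast; linarith [hlam₂.1]))
      (by
        rw [← Real.rpow_add h1t]
        exact hpow _ 3 (by push_cast; linarith [hlam₂.1, hlam₁.2]))
      (by
        rw [← Real.rpow_add h1t]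
        exact hpow _ 2 (by push_cast; linarith))
      (by positivity) (le_max_right _ _) (le_max_right _ _) ?_ hK₂
    · have e4 : (A + t) ^ (θ + 2 * ((2 : ℕ) : ℝ)) =
          (A + t) ^ (θ + 2 * ((0 : ℕ) : ℝ) + 1) * (A + t) ^ 3 := by
        rw [← Real.rpow_add_natCast hw.ne']
        congr 1
        push_cast
        ring
      rw [weight_pow hw θ 3, weight_pow hw θ 2, weight_pow hw θ 1, e4]
      exact key
    · have h1 : (inner ℝ (dt 2 g t x) (∇ (fun y => c y / a y) x)) ^ 2 ≤
          ‖dt 2 g t x‖ ^ 2 * ‖∇ (fun y => c y / a y) x‖ ^ 2 := by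
        rw [← mul_pow, ← sq_abs]
        exact pow_le_pow_left₀ (abs_nonneg _) (abs_real_inner_le_norm _ _) 2
      calc a x * (2 * (b x / a x * inner ℝ (dt 2 g t x) (∇ (fun y => c y / a y) x))) ^ 2
          = 4 * (b x * (b x / a x *
            (inner ℝ (dt 2 g t x) (∇ (fun y => c y / a y) x)) ^ 2)) := by
            field_simp
            ring
        _ ≤ 4 * (b x * (b x / a x *
            (‖dt 2 g t x‖ ^ 2 * ‖∇ (fun y => c y / a y) x‖ ^ 2))) := by gcongr
        _ = 4 * (b x * ‖dt 2 g t x‖ ^ 2 *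
            (b x / a x * ‖∇ (fun y => c y / a y) x‖ ^ 2)) := by ring
        _ ≤ _ := by gcongr
  · have y4 : dt (2 + 2) u t x = 0 := z4 hx
    have y3 : dt (1 + 2) u t x = 0 := z3 hx
    have y2 : dt (1 + 1) u t x = 0 := z2 hx
    have e : spatialMM a b c h u g t x = - opM a b (fun y => h t y / a y) x := by
      rw [spatialMM, spatialM, spatialM, y4, y3, y2, zg hx, hu.dth_eq_zero ht hx,
        hu.dth_eq_zero ht hx]
      simp
    rw [e, neg_sq]
    have h0 := hnn x
    have h1 : 0 ≤ (1 + t) ^ (θ + 3 - lam₂) *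
      (a x * (opM a b (fun y => h t y / a y) x) ^ 2) := by positivity
    linarith

/-- Bound for the weighted norm of `M² u`. -/
lemma exists_spatialMM_bound (hS : Setting a b c q) (hR : 0 < R)
    (hdamp : EffectiveDamping a c q R) {θ T₀ lam₁ lam₂ K₁ K₂ : ℝ} (hθ : 0 < θ) (hT₀ : 0 ≤ T₀)
    (hlam₁ : lam₁ ∈ Icc (0 : ℝ) 1) (hlam₂ : lam₂ ∈ Icc (0 : ℝ) 1) :
    ∃ C : ℝ≥0, ∀ h u g, IsSolution 3 a b c q R h u g → CoeffCond1 a b c lam₁ K₁ u →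
      CoeffCond2 a b c lam₂ K₂ u → ∀ T, T₀ ≤ T →
      ∫⁻ t in Icc T₀ T, ∫⁻ x,
        ENNReal.ofReal ((1 + t) ^ (θ + 3 - lam₂) * (a x * (spatialMM a b c h u g t x) ^ 2)) ≤
      C * ((∑ i ∈ Finset.range 4, energy b c u g i T₀) +
        (∫⁻ t in Icc T₀ T, ENNReal.ofReal ((1 + t) ^ θ) * energy b c u g 0 t) +
        sourceTerm a θ h 3 T₀ T) +
      8 * ∫⁻ t in Icc T₀ T, ∫⁻ x, ENNReal.ofReal ((1 + t) ^ (θ + 3 - lam₂) *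
        (a x * (opM a b (fun y => h t y / a y) x) ^ 2)) := by
  obtain ⟨A, hA, hA', hlev⟩ := level_estimate hS hR hdamp hθ hT₀ 3
  obtain ⟨C₁, hC₁, hl₁⟩ := hlev 1 (by norm_num)
  obtain ⟨C₂, hC₂, hl₂⟩ := hlev 2 (by norm_num)
  obtain ⟨C₃, hC₃, hl₃⟩ := hlev 3 le_rfl
  have hk₁ : 0 ≤ max K₁ 0 := le_max_right _ _
  have hk₂ : 0 ≤ max K₂ 0 := le_max_right _ _
  set B := 8 * (C₃ + (4 * C₂ + ((max K₂ 0 + 1) * C₁ + (4 * max K₁ 0 * C₂ + (1 + 1))))) with hB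
  have hB0 : 0 ≤ B := by positivity
  refine ⟨(B * (2 * A ^ (θ + 2 * ((3 : ℕ) : ℝ) + 1))).toNNReal, ?_⟩
  intro h u g hu hc1 hc2 T hT
  have h13 : 1 ≤ 3 := by norm_num
  set Λ := levelR a b c A θ T₀ h u g 3 T
  have hΛ : ∀ i, i ≤ 3 → levelR a b c A θ T₀ h u g i T ≤ Λ := fun i hi =>
    levelR_mono hS hA hT₀ hT h u g hi
  have l1 := (hl₁ 3 h u g h13 (by norm_num) hu T hT).trans
    (mul_le_mul_of_nonneg_left (hΛ 1 (by norm_num)) hC₁)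
  have l2 := (hl₂ 3 h u g h13 (by norm_num) hu T hT).trans
    (mul_le_mul_of_nonneg_left (hΛ 2 (by norm_num)) hC₂)
  have l3 := (hl₃ 3 h u g h13 (by norm_num) hu T hT).trans
    (mul_le_mul_of_nonneg_left (hΛ 3 (by norm_num)) hC₃)
  have k1 := timeBound_kin hS hR h13 hu (by norm_num) hA hT₀ hT l1
  have k2 := timeBound_kin hS hR h13 hu (by norm_num) hA hT₀ hT l2
  have k3 := timeBound_kin hS hR h13 hu (by norm_num) hA hT₀ hT l3
  have p2 := timeBound_pot hS hR h13 hu (by norm_num) hA hT₀ hT l2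
  have s2 := timeBound_srcE (θ := θ) (i := 2) (j := 3) hS hu (by norm_num) (by norm_num)
    hA hT₀ hT (g := g)
  have s1 := timeBound_srcE (θ := θ) (i := 1) (j := 3) hS hu (by norm_num) (by norm_num)
    hA hT₀ hT (g := g)
  have hb := (k3.add hT ((k2.const_mul (r := 4) (by norm_num)).add hT
    ((k1.const_mul (r := max K₂ 0 + 1) (by positivity)).add hT
    ((p2.const_mul (r := 4 * max K₁ 0) (by positivity)).add hT
    (s2.add hT s1))))).const_mul (r := 8) (by norm_num)
  have hmeas := (hb.cont.aemeasurable measurableSet_Icc (μ := volume)).ennreal_ofReal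
  calc _ ≤ ∫⁻ t in Icc T₀ T, (ENNReal.ofReal _ + 8 * ∫⁻ x, ENNReal.ofReal
        ((1 + t) ^ (θ + 3 - lam₂) * (a x * (opM a b (fun y => h t y / a y) x) ^ 2))) :=
        setLIntegral_mono' measurableSet_Icc fun t ht =>
          lintegral_spatialMM_le hS hR le_rfl hu hA hθ hlam₁ hlam₂ hA' hc1 hc2 (hT₀.trans ht.1)
    _ = _ := lintegral_add_left' hmeas _
    _ ≤ ENNReal.ofReal (B * Λ) + 8 * ∫⁻ t in Icc T₀ T, ∫⁻ x, ENNReal.ofReal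
        ((1 + t) ^ (θ + 3 - lam₂) * (a x * (opM a b (fun y => h t y / a y) x) ^ 2)) := by
        rw [lintegral_const_mul' _ _ (by norm_num)]
        refine add_le_add ((hb.lintegral_le hT).trans_eq ?_) le_rfl
        congr 1
        rw [hB]
        ring
    _ ≤ _ := by
        refine add_le_add ?_ le_rfl
        rw [ENNReal.ofReal_mul hB0]
        refine (mul_le_mul' le_rfl
          (ofReal_levelR_le hS hR h13 hu le_rfl hA hθ hT₀ hT)).trans_eq ?_
        rw [← mul_assoc, ← ENNReal.ofReal_mul hB0]
        rfl

end

end DampedWave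

end

theorem proposition4p2 (n : ℕ)
    (a b c : Sp n → ℝ)
    (ha : ContDiff ℝ ∞ a) (hb : ContDiff ℝ ∞ b) (hc : ContDiff ℝ ∞ c)
    (α β γ a₀ a₁ b₀ b₁ c₀ c₁ : ℝ)
    (ha₀ : 0 < a₀) (ha₁ : 0 < a₁) (hb₀ : 0 < b₀) (hb₁ : 0 < b₁) (hc₀ : 0 < c₀) (hc₁ : 0 < c₁)
    (ha_growth : PowerGrowth a a₀ a₁ (-α))
    (hb_growth : PowerGrowth b b₀ b₁ β)
    (hc_growth : PowerGrowth c c₀ c₁ (-γ))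
    (hβγ : β + γ < 2) (hαβγ : 2 * α + β - γ < 2)
    (R : ℝ) (hR : 0 < R)
    (q : ℝ → ℝ) (q₀ : ℝ) (hq₀ : 0 < q₀)
    (hq : IsSpeedBound b c q q₀ (1 - (β + γ) / 2))
    (θ : ℝ) (hθ : 0 < θ)
    (lam₁ lam₂ : ℝ) (hlam₁ : lam₁ ∈ Set.Icc (0 : ℝ) 1) (hlam₂ : lam₂ ∈ Set.Icc (0 : ℝ) 1)
    (K₁ K₂ : ℝ)
    (T₀ : ℝ) (hT₀ : 0 ≤ T₀) :
    ∃ C : ℝ≥0,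
      -- part (i)
      (∀ (h : ℝ → Sp n → ℝ) (u : ℝ → L2 n) (g : ℝ → L2Vec n),
        IsSolution 1 a b c q R h u g → CoeffCond1 a b c lam₁ K₁ u →
        ∃ Mu : ℝ → Sp n → ℝ,
          (∀ t : ℝ, 0 ≤ t → IsWeakM a b (u t) (Mu t)) ∧
          ∀ T : ℝ, T₀ ≤ T →
            ∫⁻ t in Set.Icc T₀ T, ∫⁻ x,
                ENNReal.ofReal ((1 + t) ^ (θ + 1) * (a x * (Mu t x) ^ 2))
              ≤ (C : ℝ≥0∞) *
                (ENNReal.ofReal ((1 + T₀) ^ (θ + 1)) *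
                    ∑ i ∈ Finset.range 2, energy b c u g i T₀
                  + (∫⁻ t in Set.Icc T₀ T, ENNReal.ofReal ((1 + t) ^ θ) * energy b c u g 0 t)
                  + sourceTerm a θ h 1 T₀ T)) ∧
      -- part (ii)
      (∀ (h : ℝ → Sp n → ℝ) (u : ℝ → L2 n) (g : ℝ → L2Vec n),
        IsSolution 3 a b c q R h u g →
        CoeffCond1 a b c lam₁ K₁ u → CoeffCond2 a b c lam₂ K₂ u →
        ∃ Mu MMu : ℝ → Sp n → ℝ,
          (∀ t : ℝ, 0 ≤ t → IsWeakM a b (u t) (Mu t)) ∧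
          (∀ t : ℝ, 0 ≤ t → IsWeakM a b (Mu t) (MMu t)) ∧
          ∀ T : ℝ, T₀ ≤ T →
            ∫⁻ t in Set.Icc T₀ T, ∫⁻ x,
                ENNReal.ofReal ((1 + t) ^ (θ + 3 - lam₂) * (a x * (MMu t x) ^ 2))
              ≤ (C : ℝ≥0∞) *
                (ENNReal.ofReal ((1 + T₀) ^ (θ + 3)) *
                    ∑ i ∈ Finset.range 4, energy b c u g i T₀
                  + (∫⁻ t in Set.Icc T₀ T, ENNReal.ofReal ((1 + t) ^ θ) * energy b c u g 0 t)
                  + sourceTerm a θ h 3 T₀ T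
                  + ∫⁻ t in Set.Icc T₀ T, ∫⁻ x, ENNReal.ofReal ((1 + t) ^ (θ + 3 - lam₂) *
                      ((dt 1 (fun s => h s x) t) ^ 2 / a x
                        + (1 + t) ^ (2 * lam₁) * ((dt 2 (fun s => h s x) t) ^ 2 / a x)
                        + a x * (opM a b (fun y => h t y / a y) x) ^ 2)))) := by
  have hp : 0 < 1 - (β + γ) / 2 := by linarith
  have hpa := ha_growth.pos ha₀
  have hS : Setting a b c q := setting_of_growth ha hb hc hpa (hb_growth.pos hb₀)
    (hc_growth.pos hc₀) hq₀ hp hq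
  have hdamp : EffectiveDamping a c q R :=
    effectiveDamping_of_growth ha₀ hc₁ ha_growth hc_growth hq₀ hp (by linarith) hq
  obtain ⟨C₁, hC₁⟩ := exists_spatialM_bound hS hR hdamp hθ hT₀
  obtain ⟨C₂, hC₂⟩ := exists_spatialMM_bound (K₁ := K₁) (K₂ := K₂) hS hR hdamp hθ hT₀ hlam₁ hlam₂
  have hone : ∀ s : ℝ, 0 ≤ s → ∀ S : ℝ≥0∞, S ≤ ENNReal.ofReal ((1 + T₀) ^ s) * S := fun s hs S =>
    le_mul_of_one_le_left' (ENNReal.one_le_ofReal.2 (Real.one_le_rpow (by linarith) hs))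
  refine ⟨C₁ + C₂ + 8, fun h u g hu _ => ⟨fun t => spatialM a c h u 0 t,
    fun t ht => hu.isWeakM_zero hS le_rfl ht, fun T hT => (hC₁ h u g hu T hT).trans ?_⟩,
    fun h u g hu hc1 hc2 => ⟨fun t => spatialM a c h u 0 t, fun t => spatialMM a b c h u g t,
    fun t ht => hu.isWeakM_zero hS (by norm_num) ht, fun t ht => hu.isWeakM_spatialM hS le_rfl ht,
    fun T hT => (hC₂ h u g hu hc1 hc2 T hT).trans ?_⟩⟩
  · refine mul_le_mul' ?_ (add_le_add (add_le_add (hone _ (by linarith) _) le_rfl) le_rfl)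
    push_cast
    rw [add_assoc]
    exact le_self_add
  · refine (add_le_add (mul_le_mul' ?_ (add_le_add (add_le_add (hone _ (by linarith) _) le_rfl)
      le_rfl)) (mul_le_mul' ?_ ?_)).trans_eq (mul_add _ _ _).symm
    · push_cast
      rw [add_assoc, add_left_comm]
      exact le_self_add
    · push_cast
      exact le_add_self
    · -- The terms with `h_t` and `h_tt` are not needed, as `sourceTerm` already controls them.
      refine setLIntegral_mono' measurableSet_Icc fun t ht => lintegral_mono fun x =>
        ENNReal.ofReal_le_ofReal ?_
      have hax := hpa x
      have h1t : 0 < 1 + t := by linarith [ht.1]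
      refine mul_le_mul_of_nonneg_left (le_add_of_nonneg_left ?_) (by positivity)
      positivity
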